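/- **Setting.** Let $Q:\mathbb C\to\mathbb R\cup\{+\infty\}$ be rotation-invariant, $Q(z)=q(|z|)$, lower semicontinuous, with $\liminf_{|z|\to\infty}\frac{Q(z)}{2\log|z|}>1$. For $n\ge 1$ let $(z_1,\dots,z_n)$ be distributed on $\mathbb C^n$ according to $$d\mathbb P_n=\frac1{Z_n}\prod_{1\le j<k\le n}|z_k-z_j|^2\prod_{j=1}^n e^{-nQ(z_j)}\,\frac{d^2z_j}{\pi},$$ where $d^2z$ is Lebesgue measure and $Z_n$ is the normalizing constant. The equilibrium measure $\sigma$ is the minimizer, over compactly supported Borel probability measures $\mu$ on $\mathbb C$, of $\iint\log\frac1{|z-w|}\,d\mu(z)\,d\mu(w)+\int Q\,d\mu$. The obstacle function $\check Q(z)$ is the supremum of $s(z)$ over all subharmonic $s:\mathbb C\to\mathbb R$ with $s\le Q$ and $s(w)\le 2\log|w|+O(1)$ as $|w|\to\infty$; the coincidence set is $S^*=\{z: Q(z)=\check Q(z)\}$. Write $\Delta=\frac14(\partial_x^2+\partial_y^2)$, and $\Delta Q(r)$ for the value of $\Delta Q$ on the circle $|z|=r$. Assume that (Case 2) $$S^*=\{a_0\le|z|\le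 b_0\}\cup\bigcup_{k=1}^m\{|z|=t_k\}\cup\{a_1\le|z|\le b_1\},\qquad 0\le a_0<b_0<t_1<\dots<t_m<a_1<b_1,$$ and that $Q$ is $C^6$-smooth in a neighbourhood of $S^*$ with $\Delta Q>0$ on $S^*$. Let $\varepsilon>0$ be such that the $2\varepsilon$-neighbourhoods of the outposts $\{|z|=t_k\}$ are pairwise disjoint and do not meet the interior of the droplet $\{a_0\le|z|\le b_0\}\cup\{a_1\le|z|\le b_1\}$; that is, $t_k+2\varepsilon\le t_l-2\varepsilon$ for $k<l$, and $b_0\le t_k-2\varepsilon$, $t_k+2\varepsilon\le a_1$ for all $k$. With $\eta(u)=e^{-1/u}$ for $u>0$, $\eta(u)=0$ for $u\le0$, and $\widehat\eta(u)=\frac{\eta(u)}{\eta(u)+\eta(1-u)}$, set for $k=1,\dots,m$ $$h_k(z)=\widehat\eta\Bigl(\tfrac{|z|-(t_k-\varepsilon)}{\varepsilon/2}\Bigr)\,\widehat\eta\Bigl(\tfrac{(t_k+\varepsilon)-|z|}{\varepsilon/2}\Bigr),\qquad N_{n,k}=\sum_{j=1}^n h_k(z_j).$$ Let $M_0=\sigma(\{|z|\le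 b_0\})$, $x_n=M_0n-\lfloor M_0n\rfloor$, and $$\widetilde\rho_0=\widehat\rho_{m+1}=\frac{b_0}{a_1},\qquad \widetilde\rho_k=\frac{t_k}{a_1},\qquad \widehat\rho_k=\frac{b_0}{t_k}\qquad(1\le k\le m),$$ $$\widetilde\vartheta_{0,n}=\sqrt{\tfrac{\Delta Q(a_1)}{\Delta Q(b_0)}}\,\widetilde\rho_0^{\,-2x_n},\quad \widehat\vartheta_{m+1,n}=\widetilde\vartheta_{0,n}^{-1},\quad \widetilde\vartheta_{k,n}=\sqrt{\tfrac{\Delta Q(a_1)}{\Delta Q(t_k)}}\,\widetilde\rho_k^{\,-2x_n},\quad \widehat\vartheta_{k,n}=\sqrt{\tfrac{\Delta Q(b_0)}{\Delta Q(t_k)}}\,\widehat\rho_k^{\,2x_n}\quad(1\le k\le m).$$ **Statement.** Let $p,q\in\{1,\dots,m\}$, $p\ne q$ (for the covariance). All the series below converge, and as $n\to\infty$ $$\mathbb E[N_{n,p}]=\sum_{j=0}^\infty\frac{\widetilde\vartheta_{p,n}\widetilde\rho_p^{\,2j+1}}{1+\sum_{k=0}^m\widetilde\vartheta_{k,n}\widetilde\rho_k^{\,2j+1}}+\sum_{j=0}^\infty\frac{\widehat\vartheta_{p,n}\widehat\rho_p^{\,2j+1}}{1+\sum_{k=1}^{m+1}\widehat\vartheta_{k,n}\widehat\rho_k^{\,2j+1}}+o(1),$$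 $$\operatorname{Var}[N_{n,p}]=\sum_{j=0}^\infty\frac{\widetilde\vartheta_{p,n}\widetilde\rho_p^{\,2j+1}\bigl(1+\sum_{k=0,\,k\ne p}^m\widetilde\vartheta_{k,n}\widetilde\rho_k^{\,2j+1}\bigr)}{\bigl(1+\sum_{k=0}^m\widetilde\vartheta_{k,n}\widetilde\rho_k^{\,2j+1}\bigr)^2}+\sum_{j=0}^\infty\frac{\widehat\vartheta_{p,n}\widehat\rho_p^{\,2j+1}\bigl(1+\sum_{k=1,\,k\ne p}^{m+1}\widehat\vartheta_{k,n}\widehat\rho_k^{\,2j+1}\bigr)}{\bigl(1+\sum_{k=1}^{m+1}\widehat\vartheta_{k,n}\widehat\rho_k^{\,2j+1}\bigr)^2}+o(1),$$ $$\operatorname{Cov}(N_{n,p},N_{n,q})=-\sum_{j=0}^\infty\frac{\widetilde\vartheta_{p,n}\widetilde\rho_p^{\,2j+1}\,\widetilde\vartheta_{q,n}\widetilde\rho_q^{\,2j+1}}{\bigl(1+\sum_{k=0}^m\widetilde\vartheta_{k,n}\widetilde\rho_k^{\,2j+1}\bigr)^2}-\sum_{j=0}^\infty\frac{\widehat\vartheta_{p,n}\widehat\rho_p^{\,2j+1}\,\widehat\vartheta_{q,n}\widehat\rho_q^{\,2j+1}}{\bigl(1+\sum_{k=1}^{m+1}\widehat\vartheta_{k,n}\widehat\rho_k^{\,2j+1}\bigr)^2}+o(1).$$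 For every $n$, both terms of the covariance formula (including their minus signs) are strictly negative. -/

import Mathlib

open MeasureTheory ProbabilityTheory Filter Topology
open scoped ENNReal

noncomputable section

namespace CoulombGas

/-- Real-valued subharmonic functions on the plane: upper semicontinuous functions that satisfy
the sub-mean value inequality on every circle. -/
def IsSubharmonic (s : ℂ → ℝ) : Prop :=
  UpperSemicontinuous s ∧
    ∀ (z : ℂ) (r : ℝ), 0 < r → CircleIntegrable s z r ∧ s z ≤ Real.circleAverage s z r

/-- The competitors in the obstacle problem: subharmonic `s` with `s ≤ Q` and
`s z ≤ 2 log |z| + O(1)` at infinity. -/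
def IsObstacleCompetitor (Q : ℂ → EReal) (s : ℂ → ℝ) : Prop :=
  IsSubharmonic s ∧ (∀ z, (s z : EReal) ≤ Q z) ∧
    ∃ C : ℝ, ∀ᶠ z in cocompact ℂ, s z ≤ 2 * Real.log ‖z‖ + C

/-- The obstacle function: the pointwise supremum of the competitors. -/
def obstacle (Q : ℂ → EReal) (z : ℂ) : EReal :=
  ⨆ (s : ℂ → ℝ) (_ : IsObstacleCompetitor Q s), (s z : EReal)

/-- The coincidence set of the obstacle problem. -/
def coincidenceSet (Q : ℂ → EReal) : Set ℂ := {z | Q z = obstacle Q z}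

/-- External potentials `Q : ℂ → ℝ ∪ {+∞}` that are rotation-invariant, lower semicontinuous
and confining. -/
structure IsPotential (Q : ℂ → EReal) : Prop where
  ne_bot : ∀ z, Q z ≠ ⊥
  radial : ∃ q : ℝ → EReal, ∀ z, Q z = q ‖z‖
  lsc : LowerSemicontinuous Q
  confining : 1 < liminf (fun z : ℂ => Q z / ((2 * Real.log ‖z‖ : ℝ) : EReal)) (cocompact ℂ)

/-- The closed annulus `a ≤ |z| ≤ b`. -/
def annulus (a b : ℝ) : Set ℂ := {z | a ≤ ‖z‖ ∧ ‖z‖ ≤ b}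

/-- The circle `|z| = r`. -/
def circle (r : ℝ) : Set ℂ := {z | ‖z‖ = r}

/-- `Q` is finite and `C⁶`-smooth on some open neighbourhood of `A`. -/
def IsC6Near (Q : ℂ → EReal) (A : Set ℂ) : Prop :=
  ∃ U : Set ℂ, IsOpen U ∧ A ⊆ U ∧ (∀ z ∈ U, Q z ≠ ⊤) ∧
    ContDiffOn ℝ 6 (fun z => (Q z).toReal) U

/-- The quarter Laplacian `∂∂̄ = (∂ₓ² + ∂ᵧ²) / 4` of `Q`. -/
def quarterLaplacian (Q : ℂ → EReal) (z : ℂ) : ℝ :=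
  (1 / 4) * Laplacian.laplacian (fun w : ℂ => (Q w).toReal) z

/-- The integral of an extended-real function: positive part minus negative part. -/
def erealIntegral {α : Type*} [MeasurableSpace α] (μ : Measure α) (f : α → EReal) : EReal :=
  ((∫⁻ x, (f x).toENNReal ∂μ : ℝ≥0∞) : EReal) - ((∫⁻ x, (-f x).toENNReal ∂μ : ℝ≥0∞) : EReal)

/-- The weighted logarithmic energy `∬ log (1 / |z - w|) dμ dμ + ∫ Q dμ`. The kernel is `+∞` on
the diagonal. -/
def energy (Q : ℂ → EReal) (μ : Measure ℂ) : EReal :=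
  erealIntegral (μ.prod μ) (fun p : ℂ × ℂ => -ENNReal.log ‖p.1 - p.2‖ₑ) + erealIntegral μ Q

/-- Compactly supported Borel probability measures on the plane. -/
def IsCompactProbability (μ : Measure ℂ) : Prop :=
  IsProbabilityMeasure μ ∧ ∃ K : Set ℂ, IsCompact K ∧ μ Kᶜ = 0

/-- `σ` is an equilibrium measure of `Q`: it minimizes the weighted logarithmic energy over all
compactly supported Borel probability measures. -/
def IsEquilibriumMeasure (Q : ℂ → EReal) (σ : Measure ℂ) : Prop :=
  IsCompactProbability σ ∧ ∀ μ : Measure ℂ, IsCompactProbability μ → energy Q σ ≤ energy Q μ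

/-- The area measure divided by `π`. -/
def areaMeasure : Measure ℂ := ENNReal.ofReal (1 / Real.pi) • (volume : Measure ℂ)

/-- The density `∏_{j<k} |z_k - z_j|² ∏_j exp (-n Q(z_j))`. -/
def gasDensity (Q : ℂ → EReal) (n : ℕ) (z : Fin n → ℂ) : ℝ≥0∞ :=
  (∏ j : Fin n, ∏ k ∈ Finset.Ioi j, ‖z k - z j‖ₑ ^ 2) *
    ∏ j : Fin n, EReal.exp (-((n : EReal) * Q (z j)))

/-- The partition function. -/
def partitionFunction (Q : ℂ → EReal) (n : ℕ) : ℝ≥0∞ :=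
  ∫⁻ z, gasDensity Q n z ∂(Measure.pi fun _ : Fin n => areaMeasure)

/-- The law of the `n`-particle Coulomb gas in the potential `Q`. -/
def gas (Q : ℂ → EReal) (n : ℕ) : Measure (Fin n → ℂ) :=
  (partitionFunction Q n)⁻¹ •
    (Measure.pi fun _ : Fin n => areaMeasure).withDensity (gasDensity Q n)

/-- The radial cutoff at radius `t` with parameter `ε`. Here `Real.smoothTransition u` is
`η u / (η u + η (1 - u))` with `η u = exp (-1 / u)` for `0 < u` and `η u = 0` for `u ≤ 0`. -/
def cutoff (ε t r : ℝ) : ℝ :=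
  Real.smoothTransition ((r - (t - ε)) / (ε / 2)) * Real.smoothTransition ((t + ε - r) / (ε / 2))

/-- The (smoothed) number of particles near the circle of radius `t`. -/
def count (ε t : ℝ) (n : ℕ) (z : Fin n → ℂ) : ℝ := ∑ j : Fin n, cutoff ε t ‖z j‖

/-- The fractional part `M n - ⌊M n⌋`. -/
def fracPart (M : ℝ) (n : ℕ) : ℝ := M * n - ⌊M * n⌋

/-- `ρ̃_k`, for `0 ≤ k ≤ m`. -/
def rhoTilde (b₀ a₁ : ℝ) (t : ℕ → ℝ) (k : ℕ) : ℝ :=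
  if k = 0 then b₀ / a₁ else t k / a₁

/-- `ρ̂_k`, for `1 ≤ k ≤ m + 1`. -/
def rhoHat (m : ℕ) (b₀ a₁ : ℝ) (t : ℕ → ℝ) (k : ℕ) : ℝ :=
  if k = m + 1 then b₀ / a₁ else b₀ / t k

/-- `ϑ̃_{k,n}`, for `0 ≤ k ≤ m`. -/
def thetaTilde (Q : ℂ → EReal) (b₀ a₁ : ℝ) (t : ℕ → ℝ) (M : ℝ) (k n : ℕ) : ℝ :=
  √(quarterLaplacian Q a₁ / quarterLaplacian Q (if k = 0 then b₀ else t k : ℝ)) *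
    rhoTilde b₀ a₁ t k ^ (-2 * fracPart M n)

/-- `ϑ̂_{k,n}`, for `1 ≤ k ≤ m + 1`. -/
def thetaHat (Q : ℂ → EReal) (m : ℕ) (b₀ a₁ : ℝ) (t : ℕ → ℝ) (M : ℝ) (k n : ℕ) : ℝ :=
  if k = m + 1 then (thetaTilde Q b₀ a₁ t M 0 n)⁻¹
  else √(quarterLaplacian Q b₀ / quarterLaplacian Q (t k : ℝ)) *
    rhoHat m b₀ a₁ t k ^ (2 * fracPart M n)

/-- `ϑ̃_{k,n} ρ̃_k ^ (2j+1)`, for `0 ≤ k ≤ m`. -/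
def weightTilde (Q : ℂ → EReal) (b₀ a₁ : ℝ) (t : ℕ → ℝ) (M : ℝ) (n j k : ℕ) : ℝ :=
  thetaTilde Q b₀ a₁ t M k n * rhoTilde b₀ a₁ t k ^ (2 * j + 1)

/-- `ϑ̂_{k,n} ρ̂_k ^ (2j+1)`, for `1 ≤ k ≤ m + 1`. -/
def weightHat (Q : ℂ → EReal) (m : ℕ) (b₀ a₁ : ℝ) (t : ℕ → ℝ) (M : ℝ) (n j k : ℕ) : ℝ :=
  thetaHat Q m b₀ a₁ t M k n * rhoHat m b₀ a₁ t k ^ (2 * j + 1)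

/-- `w_p / (1 + ∑_{k ∈ K} w_k)`. -/
def expTerm (K : Finset ℕ) (w : ℕ → ℝ) (p : ℕ) : ℝ := w p / (1 + ∑ k ∈ K, w k)

/-- `w_p / (1 + ∑_{k ∈ K} w_k)² · (1 + ∑_{k ∈ K, k ≠ p} w_k)`. -/
def varTerm (K : Finset ℕ) (w : ℕ → ℝ) (p : ℕ) : ℝ :=
  w p / (1 + ∑ k ∈ K, w k) ^ 2 * (1 + ∑ k ∈ K.erase p, w k)

/-- `w_p w_q / (1 + ∑_{k ∈ K} w_k)²`. -/
def covTerm (K : Finset ℕ) (w : ℕ → ℝ) (p q : ℕ) : ℝ :=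
  w p * w q / (1 + ∑ k ∈ K, w k) ^ 2

end CoulombGas

end

namespace CoulombGas

/-! ### Growth of potentials and the maximum principle -/

/-! Rotation invariance makes the moduli of the particles behave, up to a uniformly random
relabelling, like independent variables: for k = 0, ..., n-1 the k-th one has density proportional
to r^(2k+1) e^(-n q(r)). This comes from expanding the squared Vandermonde determinant over pairs of
permutations and using orthogonality of the monomials (`IsPotential.integral_realDensity`). Means
and covariances of radial statistics therefore become sums over k of one-dimensional quantities
(`level`, `IsPotential.covariance_radialSum`), and each count is in the limit a sum of independent
Bernoulli variables.

The potential theory is read in the variable log r. Subharmonic competitors obey the three-circle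
inequality, so at a coincidence radius a line of slope in [0, 2] supports q, and its slope is r
q'(r), which increases strictly across each annulus because ΔQ > 0. Conversely, a line of slope in
(0, 2] that touches q from below produces coincidence points. Since the gap between the annuli
contains only finitely many coincidence circles, the slopes at b₀ and a₁ agree
(`IsTwoComponent.logSlope_eq`), and one common tangent touches q exactly at b₀, t₁, ..., t_m, a₁
(`IsTwoComponent.tangent_eq_imp`). Its slope is 2 M₀ (`IsTwoComponent.logSlope_eq_mass`). Here σ is
not assumed to be radial: the first variation in the direction of uniform laws on circles gives U ≤
q for the circular average U of the potential of σ, and positive definiteness of the angular part of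
-log|z-w| forces equality σ-almost everywhere.

Relative to the common tangent, the k-th density is proportional to r^s e^(-n(q - tangent)) with s =
2k+1-2M₀n. When k stays at bounded distance from M₀n, s is bounded, and Laplace's method
(`tendsto_laplace`) spreads the mass over the touching radii ζ with weights proportional to ζ^s /
√ΔQ(ζ). For k = ⌊M₀n⌋+j one has s = 2j+1-2x_n, and division by the weight of a₁ gives the tilde
series; for k = ⌊M₀n⌋-1-j one has s = -(2j+1)-2x_n, and division by the weight of b₀ gives the hat
series. Away from the critical index the outposts lose against a₁ or b₀ geometrically, uniformly in
n (`IsTwoComponent.exists_level_add_le`, `IsTwoComponent.exists_level_sub_le`), so limits pass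
through the sums by dominated convergence. With e_p the limiting probability of outpost p at one
level, the summands are e_p, e_p - e_p² and -e_p e_q. -/

theorem IsPotential.eq_norm {Q : ℂ → EReal} (hQ : IsPotential Q) (z : ℂ) : Q z = Q (‖z‖ : ℂ) := by
  obtain ⟨q, hq⟩ := hQ.radial
  simp [hq]

/-- The confining condition gives the bound outside a disk; on the disk lower semicontinuity bounds
`Q` below, and `C` absorbs the logarithm there. The strict inequality θ > 1 later makes all moments
of order below n converge. -/
theorem IsPotential.growth {Q : ℂ → EReal} (hQ : IsPotential Q) :
    ∃ θ : ℝ, 1 < θ ∧ ∃ C : ℝ, ∀ z : ℂ,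
      ((2 * θ * Real.log (max ‖z‖ 1) - C : ℝ) : EReal) ≤ Q z := by
  obtain ⟨θ', h1, h2⟩ := EReal.lt_iff_exists_real_btwn.1 hQ.confining
  refine ⟨θ', by exact_mod_cast h1, ?_⟩
  have hev := eventually_lt_of_lt_liminf h2
  have hev2 : ∀ᶠ z : ℂ in cocompact ℂ, 1 < ‖z‖ :=
    (tendsto_norm_cocompact_atTop (E := ℂ)).eventually_gt_atTop 1
  have hev3 := hev.and hev2
  rw [← Metric.cobounded_eq_cocompact,
    (Metric.hasBasis_cobounded_compl_closedBall (0 : ℂ)).eventually_iff] at hev3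
  obtain ⟨R, hR⟩ := hev3
  have hout : ∀ z : ℂ, z ∉ Metric.closedBall (0 : ℂ) R →
      ((2 * θ' * Real.log (max ‖z‖ 1) : ℝ) : EReal) ≤ Q z := by
    intro z hz
    obtain ⟨h3, h4⟩ := hR.2 hz
    have hl : 0 < 2 * Real.log ‖z‖ := by have := Real.log_pos h4; positivity
    rw [EReal.lt_div_iff (by exact_mod_cast hl) (EReal.coe_ne_top _)] at h3
    rw [max_eq_left h4.le]
    refine le_trans ?_ h3.le
    rw [← EReal.coe_mul]
    exact_mod_cast (by linarith)
  obtain ⟨B, hB⟩ : ∃ B : ℝ, ∀ z ∈ Metric.closedBall (0 : ℂ) R, (B : EReal) ≤ Q z := by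
    rcases (Metric.closedBall (0 : ℂ) R).eq_empty_or_nonempty with h | h
    · exact ⟨0, by simp [h]⟩
    · obtain ⟨z₀, -, hz₀⟩ := LowerSemicontinuousOn.exists_isMinOn h
        (isCompact_closedBall (0 : ℂ) R) (hQ.lsc.lowerSemicontinuousOn _)
      obtain ⟨B, -, hB⟩ := EReal.lt_iff_exists_real_btwn.1 (bot_lt_iff_ne_bot.2 (hQ.ne_bot z₀))
      exact ⟨B, fun z hz => hB.le.trans (hz₀ hz)⟩
  have h1' : (1 : ℝ) < θ' := by exact_mod_cast h1
  refine ⟨2 * θ' * Real.log (max R 1) + |B|, fun z => ?_⟩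
  have hR0 : 0 ≤ Real.log (max R 1) := Real.log_nonneg (le_max_right _ _)
  by_cases hz : z ∈ Metric.closedBall (0 : ℂ) R
  · refine le_trans ?_ (hB z hz)
    have : ‖z‖ ≤ R := by simpa using hz
    have h5 : Real.log (max ‖z‖ 1) ≤ Real.log (max R 1) :=
      Real.log_le_log (by positivity) (max_le_max_right _ this)
    have := neg_abs_le B
    have : 2 * θ' * Real.log (max ‖z‖ 1) ≤ 2 * θ' * Real.log (max R 1) := by gcongr
    exact_mod_cast (by linarith)
  · refine le_trans ?_ (hout z hz)
    have := abs_nonneg B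
    have : 0 ≤ 2 * θ' * Real.log (max R 1) := by positivity
    exact_mod_cast (by linarith)

theorem circleAverage_norm_sq (z : ℂ) (ρ : ℝ) :
    Real.circleAverage (fun w : ℂ => ‖w‖ ^ 2) z ρ = ‖z‖ ^ 2 + ρ ^ 2 := by
  have h : ∀ θ : ℝ, ‖circleMap z ρ θ‖ ^ 2 =
      (‖z‖ ^ 2 + ρ ^ 2) + (2 * ρ * z.re * Real.cos θ + 2 * ρ * z.im * Real.sin θ) := by
    intro θ
    rw [← Complex.normSq_eq_norm_sq, ← Complex.normSq_eq_norm_sq, Complex.normSq_apply,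
      Complex.normSq_apply]
    simp only [circleMap, Complex.add_re, Complex.add_im, Complex.mul_re, Complex.mul_im,
      Complex.ofReal_re, Complex.ofReal_im, Complex.exp_ofReal_mul_I_re,
      Complex.exp_ofReal_mul_I_im]
    nlinarith [Real.sin_sq_add_cos_sq θ]
  rw [Real.circleAverage_def]
  simp only [h]
  rw [intervalIntegral.integral_add (by simp) (by apply Continuous.intervalIntegrable; fun_prop),
    intervalIntegral.integral_add (by apply Continuous.intervalIntegrable; fun_prop)
      (by apply Continuous.intervalIntegrable; fun_prop)]
  simp
  field_simp

/-- Weak maximum principle. Adding δ|w|² makes the sub-mean inequality strict, so the perturbed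
function cannot attain its maximum over `K` outside `B`, and δ is too small for the perturbation to
close the gap between `f z₁` and `c`. Only circles, not disks, have to lie in `K`. -/
theorem le_of_subMean {K B : Set ℂ} (hK : IsCompact K) {f : ℂ → ℝ}
    (hf : UpperSemicontinuousOn f K)
    (hsub : ∀ z ∈ K, z ∉ B → ∃ ρ > 0, Metric.sphere z ρ ⊆ K ∧ CircleIntegrable f z ρ ∧
      f z ≤ Real.circleAverage f z ρ) {c : ℝ} (hB : ∀ z ∈ K, z ∈ B → f z ≤ c) :
    ∀ z ∈ K, f z ≤ c := by
  intro z₁ hz₁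
  by_contra! hc
  obtain ⟨R, hR⟩ := hK.isBounded.exists_norm_le
  set δ := (f z₁ - c) / (R ^ 2 + 1) / 2 with hδ
  have hδ0 : 0 < δ := by
    have : 0 < f z₁ - c := sub_pos.2 hc
    positivity
  have hδR : δ * R ^ 2 < f z₁ - c := by
    have h0 : 0 < f z₁ - c := sub_pos.2 hc
    have : δ * (R ^ 2 + 1) = (f z₁ - c) / 2 := by rw [hδ]; field_simp
    nlinarith
  have husc : UpperSemicontinuousOn (fun w => f w + δ * ‖w‖ ^ 2) K :=
    hf.add (Continuous.continuousOn (by fun_prop)).upperSemicontinuousOn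
  obtain ⟨z, hz, hmax⟩ := UpperSemicontinuousOn.exists_isMaxOn ⟨z₁, hz₁⟩ hK husc
  have hzB : z ∉ B := by
    intro hzB
    have h1 : f z₁ + δ * ‖z₁‖ ^ 2 ≤ f z + δ * ‖z‖ ^ 2 := hmax hz₁
    have h2 := hB z hz hzB
    have h3 : ‖z‖ ^ 2 ≤ R ^ 2 := by gcongr; exact hR z hz
    nlinarith [sq_nonneg ‖z₁‖]
  obtain ⟨ρ, hρ, hsph, hint, hle⟩ := hsub z hz hzB
  have hint2 : CircleIntegrable (fun w : ℂ => δ * ‖w‖ ^ 2) z ρ :=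
    ContinuousOn.circleIntegrable hρ.le (by fun_prop)
  have hav : Real.circleAverage (fun w => f w + δ * ‖w‖ ^ 2) z ρ =
      Real.circleAverage f z ρ + δ * (‖z‖ ^ 2 + ρ ^ 2) := by
    rw [Real.circleAverage_fun_add hint hint2, ← circleAverage_norm_sq z ρ]
    congr 1
    exact Real.circleAverage_fun_smul (a := δ) (f := fun w : ℂ => ‖w‖ ^ 2)
  have hav2 : Real.circleAverage (fun w => f w + δ * ‖w‖ ^ 2) z ρ ≤ f z + δ * ‖z‖ ^ 2 := by
    apply Real.circleAverage_mono_on_of_le_circle (hint.add hint2)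
    intro x hx
    rw [abs_of_pos hρ] at hx
    exact hmax (hsph hx)
  have : 0 < δ * ρ ^ 2 := by positivity
  nlinarith

theorem circleAverage_log_norm_sub_eq_log_max (a : ℂ) {c : ℂ} {r : ℝ} (hr : 0 < r) :
    Real.circleAverage (fun z => Real.log ‖z - a‖) c r = Real.log (max r ‖c - a‖) := by
  rw [circleAverage_log_norm_sub_const_eq_log_radius_add_posLog hr.ne']
  rcases le_total ‖c - a‖ r with h | h
  · rw [max_eq_left h, add_eq_left, Real.posLog_eq_zero_iff, abs_of_nonneg (by positivity)]
    exact (inv_mul_le_one₀ hr).2 h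
  · have h0 : 0 < ‖c - a‖ := hr.trans_le h
    rw [max_eq_right h, Real.posLog_eq_log, Real.log_mul (by positivity) h0.ne', Real.log_inv]
    · ring
    · rw [abs_of_nonneg (by positivity), ← div_eq_inv_mul]
      exact (one_le_div hr).2 h

theorem circleAverage_log_norm {c : ℂ} {r : ℝ} (hr : 0 < r) :
    Real.circleAverage (fun z => Real.log ‖z‖) c r = Real.log (max r ‖c‖) := by
  simpa using circleAverage_log_norm_sub_eq_log_max 0 (c := c) hr

theorem circleIntegrable_log_norm_sub (a c : ℂ) (r : ℝ) :
    CircleIntegrable (fun z => Real.log ‖z - a‖) c r := circleIntegrable_log_norm_sub_const r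

theorem circleIntegrable_log_norm' (c : ℂ) (r : ℝ) :
    CircleIntegrable (fun z => Real.log ‖z‖) c r := by
  simpa using circleIntegrable_log_norm_sub 0 c r

/-- A subharmonic function lies below a logarithmic line on an annulus as soon as it does on the
two bounding circles. -/
theorem IsSubharmonic.le_log_line {s : ℂ → ℝ} (hs : IsSubharmonic s) {r₁ r₂ c l : ℝ}
    (hr₁ : 0 < r₁) (h1 : ∀ z : ℂ, ‖z‖ = r₁ → s z ≤ c + l * Real.log r₁)
    (h2 : ∀ z : ℂ, ‖z‖ = r₂ → s z ≤ c + l * Real.log r₂) {z : ℂ} (hz1 : r₁ ≤ ‖z‖)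
    (hz2 : ‖z‖ ≤ r₂) : s z ≤ c + l * Real.log ‖z‖ := by
  set K : Set ℂ := {w | r₁ ≤ ‖w‖ ∧ ‖w‖ ≤ r₂} with hKdef
  have hK : IsCompact K := by
    refine (isCompact_closedBall (0 : ℂ) r₂).of_isClosed_subset ?_ ?_
    · exact (isClosed_le continuous_const continuous_norm).inter
        (isClosed_le continuous_norm continuous_const)
    · intro w hw
      simpa using hw.2
  have hlog : ContinuousOn (fun w : ℂ => -(l * Real.log ‖w‖)) K := by
    refine (continuousOn_const.mul (ContinuousOn.log (by fun_prop) ?_)).neg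
    intro w hw
    exact (hr₁.trans_le hw.1).ne'
  have key := le_of_subMean (B := {w | ‖w‖ = r₁ ∨ ‖w‖ = r₂}) hK (c := c)
    (f := fun w => s w + -(l * Real.log ‖w‖))
    (UpperSemicontinuousOn.add (hs.1.upperSemicontinuousOn K) hlog.upperSemicontinuousOn) ?_ ?_
    z ⟨hz1, hz2⟩
  · linarith
  · intro w hw hwB
    simp only [Set.mem_ofPred_eq, not_or] at hwB
    have hw1 : r₁ < ‖w‖ := lt_of_le_of_ne hw.1 (Ne.symm hwB.1)
    have hw2 : ‖w‖ < r₂ := lt_of_le_of_ne hw.2 hwB.2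
    -- This radius keeps the circle inside the annulus; as it is smaller than ‖w‖, the average of
    -- log over the circle is exactly log ‖w‖.
    set ρ := min (‖w‖ - r₁) (r₂ - ‖w‖) with hρ
    have hρ0 : 0 < ρ := lt_min (by linarith) (by linarith)
    have hρ1 : ρ ≤ ‖w‖ - r₁ := min_le_left _ _
    have hρ2 : ρ ≤ r₂ - ‖w‖ := min_le_right _ _
    obtain ⟨hi, hm⟩ := hs.2 w ρ hρ0
    have hi2 : CircleIntegrable (fun w : ℂ => -(l * Real.log ‖w‖)) w ρ := by
      have h := (circleIntegrable_log_norm' w ρ).const_smul (a := -l)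
      have he : (fun w : ℂ => -(l * Real.log ‖w‖)) = -l • fun z : ℂ => Real.log ‖z‖ := by
        ext; simp
      rwa [he]
    refine ⟨ρ, hρ0, ?_, hi.add hi2, ?_⟩
    · intro x hx
      have hx' : ‖x - w‖ = ρ := by simpa [dist_eq_norm] using hx
      have h3 : ‖x‖ ≤ ‖w‖ + ‖x - w‖ := by
        simpa using norm_add_le w (x - w)
      have h4 : ‖w‖ ≤ ‖x‖ + ‖x - w‖ := by
        have := norm_sub_le x (x - w)
        simpa using this
      exact ⟨by linarith, by linarith⟩
    · rw [Real.circleAverage_fun_add hi hi2]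
      have : Real.circleAverage (fun w : ℂ => -(l * Real.log ‖w‖)) w ρ = -(l * Real.log ‖w‖) := by
        have h5 := Real.circleAverage_fun_smul (a := -l) (f := fun w : ℂ => Real.log ‖w‖)
          (c := w) (R := ρ)
        rw [circleAverage_log_norm hρ0, max_eq_right (by linarith)] at h5
        simpa using h5
      rw [this]
      simpa using hm
  · rintro w hw (h | h)
    · have := h1 w h
      simp only [h]; linarith
    · have := h2 w h
      simp only [h]; linarith

theorem IsSubharmonic.le_of_le_on_circle {s : ℂ → ℝ} (hs : IsSubharmonic s) {r c : ℝ}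
    (h : ∀ z : ℂ, ‖z‖ = r → s z ≤ c) {z : ℂ} (hz : ‖z‖ ≤ r) : s z ≤ c := by
  refine le_of_subMean (B := {w | ‖w‖ = r}) (isCompact_closedBall (0 : ℂ) r)
    (hs.1.upperSemicontinuousOn _) ?_ (fun w _ hw => h w hw) z (by simpa using hz)
  intro w hw hwB
  have hw' : ‖w‖ ≤ r := by simpa using hw
  have hlt : ‖w‖ < r := lt_of_le_of_ne hw' hwB
  refine ⟨r - ‖w‖, by linarith, ?_, hs.2 w _ (by linarith)⟩
  intro x hx
  have hx' : ‖x - w‖ = r - ‖w‖ := by simpa [dist_eq_norm] using hx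
  have h3 : ‖x‖ ≤ ‖w‖ + ‖x - w‖ := by simpa using norm_add_le w (x - w)
  simp only [Metric.mem_closedBall, dist_zero_right]
  linarith

/-! ### Logarithmic lines touching the potential -/

theorem EReal_eq_coe_of_ne {x : EReal} (h1 : x ≠ ⊥) (h2 : x ≠ ⊤) : ∃ a : ℝ, x = a :=
  ⟨x.toReal, (EReal.coe_toReal h2 h1).symm⟩

/-- By the three-circle inequality, a chord from height `Q r₁` at an inner radius to `s r₀` is never
steeper than a chord from `s r₀` to height `Q r₂` at an outer radius. The supremum of the inner
slopes separates the two families and serves as `l`. Radial symmetry turns `s ≤ Q` into a constant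
bound on each circle. -/
theorem IsObstacleCompetitor.exists_line {Q : ℂ → EReal} (hQ : IsPotential Q) {s : ℂ → ℝ}
    (hs : IsObstacleCompetitor Q s) {r₀ : ℝ} (hr₀ : 0 < r₀) :
    ∃ l ∈ Set.Icc (0 : ℝ) 2, ∀ r : ℝ, 0 < r →
      ((s r₀ + l * (Real.log r - Real.log r₀) : ℝ) : EReal) ≤ Q r := by
  obtain ⟨hsub, hle, C, hC⟩ := hs
  have hbd : ∀ {r A : ℝ}, Q r = A → ∀ z : ℂ, ‖z‖ = r → s z ≤ A := by
    intro r A hA z hz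
    have := hle z
    rw [hQ.eq_norm z, hz, hA] at this
    exact_mod_cast this
  have hnr₀ : ‖(r₀ : ℂ)‖ = r₀ := by simp [hr₀.le]
  -- The slope 0 is adjoined so that `S` is nonempty and `l ≥ 0`; it respects the outer chords
  -- because of the maximum principle on the disk.
  set S : Set ℝ := {x | x = 0 ∨ ∃ r₁ A : ℝ, 0 < r₁ ∧ r₁ < r₀ ∧ Q r₁ = A ∧
    x = (s r₀ - A) / (Real.log r₀ - Real.log r₁)} with hS
  have h0S : (0 : ℝ) ∈ S := Or.inl rfl
  have chord : ∀ {r₁ r₂ A B : ℝ}, 0 < r₁ → r₁ < r₀ → r₀ < r₂ → (∀ z : ℂ, ‖z‖ = r₁ → s z ≤ A) →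
      (∀ z : ℂ, ‖z‖ = r₂ → s z ≤ B) →
      (s r₀ - A) * (Real.log r₂ - Real.log r₁) ≤ (B - A) * (Real.log r₀ - Real.log r₁) := by
    intro r₁ r₂ A B h1 h10 h02 hA hB
    have hl : 0 < Real.log r₂ - Real.log r₁ := sub_pos.2 (Real.log_lt_log h1 (h10.trans h02))
    have key := hsub.le_log_line (c := A - (B - A) / (Real.log r₂ - Real.log r₁) * Real.log r₁)
      (l := (B - A) / (Real.log r₂ - Real.log r₁)) h1
      (fun z hz => (hA z hz).trans (by linarith))
      (fun z hz => (hB z hz).trans (le_of_eq (by field_simp; ring))) (z := r₀)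
      (by rw [hnr₀]; exact h10.le) (by rw [hnr₀]; exact h02.le)
    rw [hnr₀] at key
    have e : (B - A) / (Real.log r₂ - Real.log r₁) * (Real.log r₂ - Real.log r₁) = B - A := by
      field_simp
    have key2 : s r₀ - A ≤
        (B - A) / (Real.log r₂ - Real.log r₁) * (Real.log r₀ - Real.log r₁) := by linarith
    have := mul_le_mul_of_nonneg_right key2 hl.le
    rwa [mul_right_comm, e] at this
  have hS2 : ∀ x ∈ S, x ≤ 2 := by
    rintro x (rfl | ⟨r₁, A, h1, h10, hA, rfl⟩)
    · norm_num
    · have ha : 0 < Real.log r₀ - Real.log r₁ := sub_pos.2 (Real.log_lt_log h1 h10)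
      rw [div_le_iff₀ ha]
      by_contra! hcon
      rw [← Metric.cobounded_eq_cocompact,
        (Metric.hasBasis_cobounded_compl_closedBall (0 : ℂ)).eventually_iff] at hC
      obtain ⟨R₀, -, hR₀⟩ := hC
      -- An inner slope above 2 contradicts the chord inequality when the outer height is 2 log R +
      -- C and R tends to infinity.
      have hev : ∀ᶠ R : ℝ in atTop, (s r₀ - A - 2 * (Real.log r₀ - Real.log r₁)) * Real.log R ≤
          (s r₀ - A) * Real.log r₁ + (C - A) * (Real.log r₀ - Real.log r₁) := by
        filter_upwards [eventually_gt_atTop r₀, eventually_gt_atTop R₀] with R hR1 hR2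
        have := chord (B := 2 * Real.log R + C) h1 h10 hR1 (hbd hA) (fun z hz => by
          rw [← hz]; exact hR₀ (by simp [hz, hR2]))
        nlinarith
      have ht : Tendsto (fun R : ℝ => (s r₀ - A - 2 * (Real.log r₀ - Real.log r₁)) * Real.log R)
          atTop atTop := Real.tendsto_log_atTop.const_mul_atTop (by linarith)
      obtain ⟨R, hR1, hR2⟩ := (hev.and (ht.eventually_gt_atTop _)).exists
      exact absurd hR1 (not_le.2 hR2)
  have hbdd : BddAbove S := ⟨2, hS2⟩
  refine ⟨sSup S, ⟨le_csSup hbdd h0S, csSup_le ⟨0, h0S⟩ hS2⟩, fun r hr => ?_⟩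
  by_cases htop : Q r = ⊤
  · rw [htop]; exact le_top
  obtain ⟨A, hA⟩ := EReal_eq_coe_of_ne (hQ.ne_bot r) htop
  rw [hA, EReal.coe_le_coe_iff]
  rcases lt_trichotomy r r₀ with h | rfl | h
  · have ha : 0 < Real.log r₀ - Real.log r := sub_pos.2 (Real.log_lt_log hr h)
    have := le_csSup hbdd (show (s r₀ - A) / (Real.log r₀ - Real.log r) ∈ S from
      Or.inr ⟨r, A, hr, h, hA, rfl⟩)
    rw [div_le_iff₀ ha] at this
    linarith
  · have := hbd hA r hnr₀
    simpa using this
  · have ha : 0 < Real.log r - Real.log r₀ := sub_pos.2 (Real.log_lt_log hr₀ h)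
    have : sSup S ≤ (A - s r₀) / (Real.log r - Real.log r₀) := by
      refine csSup_le ⟨0, h0S⟩ ?_
      rintro x (rfl | ⟨r₁, B, h1, h10, hB, rfl⟩)
      · have := hsub.le_of_le_on_circle (hbd hA) (z := r₀) (by rw [hnr₀]; exact h.le)
        exact div_nonneg (by linarith) ha.le
      · have hb : 0 < Real.log r₀ - Real.log r₁ := sub_pos.2 (Real.log_lt_log h1 h10)
        rw [div_le_div_iff₀ hb ha]
        have := chord h1 h10 h (hbd hB) (hbd hA)
        nlinarith
    rw [le_div_iff₀ ha] at this
    linarith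

/-- The supremum defining the obstacle need not be attained. Competitors within 1/(n+1) of it supply
slopes in the compact interval [0, 2], and a limit slope along a subsequence does the job. -/
theorem exists_line_of_mem_coincidenceSet {Q : ℂ → EReal} (hQ : IsPotential Q) {r₀ : ℝ}
    (hr₀ : 0 < r₀) (hmem : (r₀ : ℂ) ∈ coincidenceSet Q) (hfin : Q r₀ ≠ ⊤) :
    ∃ l ∈ Set.Icc (0 : ℝ) 2, ∀ r : ℝ, 0 < r →
      (((Q r₀).toReal + l * (Real.log r - Real.log r₀) : ℝ) : EReal) ≤ Q r := by
  obtain ⟨A, hA⟩ := EReal_eq_coe_of_ne (hQ.ne_bot r₀) hfin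
  have hob : obstacle Q r₀ = A := by rw [← hA]; exact hmem.symm
  have step : ∀ n : ℕ, ∃ l ∈ Set.Icc (0 : ℝ) 2, ∀ r : ℝ, 0 < r →
      ((A - 1 / ((n : ℝ) + 1) + l * (Real.log r - Real.log r₀) : ℝ) : EReal) ≤ Q r := by
    intro n
    have hlt : ((A - 1 / ((n : ℝ) + 1) : ℝ) : EReal) < obstacle Q r₀ := by
      rw [hob, EReal.coe_lt_coe_iff]
      have : (0 : ℝ) < 1 / ((n : ℝ) + 1) := by positivity
      linarith
    obtain ⟨s, hs⟩ := lt_iSup_iff.1 hlt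
    obtain ⟨hs1, hs2⟩ := lt_iSup_iff.1 hs
    rw [EReal.coe_lt_coe_iff] at hs2
    obtain ⟨l, hl, hline⟩ := hs1.exists_line hQ hr₀
    refine ⟨l, hl, fun r hr => le_trans ?_ (hline r hr)⟩
    rw [EReal.coe_le_coe_iff]
    linarith
  choose l hl hline using step
  obtain ⟨l₀, hl₀, φ, hφ, hlim⟩ := isCompact_Icc.tendsto_subseq hl
  refine ⟨l₀, hl₀, fun r hr => ?_⟩
  rw [hA, EReal.toReal_coe]
  have h1 : Tendsto (fun n : ℕ => A - 1 / (((φ n : ℕ) : ℝ) + 1) +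
      (l ∘ φ) n * (Real.log r - Real.log r₀)) atTop
      (𝓝 (A - 0 + l₀ * (Real.log r - Real.log r₀))) :=
    (tendsto_const_nhds.sub (tendsto_one_div_add_atTop_nhds_zero_nat.comp hφ.tendsto_atTop)).add
      (hlim.mul_const _)
  rw [sub_zero] at h1
  exact le_of_tendsto ((continuous_coe_real_ereal.tendsto _).comp h1)
    (Eventually.of_forall fun n => hline (φ n) r hr)

theorem obstacle_le (Q : ℂ → EReal) (z : ℂ) : obstacle Q z ≤ Q z :=
  iSup₂_le fun _ hs => hs.2.1 z

/-- Points where a line of slope in `(0, 2]` below the potential touches it are coincidence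
points. -/
theorem mem_coincidenceSet_of_line {Q : ℂ → EReal} (hQ : IsPotential Q) {c l r₁ : ℝ}
    (hl0 : 0 < l) (hl2 : l ≤ 2) (hr₁ : 0 < r₁)
    (hline : ∀ r : ℝ, 0 < r → ((c + l * Real.log r : ℝ) : EReal) ≤ Q r)
    (heq : Q r₁ = ((c + l * Real.log r₁ : ℝ) : EReal)) : (r₁ : ℂ) ∈ coincidenceSet Q := by
  obtain ⟨θ, hθ, C, hC⟩ := hQ.growth
  have hlow : ∀ z : ℂ, ((-C : ℝ) : EReal) ≤ Q z := fun z => by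
    refine le_trans ?_ (hC z)
    rw [EReal.coe_le_coe_iff]
    have : 0 ≤ Real.log (max ‖z‖ 1) := Real.log_nonneg (le_max_right _ _)
    have : 0 ≤ 2 * θ * Real.log (max ‖z‖ 1) := by positivity
    linarith
  -- The line tends to -∞ at the origin (this uses l > 0), whereas competitors are real-valued. It
  -- is truncated at a radius δ so small that the plateau lies below the global lower bound -C of
  -- `Q`, and not beyond `r₁`, so that the value there is kept.
  set δ := min r₁ (Real.exp ((-C - c) / l)) with hδ
  have hδ0 : 0 < δ := lt_min hr₁ (Real.exp_pos _)
  have hδC : c + l * Real.log δ ≤ -C := by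
    have : Real.log δ ≤ (-C - c) / l := by
      rw [← Real.log_exp ((-C - c) / l)]
      exact Real.log_le_log hδ0 (min_le_right _ _)
    rw [le_div_iff₀ hl0] at this
    linarith
  set s : ℂ → ℝ := fun z => c + l * Real.log (max ‖z‖ δ) with hs
  have hscont : Continuous s := by
    refine continuous_const.add (continuous_const.mul (Continuous.log (by fun_prop) ?_))
    intro z
    exact (hδ0.trans_le (le_max_right _ _)).ne'
  have hcomp : IsObstacleCompetitor Q s := by
    refine ⟨⟨hscont.upperSemicontinuous, fun z r hr => ?_⟩, fun z => ?_, ?_⟩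
    · have hint : CircleIntegrable s z r := hscont.continuousOn.circleIntegrable hr.le
      refine ⟨hint, ?_⟩
      rcases le_total ‖z‖ δ with h | h
      · rw [← Real.circleAverage_const (s z) z r]
        refine Real.circleAverage_mono (by simp) hint fun w _ => ?_
        simp only [hs, max_eq_right h]
        gcongr
        exact le_max_right _ _
      · have h1 : Real.circleAverage (fun w : ℂ => c + l * Real.log ‖w‖) z r =
            c + l * Real.log (max r ‖z‖) := by
          rw [Real.circleAverage_fun_add (by simp)
            (by simpa using! (circleIntegrable_log_norm' z r).const_smul (a := l)),
            Real.circleAverage_const, ← circleAverage_log_norm hr]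
          congr 1
          exact Real.circleAverage_fun_smul (a := l) (f := fun w : ℂ => Real.log ‖w‖)
        have h2 : s z ≤ c + l * Real.log (max r ‖z‖) := by
          simp only [hs, max_eq_left h]
          have : 0 < ‖z‖ := hδ0.trans_le h
          gcongr
          exact le_max_right _ _
        -- Since `Real.log 0 = 0`, the untruncated function need not lie below `s` at the origin.
        -- Changing this single value does not affect circle averages.
        set u : ℂ → ℝ := fun w => c + l * Real.log (if w = 0 then δ else ‖w‖) with hu
        have hcod : (fun w : ℂ => c + l * Real.log ‖w‖)
            =ᶠ[codiscreteWithin (Metric.sphere z |r|)] u := by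
          have : ({0}ᶜ : Set ℂ) ∈ codiscreteWithin (Metric.sphere z |r|) :=
            codiscreteWithin_iff_locallyFiniteComplementWithin.2 fun x _ =>
              ⟨Set.univ, univ_mem, (Set.finite_singleton (0 : ℂ)).subset fun y hy => by
                simpa using hy.2.2⟩
          filter_upwards [this] with w hw
          have hw0 : w ≠ 0 := hw
          simp [hu, hw0]
        have hi0 : CircleIntegrable (fun w : ℂ => c + l * Real.log ‖w‖) z r :=
          (circleIntegrable_const c z r).add
            (by simpa using! (circleIntegrable_log_norm' z r).const_smul (a := l))
        refine h2.trans ?_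
        rw [← h1, Real.circleAverage_congr_codiscreteWithin hcod hr.ne']
        refine Real.circleAverage_mono (hi0.congr_codiscreteWithin hcod) hint fun w _ => ?_
        simp only [hs, hu]
        split_ifs with hw
        · simp [hw, hδ0.le]
        · have : 0 < ‖w‖ := norm_pos_iff.2 hw
          gcongr
          exact le_max_left _ _
    · rcases le_total ‖z‖ δ with h | h
      · refine le_trans ?_ (hlow z)
        rw [EReal.coe_le_coe_iff]
        simpa only [hs, max_eq_right h] using hδC
      · rw [hQ.eq_norm z]
        simpa only [hs, max_eq_left h] using hline ‖z‖ (hδ0.trans_le h)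
    · refine ⟨c, ?_⟩
      filter_upwards [(tendsto_norm_cocompact_atTop (E := ℂ)).eventually_ge_atTop (max δ 1)]
        with z hz
      have h1 : δ ≤ ‖z‖ := (le_max_left _ _).trans hz
      have h2 : 0 ≤ Real.log ‖z‖ := Real.log_nonneg ((le_max_right _ _).trans hz)
      simp only [hs, max_eq_left h1]
      nlinarith
  refine le_antisymm ?_ (obstacle_le Q r₁)
  have h1 : ((s r₁ : ℝ) : EReal) ≤ obstacle Q r₁ := le_iSup₂ (f := fun (s : ℂ → ℝ)
    (_ : IsObstacleCompetitor Q s) => ((s r₁ : ℝ) : EReal)) s hcomp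
  refine le_trans (le_of_eq ?_) h1
  rw [heq]
  have : max ‖(r₁ : ℂ)‖ δ = r₁ := by
    rw [Complex.norm_real, Real.norm_of_nonneg hr₁.le, max_eq_left (min_le_left _ _)]
  simp only [hs, this]

/-! ### Radial calculus -/

theorem fderiv_fderiv_apply_self {f : ℂ → ℝ} {x : ℂ} (v : ℂ) (hf : ContDiffAt ℝ 2 f x) :
    fderiv ℝ (fderiv ℝ f) x v v = deriv (deriv fun t : ℝ => f (x + t • v)) 0 := by
  have hline : ∀ t : ℝ, HasDerivAt (fun t : ℝ => x + t • v) v t := fun t => by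
    simpa using ((hasDerivAt_id t).smul_const v).const_add x
  have hev : ∀ᶠ y in 𝓝 x, ContDiffAt ℝ 2 f y := hf.eventually (by simp)
  have htend : Tendsto (fun t : ℝ => x + t • v) (𝓝 0) (𝓝 x) := by
    simpa using (hline 0).continuousAt.tendsto
  have h1 : deriv (fun t : ℝ => f (x + t • v)) =ᶠ[𝓝 0] fun t => fderiv ℝ f (x + t • v) v := by
    filter_upwards [htend.eventually hev] with t ht
    have hd : HasFDerivAt f (fderiv ℝ f (x + t • v)) (x + t • v) :=
      (ht.differentiableAt (by norm_num)).hasFDerivAt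
    exact (hd.comp_hasDerivAt t (hline t)).deriv
  rw [h1.deriv_eq]
  have hd2 : HasFDerivAt (fderiv ℝ f) (fderiv ℝ (fderiv ℝ f) x) (x + (0 : ℝ) • v) := by
    have h := (hf.fderiv_right (m := 1) (by norm_num)).differentiableAt (by norm_num)
    simpa using h.hasFDerivAt
  have h3 : HasDerivAt (fun t : ℝ => fderiv ℝ f (x + t • v)) (fderiv ℝ (fderiv ℝ f) x v) 0 :=
    hd2.comp_hasDerivAt (0 : ℝ) (hline 0)
  have h4 := h3.clm_apply (hasDerivAt_const (0 : ℝ) v)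
  rw [h4.deriv, map_zero, add_zero]

theorem contDiffAt_deriv {g : ℝ → ℝ} {r : ℝ} {m n : WithTop ℕ∞} (hg : ContDiffAt ℝ n g r)
    (hmn : m + 1 ≤ n) : ContDiffAt ℝ m (deriv g) r := by
  have h : deriv g = fun x => fderiv ℝ g x 1 := by ext x; simp
  rw [h]
  exact (hg.fderiv_right hmn).clm_apply contDiffAt_const

/-- The restriction of the potential to the positive half-line. -/
noncomputable def profile (Q : ℂ → EReal) (r : ℝ) : ℝ := (Q r).toReal

theorem IsC6Near.contDiffAt {Q : ℂ → EReal} {A : Set ℂ} (h : IsC6Near Q A) {z : ℂ} (hz : z ∈ A) :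
    ContDiffAt ℝ 6 (fun z => (Q z).toReal) z := by
  obtain ⟨U, hU, hAU, -, hd⟩ := h
  exact (hd z (hAU hz)).contDiffAt (hU.mem_nhds (hAU hz))

theorem IsC6Near.eventually_ne_top {Q : ℂ → EReal} {A : Set ℂ} (h : IsC6Near Q A) {r : ℝ}
    (hz : (r : ℂ) ∈ A) : ∀ᶠ x : ℝ in 𝓝 r, Q x ≠ ⊤ := by
  obtain ⟨U, hU, hAU, ht, -⟩ := h
  have : ∀ᶠ x : ℝ in 𝓝 r, (x : ℂ) ∈ U :=
    (Complex.continuous_ofReal.tendsto r).eventually (hU.mem_nhds (hAU hz))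
  exact this.mono fun x hx => ht x hx

theorem IsC6Near.contDiffAt_profile {Q : ℂ → EReal} {A : Set ℂ} (h : IsC6Near Q A) {r : ℝ}
    (hz : (r : ℂ) ∈ A) : ContDiffAt ℝ 6 (profile Q) r :=
  (h.contDiffAt hz).comp r Complex.ofRealCLM.contDiff.contDiffAt

/-- Continuity of `k` is enough because of the factor t; this avoids a second differentiation in the
tangential direction of the Laplacian below. -/
theorem hasDerivAt_mul_of_continuousAt {k : ℝ → ℝ} (hk : ContinuousAt k 0) :
    HasDerivAt (fun t => t * k t) (k 0) 0 := by
  rw [hasDerivAt_iff_tendsto_slope]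
  refine (hk.tendsto.mono_left nhdsWithin_le_nhds).congr' ?_
  filter_upwards [self_mem_nhdsWithin] with t ht
  have : t ≠ 0 := ht
  simp [slope_def_field]
  field_simp

/-- Along the radial direction the second derivative is q''. Along the tangential one the function
is q(√(r²+t²)), with derivative t · q'(√(r²+t²))/√(r²+t²), hence second derivative q'(r)/r at t = 0.
-/
theorem quarterLaplacian_eq {Q : ℂ → EReal} (hQ : IsPotential Q) {r : ℝ} (hr : 0 < r)
    (hd : ContDiffAt ℝ 6 (fun z => (Q z).toReal) (r : ℂ)) :
    quarterLaplacian Q r =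
      (1 / 4) * (deriv (deriv (profile Q)) r + deriv (profile Q) r / r) := by
  have hd2 : ContDiffAt ℝ 2 (fun z => (Q z).toReal) (r : ℂ) := hd.of_le (by norm_num)
  have hg : ContDiffAt ℝ 2 (profile Q) r :=
    hd2.comp r Complex.ofRealCLM.contDiff.contDiffAt
  rw [quarterLaplacian, InnerProductSpace.laplacian_eq_iteratedFDeriv_complexPlane]
  simp only [iteratedFDeriv_two_apply, Matrix.cons_val_zero, Matrix.cons_val_one]
  rw [fderiv_fderiv_apply_self _ hd2, fderiv_fderiv_apply_self _ hd2]
  congr 2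
  · have h1 : (fun t : ℝ => (Q ((r : ℂ) + t • (1 : ℂ))).toReal) = fun t => profile Q (r + t) := by
      ext t
      simp [profile]
    have h2 : deriv (fun t : ℝ => profile Q (r + t)) = fun t => deriv (profile Q) (r + t) := by
      ext t
      exact deriv_comp_const_add (profile Q) r t
    rw [h1, h2, deriv_comp_const_add (deriv (profile Q)) r 0, add_zero]
  · have h1 : (fun t : ℝ => (Q ((r : ℂ) + t • Complex.I)).toReal) =
        fun t => profile Q (√(r ^ 2 + t ^ 2)) := by
      ext t
      rw [hQ.eq_norm, profile]
      congr 4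
      simp [Complex.norm_add_mul_I]
    have hpos : ∀ t : ℝ, 0 < r ^ 2 + t ^ 2 := fun t => by positivity
    have hsq : ∀ t : ℝ, HasDerivAt (fun t : ℝ => √(r ^ 2 + t ^ 2)) (t / √(r ^ 2 + t ^ 2)) t := by
      intro t
      have := ((hasDerivAt_pow 2 t).const_add (r ^ 2)).sqrt (hpos t).ne'
      convert this using 1
      field_simp
      norm_num
      ring
    have h0 : √(r ^ 2 + (0 : ℝ) ^ 2) = r := by simp [Real.sqrt_sq hr.le]
    have htend : Tendsto (fun t : ℝ => √(r ^ 2 + t ^ 2)) (𝓝 0) (𝓝 r) := by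
      have := (hsq 0).continuousAt.tendsto
      rwa [h0] at this
    have hev : ∀ᶠ y in 𝓝 r, ContDiffAt ℝ 2 (profile Q) y := hg.eventually (by simp)
    have h2 : deriv (fun t : ℝ => profile Q (√(r ^ 2 + t ^ 2))) =ᶠ[𝓝 0]
        fun t => t * (deriv (profile Q) (√(r ^ 2 + t ^ 2)) / √(r ^ 2 + t ^ 2)) := by
      filter_upwards [htend.eventually hev] with t ht
      have := ((ht.differentiableAt (by norm_num)).hasDerivAt.comp t (hsq t)).deriv
      rw [Function.comp_def] at this
      rw [this]; ring
    rw [h1, h2.deriv_eq]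
    have hk : ContinuousAt (fun t : ℝ => deriv (profile Q) (√(r ^ 2 + t ^ 2)) / √(r ^ 2 + t ^ 2))
        0 := by
      have hc : ContinuousAt (deriv (profile Q)) (√(r ^ 2 + (0 : ℝ) ^ 2)) := by
        rw [h0]
        exact (contDiffAt_deriv (m := 1) hg (by norm_num)).continuousAt
      exact (ContinuousAt.comp (f := fun t : ℝ => √(r ^ 2 + t ^ 2)) hc (hsq 0).continuousAt).div
        (hsq 0).continuousAt (by rw [h0]; exact hr.ne')
    rw [(hasDerivAt_mul_of_continuousAt hk).deriv, h0]

/-- `r q'(r)`, the derivative of the profile with respect to `log r`. -/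
noncomputable def logSlope (Q : ℂ → EReal) (r : ℝ) : ℝ := r * deriv (profile Q) r

/-! ### The potential between the two components of the droplet -/

/-- The coincidence set consists of two annuli and `m` circles between them, and the potential
is smooth and strictly subharmonic there. -/
structure IsTwoComponent (Q : ℂ → EReal) (m : ℕ) (a₀ b₀ a₁ b₁ : ℝ) (t : ℕ → ℝ) : Prop where
  pot : IsPotential Q
  nonneg : 0 ≤ a₀
  lt₀ : a₀ < b₀
  lt₁ : a₁ < b₁
  gap : b₀ < a₁
  outpost : ∀ k ∈ Finset.Icc 1 m, b₀ < t k ∧ t k < a₁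
  coincidence : coincidenceSet Q =
    annulus a₀ b₀ ∪ (⋃ k ∈ Finset.Icc 1 m, circle (t k)) ∪ annulus a₁ b₁
  smooth : IsC6Near Q (coincidenceSet Q)
  pos : ∀ z ∈ coincidenceSet Q, 0 < quarterLaplacian Q z

theorem isLocalMin_slope {g : ℝ → ℝ} {r l : ℝ} (hr : 0 < r) (hg : DifferentiableAt ℝ g r)
    (h : ∀ᶠ x in 𝓝 r, g r + l * (Real.log x - Real.log r) ≤ g x) : r * deriv g r = l := by
  have hd : HasDerivAt (fun x => g x - l * Real.log x) (deriv g r - l * r⁻¹) r :=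
    hg.hasDerivAt.sub ((Real.hasDerivAt_log hr.ne').const_mul l)
  have hmin : IsLocalMin (fun x => g x - l * Real.log x) r := by
    filter_upwards [h] with x hx
    linarith
  have := hmin.hasDerivAt_eq_zero hd
  have h2 : deriv g r = l * r⁻¹ := by linarith
  rw [h2]
  field_simp

/-- The difference has derivative V'(y) - κ(y-ζ) = o(|y-ζ|) by differentiability of V' at ζ, and the
mean value inequality on the segment from ζ to x supplies the second factor |x-ζ|. -/
theorem isLittleO_sq_of_deriv {V : ℝ → ℝ} {ζ κ : ℝ} (hV : ContDiffAt ℝ 2 V ζ) (h0 : V ζ = 0)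
    (h1 : deriv V ζ = 0) (h2 : deriv (deriv V) ζ = κ) :
    (fun x => V x - κ / 2 * (x - ζ) ^ 2) =o[𝓝 ζ] fun x => (x - ζ) ^ 2 := by
  have hd : HasDerivAt (deriv V) κ ζ := by
    rw [← h2]
    exact ((contDiffAt_deriv (m := 1) hV (by norm_num)).differentiableAt (by norm_num)).hasDerivAt
  have ho := hd.isLittleO
  rw [Asymptotics.isLittleO_iff] at ho ⊢
  intro c hc
  have hev : ∀ᶠ y in 𝓝 ζ, DifferentiableAt ℝ V y :=
    (hV.eventually (by simp)).mono fun y hy => hy.differentiableAt (by norm_num)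
  obtain ⟨δ, hδ, hball⟩ := Metric.eventually_nhds_iff_ball.1 ((ho hc).and hev)
  filter_upwards [Metric.ball_mem_nhds ζ hδ] with x hx
  have hsub : ∀ y ∈ segment ℝ ζ x, y ∈ Metric.ball ζ δ ∧ |y - ζ| ≤ |x - ζ| := by
    intro y hy
    have := norm_sub_le_of_mem_segment hy
    rw [Real.norm_eq_abs, Real.norm_eq_abs, abs_sub_comm] at this
    have h3 : |y - ζ| ≤ |x - ζ| := by
      obtain ⟨u, v, hu, hv, huv, rfl⟩ := hy
      have : u • ζ + v • x - ζ = v * (x - ζ) := by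
        simp only [smul_eq_mul]; linear_combination ζ * huv
      rw [this, abs_mul, abs_of_nonneg hv]
      have : v ≤ 1 := by linarith
      exact mul_le_of_le_one_left (abs_nonneg _) this
    refine ⟨?_, h3⟩
    rw [Metric.mem_ball, Real.dist_eq] at hx ⊢
    exact h3.trans_lt hx
  have key := Convex.norm_image_sub_le_of_norm_hasDerivWithin_le (𝕜 := ℝ)
    (f := fun y => V y - κ / 2 * (y - ζ) ^ 2) (f' := fun y => deriv V y - κ * (y - ζ))
    (s := segment ℝ ζ x) (C := c * |x - ζ|) (fun y hy => by
      have hdy := (hball y (hsub y hy).1).2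
      have h5 : HasDerivAt (fun y => V y - κ / 2 * (y - ζ) ^ 2)
          (deriv V y - κ / 2 * (2 * (y - ζ) ^ (2 - 1) * 1)) y :=
        hdy.hasDerivAt.sub (((hasDerivAt_id y).sub_const ζ).pow 2 |>.const_mul (κ / 2))
      have h6 : deriv V y - κ / 2 * (2 * (y - ζ) ^ (2 - 1) * 1) = deriv V y - κ * (y - ζ) := by
        norm_num; ring
      rw [h6] at h5
      exact h5.hasDerivWithinAt) (fun y hy => by
      have h4 := (hball y (hsub y hy).1).1
      rw [h1, Real.norm_eq_abs, Real.norm_eq_abs, smul_eq_mul] at h4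
      rw [Real.norm_eq_abs]
      have : deriv V y - κ * (y - ζ) = deriv V y - 0 - (y - ζ) * κ := by ring
      rw [this]
      exact h4.trans (mul_le_mul_of_nonneg_left (hsub y hy).2 hc.le)) (convex_segment _ _)
    (left_mem_segment _ _ _) (right_mem_segment _ _ _)
  simp only [h0, sub_self, ne_eq, OfNat.ofNat_ne_zero, not_false_eq_true, zero_pow, mul_zero,
    sub_zero, Real.norm_eq_abs] at key ⊢
  rwa [abs_pow, pow_two |x - ζ|, ← mul_assoc]

namespace IsTwoComponent

variable {Q : ℂ → EReal} {m : ℕ} {a₀ b₀ a₁ b₁ : ℝ} {t : ℕ → ℝ}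

theorem mem_iff (h : IsTwoComponent Q m a₀ b₀ a₁ b₁ t) {r : ℝ} (hr : 0 < r) :
    (r : ℂ) ∈ coincidenceSet Q ↔
      (a₀ ≤ r ∧ r ≤ b₀) ∨ (∃ k ∈ Finset.Icc 1 m, r = t k) ∨ (a₁ ≤ r ∧ r ≤ b₁) := by
  rw [h.coincidence]
  simp only [annulus, circle, Set.mem_union, Set.mem_iUnion, Set.mem_ofPred_eq, Complex.norm_real,
    Real.norm_of_nonneg hr.le, exists_prop, or_assoc]

theorem b₀_pos (h : IsTwoComponent Q m a₀ b₀ a₁ b₁ t) : 0 < b₀ := h.nonneg.trans_lt h.lt₀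

theorem a₁_pos (h : IsTwoComponent Q m a₀ b₀ a₁ b₁ t) : 0 < a₁ := h.b₀_pos.trans h.gap

theorem t_pos (h : IsTwoComponent Q m a₀ b₀ a₁ b₁ t) {k : ℕ} (hk : k ∈ Finset.Icc 1 m) :
    0 < t k := h.b₀_pos.trans (h.outpost k hk).1

theorem b₀_mem (h : IsTwoComponent Q m a₀ b₀ a₁ b₁ t) : (b₀ : ℂ) ∈ coincidenceSet Q :=
  (h.mem_iff h.b₀_pos).2 (Or.inl ⟨h.lt₀.le, le_rfl⟩)

theorem a₁_mem (h : IsTwoComponent Q m a₀ b₀ a₁ b₁ t) : (a₁ : ℂ) ∈ coincidenceSet Q :=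
  (h.mem_iff h.a₁_pos).2 (Or.inr (Or.inr ⟨le_rfl, h.lt₁.le⟩))

theorem t_mem (h : IsTwoComponent Q m a₀ b₀ a₁ b₁ t) {k : ℕ} (hk : k ∈ Finset.Icc 1 m) :
    (t k : ℂ) ∈ coincidenceSet Q :=
  (h.mem_iff (h.t_pos hk)).2 (Or.inr (Or.inl ⟨k, hk, rfl⟩))

theorem eq_profile (h : IsTwoComponent Q m a₀ b₀ a₁ b₁ t) {r : ℝ}
    (hr : (r : ℂ) ∈ coincidenceSet Q) : Q r = (profile Q r : EReal) :=
  (EReal.coe_toReal (h.smooth.eventually_ne_top hr).self_of_nhds (h.pot.ne_bot _)).symm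

theorem eventually_eq_profile (h : IsTwoComponent Q m a₀ b₀ a₁ b₁ t) {r : ℝ}
    (hr : (r : ℂ) ∈ coincidenceSet Q) : ∀ᶠ x : ℝ in 𝓝 r, Q x = (profile Q x : EReal) :=
  (h.smooth.eventually_ne_top hr).mono fun _ hx => (EReal.coe_toReal hx (h.pot.ne_bot _)).symm

/-- A line below the potential that touches it at a coincidence point has slope `r q'(r)`. -/
theorem slope_eq (h : IsTwoComponent Q m a₀ b₀ a₁ b₁ t) {r l : ℝ} (hr0 : 0 < r)
    (hr : (r : ℂ) ∈ coincidenceSet Q) (hline : ∀ x : ℝ, 0 < x →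
      ((profile Q r + l * (Real.log x - Real.log r) : ℝ) : EReal) ≤ Q x) :
    logSlope Q r = l := by
  refine isLocalMin_slope hr0
    ((h.smooth.contDiffAt_profile hr).differentiableAt (by norm_num)) ?_
  filter_upwards [h.eventually_eq_profile hr, lt_mem_nhds hr0] with x hx hx0
  have := hline x hx0
  rw [hx] at this
  exact_mod_cast this

theorem line_at (h : IsTwoComponent Q m a₀ b₀ a₁ b₁ t) {r : ℝ} (hr0 : 0 < r)
    (hr : (r : ℂ) ∈ coincidenceSet Q) : logSlope Q r ∈ Set.Icc (0 : ℝ) 2 ∧ ∀ x : ℝ, 0 < x →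
      ((profile Q r + logSlope Q r * (Real.log x - Real.log r) : ℝ) : EReal) ≤ Q x := by
  obtain ⟨l, hl, hline⟩ := exists_line_of_mem_coincidenceSet h.pot hr0 hr
    (h.smooth.eventually_ne_top hr).self_of_nhds
  rw [h.slope_eq hr0 hr hline]
  exact ⟨hl, hline⟩

/-- (r q')' = q' + r q'' is 4r times the radial quarter Laplacian, so positivity of ΔQ is strict
convexity of q in log r. -/
theorem hasDerivAt_logSlope (h : IsTwoComponent Q m a₀ b₀ a₁ b₁ t) {r : ℝ} (hr0 : 0 < r)
    (hr : (r : ℂ) ∈ coincidenceSet Q) :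
    HasDerivAt (logSlope Q) (4 * r * quarterLaplacian Q r) r := by
  have hd : ContDiffAt ℝ 5 (deriv (profile Q)) r :=
    contDiffAt_deriv (h.smooth.contDiffAt_profile hr) (by norm_num)
  have := (hasDerivAt_id r).mul (hd.differentiableAt (by norm_num)).hasDerivAt
  rw [quarterLaplacian_eq h.pot hr0 (h.smooth.contDiffAt hr)]
  refine HasDerivAt.congr_deriv (f := logSlope Q) this ?_
  simp only [id]
  field_simp
  ring

theorem strictMonoOn_logSlope (h : IsTwoComponent Q m a₀ b₀ a₁ b₁ t) {r₁ r₂ : ℝ} (hr₁ : 0 < r₁)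
    (hsub : ∀ r ∈ Set.Icc r₁ r₂, (r : ℂ) ∈ coincidenceSet Q) :
    StrictMonoOn (logSlope Q) (Set.Icc r₁ r₂) := by
  refine strictMonoOn_of_deriv_pos (convex_Icc _ _) (fun x hx => ?_) (fun x hx => ?_)
  · exact (h.hasDerivAt_logSlope (hr₁.trans_le hx.1) (hsub x hx)).continuousAt.continuousWithinAt
  · have hx' := interior_subset hx
    have hx0 := hr₁.trans_le hx'.1
    rw [(h.hasDerivAt_logSlope hx0 (hsub x hx')).deriv]
    have := h.pos x (hsub x hx')
    positivity

theorem logSlope_lt_left (h : IsTwoComponent Q m a₀ b₀ a₁ b₁ t) {r : ℝ} (hr0 : 0 < r)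
    (har : a₀ ≤ r) (hrb : r < b₀) : logSlope Q r < logSlope Q b₀ :=
  h.strictMonoOn_logSlope hr0 (r₂ := b₀) (fun _ hx => (h.mem_iff (hr0.trans_le hx.1)).2
    (Or.inl ⟨har.trans hx.1, hx.2⟩)) ⟨le_rfl, hrb.le⟩ ⟨hrb.le, le_rfl⟩ hrb

theorem logSlope_lt_right (h : IsTwoComponent Q m a₀ b₀ a₁ b₁ t) {r : ℝ}
    (har : a₁ < r) (hrb : r ≤ b₁) : logSlope Q a₁ < logSlope Q r :=
  h.strictMonoOn_logSlope h.a₁_pos (r₂ := r) (fun _ hx =>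
    (h.mem_iff (h.a₁_pos.trans_le hx.1)).2 (Or.inr (Or.inr ⟨hx.1, hx.2.trans hrb⟩)))
    ⟨le_rfl, har.le⟩ ⟨har.le, le_rfl⟩ har

/-- Slopes inside the inner annulus are already nonnegative and increase strictly up to b₀.
Strictness is what allows truncation at the origin and gives decay of the Boltzmann factor there. -/
theorem logSlope_pos (h : IsTwoComponent Q m a₀ b₀ a₁ b₁ t) : 0 < logSlope Q b₀ := by
  have h0 := h.lt₀
  have h1 := h.nonneg
  have hm : 0 < (a₀ + b₀) / 2 := by linarith
  refine lt_of_le_of_lt ?_ (h.logSlope_lt_left hm (by linarith) (by linarith))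
  exact (h.line_at hm ((h.mem_iff hm).2 (Or.inl ⟨by linarith, by linarith⟩))).1.1

theorem logSlope_lt_two (h : IsTwoComponent Q m a₀ b₀ a₁ b₁ t) : logSlope Q a₁ < 2 := by
  have h0 := h.lt₁
  have h1 := h.a₁_pos
  have hm : 0 < (a₁ + b₁) / 2 := by linarith
  refine lt_of_lt_of_le (h.logSlope_lt_right (r := (a₁ + b₁) / 2) (by linarith) (by linarith)) ?_
  exact (h.line_at hm ((h.mem_iff hm).2 (Or.inr (Or.inr ⟨by linarith, by linarith⟩)))).1.2

/-- Minimize q - l log r over [b₀, a₁]. The line of slope l through the minimum lies below `Q`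
everywhere, so the minimum is a coincidence point of slope l, and in [b₀, a₁] there are only the
listed ones. -/
theorem exists_slope_eq (h : IsTwoComponent Q m a₀ b₀ a₁ b₁ t) {l : ℝ}
    (hl : l ∈ Set.Icc (logSlope Q b₀) (logSlope Q a₁)) :
    l ∈ logSlope Q '' ({b₀, a₁} ∪ t '' (Finset.Icc 1 m : Set ℕ)) := by
  set F : ℝ → EReal := fun r => Q r + ((-(l * Real.log r) : ℝ) : EReal) with hF
  have hlsc : LowerSemicontinuousOn F (Set.Icc b₀ a₁) := by
    refine LowerSemicontinuousOn.add' ?_ ?_ ?_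
    · exact (h.pot.lsc.comp Complex.continuous_ofReal).lowerSemicontinuousOn _
    · have : ContinuousOn (fun r : ℝ => ((-(l * Real.log r) : ℝ) : EReal)) (Set.Icc b₀ a₁) := by
        refine continuous_coe_real_ereal.comp_continuousOn
          (continuousOn_const.mul (ContinuousOn.log continuousOn_id ?_)).neg
        intro x hx
        exact (h.b₀_pos.trans_le hx.1).ne'
      exact this.lowerSemicontinuousOn
    · intro x _
      exact EReal.continuousAt_add (Or.inr (EReal.coe_ne_bot _)) (Or.inl (h.pot.ne_bot _))
  obtain ⟨r, hr, hmin⟩ := LowerSemicontinuousOn.exists_isMinOn (Set.nonempty_Icc.2 h.gap.le)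
    isCompact_Icc hlsc
  have hr0 : 0 < r := h.b₀_pos.trans_le hr.1
  have hFb : F b₀ = ((profile Q b₀ - l * Real.log b₀ : ℝ) : EReal) := by
    simp only [hF]
    rw [h.eq_profile h.b₀_mem, ← EReal.coe_add, sub_eq_add_neg]
  have hFa : F a₁ = ((profile Q a₁ - l * Real.log a₁ : ℝ) : EReal) := by
    simp only [hF]
    rw [h.eq_profile h.a₁_mem, ← EReal.coe_add, sub_eq_add_neg]
  have htop : Q r ≠ ⊤ := by
    intro htop
    have h1 : F r ≤ F b₀ := hmin (show b₀ ∈ Set.Icc b₀ a₁ from ⟨le_rfl, h.gap.le⟩)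
    rw [hFb] at h1
    simp only [hF, htop, EReal.top_add_coe] at h1
    exact absurd (top_le_iff.1 h1) (EReal.coe_ne_top _)
  obtain ⟨A, hA⟩ := EReal_eq_coe_of_ne (h.pot.ne_bot r) htop
  have hFr : F r = ((A - l * Real.log r : ℝ) : EReal) := by
    simp only [hF]
    rw [hA, ← EReal.coe_add, sub_eq_add_neg]
  have hb : A - l * Real.log r ≤ profile Q b₀ - l * Real.log b₀ := by
    have h1 : F r ≤ F b₀ := hmin (show b₀ ∈ Set.Icc b₀ a₁ from ⟨le_rfl, h.gap.le⟩)
    rw [hFb, hFr] at h1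
    exact_mod_cast h1
  have ha : A - l * Real.log r ≤ profile Q a₁ - l * Real.log a₁ := by
    have h1 : F r ≤ F a₁ := hmin (show a₁ ∈ Set.Icc b₀ a₁ from ⟨h.gap.le, le_rfl⟩)
    rw [hFa, hFr] at h1
    exact_mod_cast h1
  have hline : ∀ x : ℝ, 0 < x → ((A - l * Real.log r + l * Real.log x : ℝ) : EReal) ≤ Q x := by
    intro x hx
    -- Beyond the interval the line is dominated by the supporting lines at b₀ and a₁, because l
    -- lies between their slopes.
    rcases lt_or_ge x b₀ with hxb | hxb
    · refine le_trans ?_ ((h.line_at h.b₀_pos h.b₀_mem).2 x hx)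
      have hlog : Real.log x < Real.log b₀ := Real.log_lt_log hx hxb
      rw [EReal.coe_le_coe_iff]
      nlinarith [hl.1]
    · rcases lt_or_ge a₁ x with hxa | hxa
      · refine le_trans ?_ ((h.line_at h.a₁_pos h.a₁_mem).2 x hx)
        have hlog : Real.log a₁ < Real.log x := Real.log_lt_log h.a₁_pos hxa
        rw [EReal.coe_le_coe_iff]
        nlinarith [hl.2]
      · have h1 : F r ≤ F x := hmin (show x ∈ Set.Icc b₀ a₁ from ⟨hxb, hxa⟩)
        rw [hFr] at h1
        by_cases hxt : Q x = ⊤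
        · rw [hxt]; exact le_top
        obtain ⟨B, hB⟩ := EReal_eq_coe_of_ne (h.pot.ne_bot x) hxt
        simp only [hF, hB] at h1
        rw [← EReal.coe_add, EReal.coe_le_coe_iff] at h1
        rw [hB, EReal.coe_le_coe_iff]
        linarith
  have hl0 : 0 < l := h.logSlope_pos.trans_le hl.1
  have hl2 : l ≤ 2 := hl.2.trans h.logSlope_lt_two.le
  have hrS : (r : ℂ) ∈ coincidenceSet Q :=
    mem_coincidenceSet_of_line h.pot hl0 hl2 hr0 hline (by rw [hA]; congr 1; ring)
  have hAp : A = profile Q r := by simp [profile, hA]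
  refine ⟨r, ?_, h.slope_eq hr0 hrS fun x hx => le_trans (le_of_eq ?_) (hline x hx)⟩
  · rcases (h.mem_iff hr0).1 hrS with h1 | ⟨k, hk, rfl⟩ | h1
    · exact Or.inl (Or.inl (le_antisymm h1.2 hr.1))
    · exact Or.inr ⟨k, by simpa using hk, rfl⟩
    · exact Or.inl (Or.inr (le_antisymm hr.2 h1.1))
  · rw [hAp]; congr 1; ring

/-- Otherwise a nondegenerate interval of slopes would be contained in the finite set of slopes at
b₀, a₁ and the outposts. -/
theorem logSlope_eq (h : IsTwoComponent Q m a₀ b₀ a₁ b₁ t) : logSlope Q a₁ = logSlope Q b₀ := by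
  have hle : logSlope Q b₀ ≤ logSlope Q a₁ := by
    have h1 := (h.line_at h.b₀_pos h.b₀_mem).2 a₁ h.a₁_pos
    have h2 := (h.line_at h.a₁_pos h.a₁_mem).2 b₀ h.b₀_pos
    rw [h.eq_profile h.a₁_mem, EReal.coe_le_coe_iff] at h1
    rw [h.eq_profile h.b₀_mem, EReal.coe_le_coe_iff] at h2
    have := Real.log_lt_log h.b₀_pos h.gap
    nlinarith
  by_contra hne
  have hlt : logSlope Q b₀ < logSlope Q a₁ := lt_of_le_of_ne hle (Ne.symm hne)
  refine Set.Icc_infinite hlt (Set.Finite.subset ?_ fun l hl => h.exists_slope_eq hl)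
  exact (((Set.finite_singleton a₁).insert b₀).union
    ((Finset.finite_toSet _).image _)).image _

theorem profile_a₁ (h : IsTwoComponent Q m a₀ b₀ a₁ b₁ t) :
    profile Q a₁ = profile Q b₀ + logSlope Q b₀ * (Real.log a₁ - Real.log b₀) := by
  have h1 := (h.line_at h.b₀_pos h.b₀_mem).2 a₁ h.a₁_pos
  have h2 := (h.line_at h.a₁_pos h.a₁_mem).2 b₀ h.b₀_pos
  rw [h.eq_profile h.a₁_mem, EReal.coe_le_coe_iff] at h1
  rw [h.eq_profile h.b₀_mem, EReal.coe_le_coe_iff, h.logSlope_eq] at h2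
  linarith

/-- The supporting line at `t k` is at most the common tangent at b₀ and at a₁, hence at most the
tangent in between; the reverse inequality is the tangent itself lying below `Q`. -/
theorem profile_t (h : IsTwoComponent Q m a₀ b₀ a₁ b₁ t) {k : ℕ} (hk : k ∈ Finset.Icc 1 m) :
    profile Q (t k) = profile Q b₀ + logSlope Q b₀ * (Real.log (t k) - Real.log b₀) := by
  have h1 := (h.line_at h.b₀_pos h.b₀_mem).2 (t k) (h.t_pos hk)
  have h2 := (h.line_at (h.t_pos hk) (h.t_mem hk)).2 b₀ h.b₀_pos
  have h3 := (h.line_at (h.t_pos hk) (h.t_mem hk)).2 a₁ h.a₁_pos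
  rw [h.eq_profile (h.t_mem hk), EReal.coe_le_coe_iff] at h1
  rw [h.eq_profile h.b₀_mem, EReal.coe_le_coe_iff] at h2
  rw [h.eq_profile h.a₁_mem, EReal.coe_le_coe_iff, h.profile_a₁] at h3
  refine le_antisymm ?_ h1
  have hb : 0 < Real.log (t k) - Real.log b₀ :=
    sub_pos.2 (Real.log_lt_log h.b₀_pos (h.outpost k hk).1)
  have ha : 0 < Real.log a₁ - Real.log (t k) :=
    sub_pos.2 (Real.log_lt_log (h.t_pos hk) (h.outpost k hk).2)
  generalize logSlope Q (t k) = s at h2 h3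
  by_contra! hcon
  have e1 := mul_le_mul_of_nonneg_right h2 ha.le
  have e2 := mul_le_mul_of_nonneg_right h3 hb.le
  have e3 := mul_lt_mul_of_pos_right hcon (add_pos ha hb)
  nlinarith

/-- The common tangent line of the gap, as a function of the radius. -/
theorem tangent_le (h : IsTwoComponent Q m a₀ b₀ a₁ b₁ t) {r : ℝ} (hr : 0 < r) :
    ((profile Q b₀ + logSlope Q b₀ * (Real.log r - Real.log b₀) : ℝ) : EReal) ≤ Q r :=
  (h.line_at h.b₀_pos h.b₀_mem).2 r hr

theorem logSlope_t (h : IsTwoComponent Q m a₀ b₀ a₁ b₁ t) {k : ℕ} (hk : k ∈ Finset.Icc 1 m) :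
    logSlope Q (t k) = logSlope Q b₀ := by
  refine h.slope_eq (h.t_pos hk) (h.t_mem hk) fun x hx => le_trans (le_of_eq ?_) (h.tangent_le hx)
  rw [h.profile_t hk]
  congr 1; ring

/-- A touching point is a coincidence point with the slope of the tangent, and strict monotonicity
of the slope excludes the other points of both annuli. These radii are thus the only maxima in the
later Laplace analysis. -/
theorem tangent_eq_imp (h : IsTwoComponent Q m a₀ b₀ a₁ b₁ t) {r : ℝ} (hr : 0 < r)
    (heq : Q r = ((profile Q b₀ + logSlope Q b₀ * (Real.log r - Real.log b₀) : ℝ) : EReal)) :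
    r = b₀ ∨ r = a₁ ∨ ∃ k ∈ Finset.Icc 1 m, r = t k := by
  have hrS : (r : ℂ) ∈ coincidenceSet Q := by
    refine mem_coincidenceSet_of_line h.pot (c := profile Q b₀ - logSlope Q b₀ * Real.log b₀)
      h.logSlope_pos (h.logSlope_eq ▸ h.logSlope_lt_two.le) hr
      (fun x hx => le_trans (le_of_eq ?_) (h.tangent_le hx)) (heq.trans ?_) <;> (congr 1; ring)
  have hp : profile Q r = profile Q b₀ + logSlope Q b₀ * (Real.log r - Real.log b₀) := by
    rw [profile, heq, EReal.toReal_coe]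
  have hs : logSlope Q r = logSlope Q b₀ := by
    refine h.slope_eq hr hrS fun x hx => le_trans (le_of_eq ?_) (h.tangent_le hx)
    rw [hp]; congr 1; ring
  rcases (h.mem_iff hr).1 hrS with h1 | ⟨k, hk, rfl⟩ | h1
  · rcases h1.2.lt_or_eq with h2 | h2
    · exact absurd hs (h.logSlope_lt_left hr h1.1 h2).ne
    · exact Or.inl h2
  · exact Or.inr (Or.inr ⟨k, hk, rfl⟩)
  · rcases h1.1.lt_or_eq with h2 | h2
    · exact absurd (hs.trans h.logSlope_eq.symm) (h.logSlope_lt_right h2 h1.2).ne'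
    · exact Or.inr (Or.inl h2.symm)

/-- Second-order expansion of `q - tangent` at a zero. -/
theorem isLittleO_tangent (h : IsTwoComponent Q m a₀ b₀ a₁ b₁ t) {ζ : ℝ} (hζ : 0 < ζ)
    (hS : (ζ : ℂ) ∈ coincidenceSet Q) (hs : logSlope Q ζ = logSlope Q b₀)
    (hp : profile Q ζ = profile Q b₀ + logSlope Q b₀ * (Real.log ζ - Real.log b₀)) :
    (fun r => profile Q r - (profile Q b₀ + logSlope Q b₀ * (Real.log r - Real.log b₀)) -
      4 * quarterLaplacian Q ζ / 2 * (r - ζ) ^ 2) =o[𝓝 ζ] fun r => (r - ζ) ^ 2 := by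
  have hg := h.smooth.contDiffAt_profile hS
  set l := logSlope Q b₀
  have hd : ∀ᶠ r in 𝓝 ζ, deriv (fun r => profile Q r -
      (profile Q b₀ + l * (Real.log r - Real.log b₀))) r = deriv (profile Q) r - l * r⁻¹ := by
    filter_upwards [hg.eventually (by simp), lt_mem_nhds hζ] with r hr hr0
    have := (hr.differentiableAt (by norm_num)).hasDerivAt.sub
      ((((Real.hasDerivAt_log hr0.ne').sub_const (Real.log b₀)).const_mul l).const_add
        (profile Q b₀))
    exact this.deriv
  refine isLittleO_sq_of_deriv ?_ (by rw [hp]; ring) ?_ ?_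
  · refine (hg.of_le (by norm_num)).sub (contDiffAt_const.add (contDiffAt_const.mul
      (ContDiffAt.sub ?_ contDiffAt_const)))
    exact Real.contDiffAt_log.2 hζ.ne'
  · rw [hd.self_of_nhds, ← hs, logSlope]
    field_simp
    ring
  -- With l = ζ q'(ζ) the second derivative of q - l log r is q'' + l/ζ² = q'' + q'/ζ = 4ΔQ(ζ).
  · rw [Filter.EventuallyEq.deriv_eq (f := fun r => deriv (profile Q) r - l * r⁻¹) hd]
    have h2 : DifferentiableAt ℝ (deriv (profile Q)) ζ :=
      (contDiffAt_deriv (m := 5) hg (by norm_num)).differentiableAt (by norm_num)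
    have := h2.hasDerivAt.sub ((hasDerivAt_inv hζ.ne').const_mul l)
    rw [HasDerivAt.deriv (f := fun r => deriv (profile Q) r - l * r⁻¹) this,
      quarterLaplacian_eq h.pot hζ (h.smooth.contDiffAt hS), ← hs, logSlope]
    field_simp
    ring

end IsTwoComponent

/-! ### Positivity of the angular part of the logarithmic kernel -/

/-- `min (|z|, |w|)² / (z w̄)`: the quotient of the smaller by the larger modulus, with the
difference of the arguments. -/
noncomputable def radialRatio (p : ℂ × ℂ) : ℂ :=
  ((min ‖p.1‖ ‖p.2‖ ^ 2 : ℝ) : ℂ) / (p.1 * (starRingEnd ℂ) p.2)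

theorem measurable_radialRatio : Measurable radialRatio := by
  unfold radialRatio
  fun_prop

theorem norm_radialRatio_le (p : ℂ × ℂ) : ‖radialRatio p‖ ≤ 1 := by
  rw [radialRatio, norm_div, norm_mul, RCLike.norm_conj, Complex.norm_real,
    Real.norm_of_nonneg (by positivity)]
  refine div_le_one_of_le₀ ?_ (by positivity)
  have h0 : 0 ≤ min ‖p.1‖ ‖p.2‖ := le_min (norm_nonneg _) (norm_nonneg _)
  rw [pow_two]
  exact mul_le_mul (min_le_left _ _) (min_le_right _ _) h0 (norm_nonneg _)

/-- This splits log|z-w| into the radial kernel log max(|z|, |w|) and the angular remainder log|1 -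
ratio|, whose double integral is shown below to be nonpositive. -/
theorem norm_one_sub_radialRatio {z w : ℂ} (hz : z ≠ 0) (hw : w ≠ 0) :
    ‖1 - radialRatio (z, w)‖ = ‖z - w‖ / max ‖z‖ ‖w‖ := by
  have hz' : ‖z‖ ≠ 0 := norm_ne_zero_iff.2 hz
  have hw' : ‖w‖ ≠ 0 := norm_ne_zero_iff.2 hw
  have hcw : (starRingEnd ℂ) w ≠ 0 := (map_ne_zero _).2 hw
  rcases le_total ‖z‖ ‖w‖ with h | h
  · have : 1 - radialRatio (z, w) = (starRingEnd ℂ) ((w - z) / w) := by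
      rw [radialRatio, min_eq_left h]
      simp only [Complex.ofReal_pow, map_div₀, map_sub]
      rw [← Complex.mul_conj']
      field_simp
    rw [this, RCLike.norm_conj, norm_div, norm_sub_rev, max_eq_right h]
  · have : 1 - radialRatio (z, w) = (z - w) / z := by
      rw [radialRatio, min_eq_right h]
      simp only [Complex.ofReal_pow]
      rw [← Complex.mul_conj']
      field_simp
    rw [this, norm_div, max_eq_left h]

/-- The truncated inverse power `z⁻ᵏ 1_{s ≤ |z|}`. -/
noncomputable def truncInvPow (k : ℕ) (s : ℝ) (z : ℂ) : ℂ := if s ≤ ‖z‖ then (z ^ k)⁻¹ else 0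

/-- Both truncations together cut the integral at s = min(|z|, |w|), and 2(j+1)s^(2j+1) integrates
to min^(2(j+1)). The power of the ratio thereby becomes a superposition of rank-one Gram kernels;
the norm identity serves Fubini. -/
theorem integral_truncInvPow (j : ℕ) (p : ℂ × ℂ) :
    Integrable (fun s : ℝ => ((2 * (j + 1) * s ^ (2 * j + 1) : ℝ) : ℂ) *
      (truncInvPow (j + 1) s p.1 * (starRingEnd ℂ) (truncInvPow (j + 1) s p.2)))
      (volume.restrict (Set.Ioi 0)) ∧
    ∫ s in Set.Ioi (0 : ℝ), ((2 * (j + 1) * s ^ (2 * j + 1) : ℝ) : ℂ) *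
      (truncInvPow (j + 1) s p.1 * (starRingEnd ℂ) (truncInvPow (j + 1) s p.2)) =
      radialRatio p ^ (j + 1) ∧
    ∫ s in Set.Ioi (0 : ℝ), ‖((2 * (j + 1) * s ^ (2 * j + 1) : ℝ) : ℂ) *
      (truncInvPow (j + 1) s p.1 * (starRingEnd ℂ) (truncInvPow (j + 1) s p.2))‖ =
      ‖radialRatio p‖ ^ (j + 1) := by
  set m := min ‖p.1‖ ‖p.2‖ with hm
  have hm0 : 0 ≤ m := le_min (norm_nonneg _) (norm_nonneg _)
  set c : ℂ := (p.1 ^ (j + 1))⁻¹ * (starRingEnd ℂ) ((p.2 ^ (j + 1))⁻¹) with hc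
  set F : ℝ → ℂ := fun s => ((2 * (j + 1) * s ^ (2 * j + 1) : ℝ) : ℂ) *
      (truncInvPow (j + 1) s p.1 * (starRingEnd ℂ) (truncInvPow (j + 1) s p.2)) with hF
  have hFi : F = Set.indicator (Set.Iic m)
      (fun s => ((2 * (j + 1) * s ^ (2 * j + 1) : ℝ) : ℂ) * c) := by
    ext s
    simp only [hF, truncInvPow, Set.indicator, Set.mem_Iic, hm, le_min_iff, hc]
    by_cases h1 : s ≤ ‖p.1‖ <;> by_cases h2 : s ≤ ‖p.2‖ <;> simp [h1, h2]
  have hset : Set.Ioi (0 : ℝ) ∩ Set.Iic m = Set.Ioc 0 m := Set.Ioi_inter_Iic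
  have hreal : ∫ s in Set.Ioc (0 : ℝ) m, (2 * (j + 1) * s ^ (2 * j + 1) : ℝ) =
      m ^ (2 * (j + 1)) := by
    rw [← intervalIntegral.integral_of_le hm0, intervalIntegral.integral_const_mul, integral_pow]
    push_cast
    rw [zero_pow (by omega)]
    field_simp
    ring
  have hci : c * ((m ^ (2 * (j + 1)) : ℝ) : ℂ) = radialRatio p ^ (j + 1) := by
    simp only [hc, radialRatio, div_pow, mul_pow, map_inv₀, map_pow, Complex.ofReal_pow, ← hm]
    rw [pow_mul, div_eq_mul_inv, mul_inv]
    ring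
  refine ⟨?_, ?_, ?_⟩
  · rw [hFi, integrable_indicator_iff measurableSet_Iic, IntegrableOn,
      Measure.restrict_restrict measurableSet_Iic, Set.inter_comm, hset]
    exact (Continuous.integrableOn_Ioc (by fun_prop))
  · rw [hFi, setIntegral_indicator measurableSet_Iic, hset, integral_mul_const,
      integral_complex_ofReal, hreal, mul_comm, hci]
  · have hn : ∀ s ∈ Set.Ioi (0 : ℝ), ‖F s‖ = Set.indicator (Set.Iic m)
        (fun s => (2 * (j + 1) * s ^ (2 * j + 1) : ℝ) * ‖c‖) s := by
      intro s hs
      have hs' : 0 < s := hs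
      rw [hFi]
      simp only [Set.indicator]
      split_ifs
      · rw [norm_mul, Complex.norm_real, Real.norm_of_nonneg (by positivity)]
      · simp
    rw [setIntegral_congr_fun measurableSet_Ioi hn, setIntegral_indicator measurableSet_Iic, hset,
      integral_mul_const, hreal, ← norm_pow, ← hci, norm_mul _ ((m ^ (2 * (j + 1)) : ℝ) : ℂ),
      Complex.norm_real, Real.norm_of_nonneg (by positivity), mul_comm]

theorem measurable_truncInvPow (k : ℕ) :
    Measurable fun q : ℝ × ℂ => truncInvPow k q.1 q.2 := by
  unfold truncInvPow
  exact Measurable.ite (measurableSet_le measurable_fst measurable_snd.norm)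
    ((measurable_snd.pow_const k).inv) measurable_const

/-- After Fubini the integrand in s is a nonnegative weight times |∫ `truncInvPow` dσ|². -/
theorem integral_re_radialRatio_pow_nonneg (σ : Measure ℂ) [IsProbabilityMeasure σ] (j : ℕ) :
    0 ≤ ∫ p, (radialRatio p ^ (j + 1)).re ∂(σ.prod σ) := by
  set G : (ℂ × ℂ) → ℝ → ℂ := fun p s => ((2 * (j + 1) * s ^ (2 * j + 1) : ℝ) : ℂ) *
      (truncInvPow (j + 1) s p.1 * (starRingEnd ℂ) (truncInvPow (j + 1) s p.2)) with hG
  have hmeas : Measurable (Function.uncurry G) := by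
    have h1 : Measurable fun q : (ℂ × ℂ) × ℝ => truncInvPow (j + 1) q.2 q.1.1 :=
      (measurable_truncInvPow (j + 1)).comp (by fun_prop : Measurable
        fun q : (ℂ × ℂ) × ℝ => (q.2, q.1.1))
    have h2 : Measurable fun q : (ℂ × ℂ) × ℝ => truncInvPow (j + 1) q.2 q.1.2 :=
      (measurable_truncInvPow (j + 1)).comp (by fun_prop : Measurable
        fun q : (ℂ × ℂ) × ℝ => (q.2, q.1.2))
    exact (by fun_prop : Measurable fun q : (ℂ × ℂ) × ℝ =>
      ((2 * (j + 1) * q.2 ^ (2 * j + 1) : ℝ) : ℂ)).mul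
        (h1.mul (Complex.continuous_conj.measurable.comp h2))
  have hint : Integrable (Function.uncurry G) ((σ.prod σ).prod (volume.restrict (Set.Ioi 0))) := by
    refine (integrable_prod_iff hmeas.aestronglyMeasurable).2
      ⟨Eventually.of_forall fun p => (integral_truncInvPow j p).1, ?_⟩
    have : (fun p => ∫ s in Set.Ioi (0 : ℝ), ‖Function.uncurry G (p, s)‖) =
        fun p => ‖radialRatio p‖ ^ (j + 1) := by
      ext p
      exact (integral_truncInvPow j p).2.2
    rw [this]
    refine Integrable.of_bound (measurable_radialRatio.norm.pow_const _).aestronglyMeasurable 1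
      (Eventually.of_forall fun p => ?_)
    rw [norm_pow, norm_norm]
    exact pow_le_one₀ (norm_nonneg _) (norm_radialRatio_le p)
  have hswap := integral_integral_swap hint
  have hpow : Integrable (fun p => radialRatio p ^ (j + 1)) (σ.prod σ) := by
    refine Integrable.of_bound (measurable_radialRatio.pow_const _).aestronglyMeasurable 1
      (Eventually.of_forall fun p => ?_)
    rw [norm_pow]
    exact pow_le_one₀ (norm_nonneg _) (norm_radialRatio_le p)
  have hL : ∫ p, (∫ s in Set.Ioi (0 : ℝ), G p s) ∂(σ.prod σ) =
      ∫ p, radialRatio p ^ (j + 1) ∂(σ.prod σ) :=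
    integral_congr_ae (Eventually.of_forall fun p => (integral_truncInvPow j p).2.1)
  have hR : ∀ s : ℝ, ∫ p, G p s ∂(σ.prod σ) = ((2 * (j + 1) * s ^ (2 * j + 1) *
      ‖∫ z, truncInvPow (j + 1) s z ∂σ‖ ^ 2 : ℝ) : ℂ) := by
    intro s
    simp only [hG]
    rw [integral_const_mul, integral_prod_mul (truncInvPow (j + 1) s)
      (fun w => (starRingEnd ℂ) (truncInvPow (j + 1) s w)), integral_conj, Complex.mul_conj']
    push_cast
    ring
  rw [hL] at hswap
  simp only [hR] at hswap
  rw [integral_complex_ofReal] at hswap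
  have hre : ∫ p, (radialRatio p ^ (j + 1)).re ∂(σ.prod σ) =
      (∫ p, radialRatio p ^ (j + 1) ∂(σ.prod σ)).re := integral_re hpow
  rw [hre, hswap, Complex.ofReal_re]
  refine setIntegral_nonneg measurableSet_Ioi fun s hs => ?_
  have hs' : 0 < s := hs
  positivity

/-- Expand -log|1 - tρ| = ∑ tⁿ Re(ρⁿ)/n. The factor t < 1 gives a geometric majorant, and every term
has nonnegative integral (the term n = 0 vanishes). -/
theorem integral_log_norm_one_sub_smul_nonpos (σ : Measure ℂ) [IsProbabilityMeasure σ] {t : ℝ}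
    (ht0 : 0 ≤ t) (ht1 : t < 1) :
    ∫ p, Real.log ‖1 - t * radialRatio p‖ ∂(σ.prod σ) ≤ 0 := by
  have hnorm : ∀ p, ‖(t : ℂ) * radialRatio p‖ ≤ t := fun p => by
    rw [norm_mul, Complex.norm_real, Real.norm_of_nonneg ht0]
    exact mul_le_of_le_one_right ht0 (norm_radialRatio_le p)
  have hterm : ∀ (p : ℂ × ℂ) (n : ℕ), (((t : ℂ) * radialRatio p) ^ n / n).re =
      t ^ n / n * (radialRatio p ^ n).re := by
    intro p n
    rw [mul_pow, ← Complex.ofReal_pow, mul_div_right_comm, ← Complex.ofReal_natCast,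
      ← Complex.ofReal_div, Complex.re_ofReal_mul]
  have hsum : ∀ p, HasSum (fun n : ℕ => t ^ n / n * (radialRatio p ^ n).re)
      (-Real.log ‖1 - t * radialRatio p‖) := by
    intro p
    have h1 := Complex.hasSum_re (Complex.hasSum_taylorSeries_neg_log
      ((hnorm p).trans_lt ht1))
    simp only [hterm] at h1
    rwa [Complex.neg_re, Complex.log_re] at h1
  have hbound : ∀ (n : ℕ) (p : ℂ × ℂ), ‖t ^ n / n * (radialRatio p ^ n).re‖ ≤ t ^ n := by
    intro n p
    rw [norm_mul, norm_div, Real.norm_of_nonneg (by positivity : (0 : ℝ) ≤ t ^ n)]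
    have h1 : ‖(radialRatio p ^ n).re‖ ≤ 1 := by
      refine (Complex.abs_re_le_norm _).trans ?_
      rw [norm_pow]
      exact pow_le_one₀ (norm_nonneg _) (norm_radialRatio_le p)
    rcases Nat.eq_zero_or_pos n with rfl | hn
    · simp
    · have hn' : (1 : ℝ) ≤ ‖(n : ℝ)‖ := by
        rw [Real.norm_of_nonneg (by positivity)]; exact_mod_cast hn
      have h2 : t ^ n / ‖(n : ℝ)‖ ≤ t ^ n := div_le_self (by positivity) hn'
      calc _ ≤ t ^ n * 1 := mul_le_mul h2 h1 (norm_nonneg _) (by positivity)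
        _ = t ^ n := mul_one _
  have key := hasSum_integral_of_dominated_convergence (μ := σ.prod σ)
    (F := fun (n : ℕ) p => t ^ n / n * (radialRatio p ^ n).re)
    (f := fun p => -Real.log ‖1 - t * radialRatio p‖) (fun n _ => t ^ n)
    (fun n => ((Complex.measurable_re.comp (measurable_radialRatio.pow_const n)).const_mul
      _).aestronglyMeasurable)
    (fun n => Eventually.of_forall (hbound n))
    (Eventually.of_forall fun _ => summable_geometric_of_lt_one ht0 ht1)
    (integrable_const _) (Eventually.of_forall hsum)
  have hnn : 0 ≤ ∫ p, -Real.log ‖1 - t * radialRatio p‖ ∂(σ.prod σ) := by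
    refine key.nonneg fun n => ?_
    rw [integral_const_mul]
    rcases n with _ | j
    · simp
    · exact mul_nonneg (by positivity) (integral_re_radialRatio_pow_nonneg σ j)
  rw [integral_neg] at hnn
  linarith

/-- Abel limit t → 1. The majorant comes from |1-ρ| ≤ 2|1-tρ| together with |1-tρ| ≤ 2, so only
integrability of the limit itself is needed. -/
theorem integral_log_norm_one_sub_nonpos (σ : Measure ℂ) [IsProbabilityMeasure σ]
    (hint : Integrable (fun p => Real.log ‖1 - radialRatio p‖) (σ.prod σ))
    (hne : ∀ᵐ p ∂(σ.prod σ), radialRatio p ≠ 1) :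
    ∫ p, Real.log ‖1 - radialRatio p‖ ∂(σ.prod σ) ≤ 0 := by
  set t : ℕ → ℝ := fun n => 1 - 1 / ((n : ℝ) + 1) with ht
  have ht1 : ∀ n, t n < 1 := fun n => by
    have : (0 : ℝ) < 1 / ((n : ℝ) + 1) := by positivity
    simp only [ht]; linarith
  have ht0 : ∀ n, 0 ≤ t n := fun n => by
    have : 1 / ((n : ℝ) + 1) ≤ 1 := by
      rw [div_le_one (by positivity)]
      have : (0 : ℝ) ≤ n := by positivity
      linarith
    simp only [ht]; linarith
  have htlim : Tendsto t atTop (𝓝 1) := by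
    simpa only [sub_zero] using
      (tendsto_const_nhds (x := (1 : ℝ))).sub tendsto_one_div_add_atTop_nhds_zero_nat
  have key := tendsto_integral_of_dominated_convergence (μ := σ.prod σ)
    (F := fun n p => Real.log ‖1 - (t n : ℂ) * radialRatio p‖)
    (f := fun p => Real.log ‖1 - radialRatio p‖)
    (fun p => |Real.log ‖1 - radialRatio p‖| + Real.log 2) (fun n => by
      have := measurable_radialRatio
      exact (Measurable.aestronglyMeasurable (by fun_prop)))
    (hint.abs.add (integrable_const _)) (fun n => by
      filter_upwards [hne] with p hp
      have h0 : 0 < ‖1 - radialRatio p‖ := norm_pos_iff.2 (sub_ne_zero.2 hp.symm)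
      have hr := norm_radialRatio_le p
      have hn : ‖(t n : ℂ) * radialRatio p‖ ≤ t n := by
        rw [norm_mul, Complex.norm_real, Real.norm_of_nonneg (ht0 n)]
        exact mul_le_of_le_one_right (ht0 n) hr
      have h1 : 1 - t n ≤ ‖1 - (t n : ℂ) * radialRatio p‖ := by
        have := norm_sub_norm_le (1 : ℂ) ((t n : ℂ) * radialRatio p)
        rw [norm_one] at this
        linarith
      have h2 : ‖1 - (t n : ℂ) * radialRatio p‖ ≤ 2 := by
        have := norm_sub_le (1 : ℂ) ((t n : ℂ) * radialRatio p)
        rw [norm_one] at this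
        linarith [ht1 n]
      -- Write 1-ρ = (1-tρ) - (1-t)ρ and use 1-t ≤ |1-tρ|.
      have h3 : ‖1 - radialRatio p‖ ≤ 2 * ‖1 - (t n : ℂ) * radialRatio p‖ := by
        have e : 1 - radialRatio p = (1 - (t n : ℂ) * radialRatio p) +
            (-((1 - t n : ℝ) : ℂ)) * radialRatio p := by push_cast; ring
        have h4 : ‖(-((1 - t n : ℝ) : ℂ)) * radialRatio p‖ ≤ 1 - t n := by
          rw [norm_mul, norm_neg, Complex.norm_real, Real.norm_of_nonneg (by linarith [ht1 n])]
          exact mul_le_of_le_one_right (by linarith [ht1 n]) hr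
        rw [e]
        refine (norm_add_le _ _).trans ?_
        linarith
      have h5 : 0 < ‖1 - (t n : ℂ) * radialRatio p‖ := by linarith
      rw [Real.norm_eq_abs, abs_le]
      have h6 := Real.log_le_log h0 h3
      rw [Real.log_mul (by norm_num) h5.ne'] at h6
      have h7 := Real.log_le_log h5 h2
      constructor
      · linarith [neg_abs_le (Real.log ‖1 - radialRatio p‖)]
      · linarith [abs_nonneg (Real.log ‖1 - radialRatio p‖)])
    (by
      filter_upwards [hne] with p hp
      have h0 : ‖1 - radialRatio p‖ ≠ 0 := norm_ne_zero_iff.2 (sub_ne_zero.2 hp.symm)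
      have h1 : Tendsto (fun n => ‖1 - (t n : ℂ) * radialRatio p‖) atTop
          (𝓝 ‖1 - ((1 : ℝ) : ℂ) * radialRatio p‖) :=
        (tendsto_const_nhds.sub (((Complex.continuous_ofReal.tendsto 1).comp htlim).mul_const
          _)).norm
      rw [Complex.ofReal_one, one_mul] at h1
      exact (Real.continuousAt_log h0).tendsto.comp h1)
  exact le_of_tendsto key (Eventually.of_forall fun n =>
    integral_log_norm_one_sub_smul_nonpos σ (ht0 n) (ht1 n))

/-! ### Real-valued energies -/

theorem erealIntegral_eq_coe {α : Type*} [MeasurableSpace α] {μ : Measure α} {f : α → EReal}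
    {g : α → ℝ} (hg : Integrable g μ) (hfg : ∀ᵐ x ∂μ, f x = g x) :
    erealIntegral μ f = ((∫ x, g x ∂μ : ℝ) : EReal) := by
  have h1 : ∫⁻ x, (f x).toENNReal ∂μ = ∫⁻ x, ENNReal.ofReal (g x) ∂μ :=
    lintegral_congr_ae (hfg.mono fun x hx => by simp only [hx, EReal.real_coe_toENNReal])
  have h2 : ∫⁻ x, (-f x).toENNReal ∂μ = ∫⁻ x, ENNReal.ofReal (-g x) ∂μ :=
    lintegral_congr_ae (hfg.mono fun x hx => by
      simp only [hx, ← EReal.coe_neg, EReal.real_coe_toENNReal])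
  have hfin1 : ∫⁻ x, ENNReal.ofReal (g x) ∂μ ≠ ⊤ := hg.lintegral_lt_top.ne
  have hfin2 : ∫⁻ x, ENNReal.ofReal (-g x) ∂μ ≠ ⊤ := hg.neg.lintegral_lt_top.ne
  rw [erealIntegral, h1, h2, integral_eq_lintegral_pos_part_sub_lintegral_neg_part hg,
    EReal.coe_sub, EReal.coe_ennreal_toReal hfin1, EReal.coe_ennreal_toReal hfin2]

/-- A lower bound and a finite measure make the negative part finite, so ∞ - ∞ cannot occur and a
finite value means genuine integrability. -/
theorem erealIntegral_of_bddBelow {α : Type*} [MeasurableSpace α] {μ : Measure α}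
    [IsFiniteMeasure μ] {f : α → EReal} (hf : Measurable f) {C : ℝ}
    (hC : ∀ᵐ x ∂μ, ((-C : ℝ) : EReal) ≤ f x) :
    erealIntegral μ f ≠ ⊥ ∧ (erealIntegral μ f ≠ ⊤ →
      (∀ᵐ x ∂μ, f x ≠ ⊤) ∧ Integrable (fun x => (f x).toReal) μ) := by
  have hneg : ∫⁻ x, (-f x).toENNReal ∂μ ≠ ⊤ := by
    have hle : ∫⁻ x, (-f x).toENNReal ∂μ ≤ ∫⁻ _, ENNReal.ofReal C ∂μ := by
      refine lintegral_mono_ae (hC.mono fun x hx => ?_)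
      rw [← EReal.real_coe_toENNReal]
      refine EReal.toENNReal_le_toENNReal ?_
      rw [EReal.neg_le]
      simpa using hx
    refine ne_top_of_le_ne_top ?_ hle
    rw [lintegral_const]
    exact ENNReal.mul_ne_top ENNReal.ofReal_ne_top (measure_ne_top _ _)
  have hnegR : ((∫⁻ x, (-f x).toENNReal ∂μ : ℝ≥0∞) : EReal) =
      ((∫⁻ x, (-f x).toENNReal ∂μ).toReal : EReal) := (EReal.coe_ennreal_toReal hneg).symm
  have hpos : ((∫⁻ x, (f x).toENNReal ∂μ : ℝ≥0∞) : EReal) ≠ ⊥ := EReal.coe_ennreal_ne_bot _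
  refine ⟨?_, fun htop => ?_⟩
  · rw [erealIntegral, hnegR, sub_eq_add_neg, ← EReal.coe_neg, Ne, EReal.add_eq_bot_iff]
    simp [hpos]
  · have hP : ∫⁻ x, (f x).toENNReal ∂μ ≠ ⊤ := by
      intro hP
      apply htop
      rw [erealIntegral, hnegR, hP, EReal.coe_ennreal_top]
      exact EReal.top_sub_coe _
    have hae : ∀ᵐ x ∂μ, f x ≠ ⊤ := (ae_lt_top hf.ereal_toENNReal hP).mono fun x hx h =>
      by simp [h] at hx
    refine ⟨hae, hf.ereal_toReal.aestronglyMeasurable, ?_⟩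
    refine lt_of_le_of_lt (lintegral_mono_ae (g := fun x => (f x).toENNReal + (-f x).toENNReal)
      ?_) ?_
    · filter_upwards [hae, hC] with x hx hx2
      obtain ⟨a, ha⟩ := EReal_eq_coe_of_ne (fun h => by simp [h] at hx2) hx
      rw [ha, EReal.toReal_coe, ← EReal.coe_neg, EReal.real_coe_toENNReal,
        EReal.real_coe_toENNReal, ← ofReal_norm, Real.norm_eq_abs]
      rcases le_total 0 a with h | h
      · rw [abs_of_nonneg h]; exact le_self_add
      · rw [abs_of_nonpos h]; exact le_add_self
    · rw [lintegral_add_left hf.ereal_toENNReal]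
      exact ENNReal.add_lt_top.2 ⟨hP.lt_top, hneg.lt_top⟩

/-- The measure has finite energy, in terms of real-valued integrals. -/
structure FiniteEnergy (Q : ℂ → EReal) (μ : Measure ℂ) : Prop where
  off_diag : ∀ᵐ p ∂(μ.prod μ), p.1 ≠ p.2
  log_int : Integrable (fun p : ℂ × ℂ => Real.log ‖p.1 - p.2‖) (μ.prod μ)
  fin : ∀ᵐ z ∂μ, Q z ≠ ⊤
  int : Integrable (fun z => (Q z).toReal) μ

theorem neg_log_enorm {x : ℂ} (hx : x ≠ 0) :
    -ENNReal.log ‖x‖ₑ = ((-Real.log ‖x‖ : ℝ) : EReal) := by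
  rw [← ofReal_norm, ENNReal.log_ofReal_of_pos (norm_pos_iff.2 hx), EReal.coe_neg]

theorem FiniteEnergy.energy_eq {Q : ℂ → EReal} (hQ : IsPotential Q) {μ : Measure ℂ}
    (h : FiniteEnergy Q μ) : energy Q μ =
      ((-∫ p, Real.log ‖p.1 - p.2‖ ∂(μ.prod μ) + ∫ z, (Q z).toReal ∂μ : ℝ) : EReal) := by
  rw [energy, erealIntegral_eq_coe h.log_int.neg (h.off_diag.mono fun p hp =>
    neg_log_enorm (sub_ne_zero.2 hp)), erealIntegral_eq_coe h.int (h.fin.mono fun z hz =>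
    (EReal.coe_toReal hz (hQ.ne_bot z)).symm), ← EReal.coe_add]
  congr 2
  exact integral_neg _

theorem IsPotential.bddBelow {Q : ℂ → EReal} (hQ : IsPotential Q) :
    ∃ C : ℝ, ∀ z, ((-C : ℝ) : EReal) ≤ Q z := by
  obtain ⟨θ, hθ, C, hC⟩ := hQ.growth
  refine ⟨C, fun z => le_trans ?_ (hC z)⟩
  rw [EReal.coe_le_coe_iff]
  have : 0 ≤ Real.log (max ‖z‖ 1) := Real.log_nonneg (le_max_right _ _)
  have : 0 ≤ 2 * θ * Real.log (max ‖z‖ 1) := by positivity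
  linarith

theorem IsCompactProbability.exists_bound {μ : Measure ℂ} (h : IsCompactProbability μ) :
    ∃ R : ℝ, 1 ≤ R ∧ ∀ᵐ z ∂μ, ‖z‖ ≤ R := by
  obtain ⟨-, K, hK, hμ⟩ := h
  obtain ⟨R, hR⟩ := hK.isBounded.exists_norm_le
  refine ⟨max R 1, le_max_right _ _, ?_⟩
  have : ∀ᵐ z ∂μ, z ∈ K := hμ
  exact this.mono fun z hz => (hR z hz).trans (le_max_left _ _)

theorem ae_prod_of_ae {μ ν : Measure ℂ} [SFinite μ] [SFinite ν] {P R : ℂ → Prop}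
    (hP : ∀ᵐ z ∂μ, P z) (hR : ∀ᵐ z ∂ν, R z) : ∀ᵐ p ∂(μ.prod ν), P p.1 ∧ R p.2 :=
  (Measure.quasiMeasurePreserving_fst.ae hP).and (Measure.quasiMeasurePreserving_snd.ae hR)

/-- On a compact support of radius R the kernel is at least -log(2R), so neither summand of the
energy is ⊥ and a finite sum forces both to be finite. -/
theorem finiteEnergy_of_ne_top {Q : ℂ → EReal} (hQ : IsPotential Q) {μ : Measure ℂ}
    (hμ : IsCompactProbability μ) (hne : energy Q μ ≠ ⊤) : FiniteEnergy Q μ := by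
  have := hμ.1
  obtain ⟨R, hR1, hR⟩ := hμ.exists_bound
  obtain ⟨C, hC⟩ := hQ.bddBelow
  obtain ⟨hb2, ht2⟩ := erealIntegral_of_bddBelow (μ := μ) hQ.lsc.measurable
    (Eventually.of_forall hC)
  have hmeas : Measurable fun p : ℂ × ℂ => -ENNReal.log ‖p.1 - p.2‖ₑ := by fun_prop
  obtain ⟨hb1, ht1⟩ := erealIntegral_of_bddBelow (μ := μ.prod μ) hmeas (C := Real.log (2 * R))
    ((ae_prod_of_ae hR hR).mono fun p hp => by
      rw [EReal.coe_neg, EReal.neg_le_neg_iff,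
        ← ENNReal.log_ofReal_of_pos (by positivity : (0 : ℝ) < 2 * R), ENNReal.log_le_log_iff,
        ← ofReal_norm]
      refine ENNReal.ofReal_le_ofReal ((norm_sub_le _ _).trans ?_)
      linarith [hp.1, hp.2])
  have h1 : erealIntegral (μ.prod μ) (fun p : ℂ × ℂ => -ENNReal.log ‖p.1 - p.2‖ₑ) ≠ ⊤ := by
    intro h
    apply hne
    rw [energy, h, EReal.top_add_of_ne_bot hb2]
  have h2 : erealIntegral μ Q ≠ ⊤ := by
    intro h
    apply hne
    rw [energy, h, EReal.add_top_of_ne_bot hb1]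
  obtain ⟨hd, hi⟩ := ht1 h1
  have hd' : ∀ᵐ p ∂(μ.prod μ), p.1 ≠ p.2 := hd.mono fun p hp h => by simp [h] at hp
  refine ⟨hd', ?_, (ht2 h2).1, (ht2 h2).2⟩
  refine hi.neg.congr (hd'.mono fun p hp => ?_)
  simp only [Pi.neg_apply, neg_log_enorm (sub_ne_zero.2 hp), EReal.toReal_coe, neg_neg]

/-! ### Uniform laws on circles -/

/-- The uniform probability measure on the circle `|z| = r`. -/
noncomputable def circleLaw (r : ℝ) : Measure ℂ :=
  ENNReal.ofReal (2 * Real.pi)⁻¹ •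
    (volume.restrict (Set.Ioc 0 (2 * Real.pi))).map (circleMap 0 r)

theorem measurable_circleMap (r : ℝ) : Measurable (circleMap 0 r) :=
  (continuous_circleMap 0 r).measurable

instance (r : ℝ) : IsProbabilityMeasure (circleLaw r) := by
  constructor
  rw [circleLaw, Measure.smul_apply, Measure.map_apply (measurable_circleMap r) .univ,
    Set.preimage_univ, Measure.restrict_apply_univ, Real.volume_Ioc, smul_eq_mul,
    ← ENNReal.ofReal_mul (by positivity), sub_zero, inv_mul_cancel₀ Real.two_pi_pos.ne',
    ENNReal.ofReal_one]

theorem circleLaw_ae {r : ℝ} {P : ℂ → Prop} (hP : ∀ᵐ θ : ℝ, P (circleMap 0 r θ))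
    (hm : MeasurableSet {z | P z}) : ∀ᵐ z ∂(circleLaw r), P z := by
  rw [circleLaw]
  refine Measure.ae_smul_measure ?_ _
  exact (ae_map_iff (measurable_circleMap r).aemeasurable hm).2 (ae_restrict_of_ae hP)

theorem circleLaw_ae_norm {r : ℝ} (hr : 0 ≤ r) : ∀ᵐ z ∂(circleLaw r), ‖z‖ = r :=
  circleLaw_ae (Eventually.of_forall fun θ => by simp [abs_of_nonneg hr])
    (measurableSet_eq_fun measurable_norm measurable_const)

theorem circleLaw_ae_ne {r : ℝ} (hr : r ≠ 0) (w : ℂ) : ∀ᵐ z ∂(circleLaw r), z ≠ w :=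
  circleLaw_ae (((Set.countable_singleton w).preimage_circleMap 0 hr).ae_notMem _)
    (measurableSet_singleton w).compl

theorem integral_circleLaw {r : ℝ} {f : ℂ → ℝ} (hf : Measurable f) :
    ∫ z, f z ∂(circleLaw r) = Real.circleAverage f 0 r := by
  rw [circleLaw, integral_smul_measure, integral_map (measurable_circleMap r).aemeasurable
    hf.aestronglyMeasurable, Real.circleAverage_def,
    intervalIntegral.integral_of_le Real.two_pi_pos.le, ENNReal.toReal_ofReal (by positivity)]

theorem integrable_circleLaw {r : ℝ} {f : ℂ → ℝ} (hf : Measurable f)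
    (hi : CircleIntegrable f 0 r) : Integrable f (circleLaw r) := by
  rw [circleLaw]
  refine Integrable.smul_measure ?_ ENNReal.ofReal_ne_top
  rw [integrable_map_measure hf.aestronglyMeasurable (measurable_circleMap r).aemeasurable]
  exact (intervalIntegrable_iff_integrableOn_Ioc_of_le Real.two_pi_pos.le).1 hi

theorem isCompactProbability_circleLaw {r : ℝ} (hr : 0 ≤ r) :
    IsCompactProbability (circleLaw r) := by
  refine ⟨inferInstance, Metric.sphere 0 r, isCompact_sphere 0 r, ?_⟩
  have h := circleLaw_ae_norm hr
  have h' : ∀ᵐ z ∂(circleLaw r), z ∈ Metric.sphere (0 : ℂ) r := h.mono fun z hz => by simpa using hz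
  exact h'

theorem abs_log_le {x : ℝ} (hx : 0 ≤ x) : |Real.log x| ≤ 2 * x - Real.log x := by
  rcases hx.eq_or_lt with rfl | hx
  · simp
  · have := Real.log_le_sub_one_of_pos hx
    rcases le_total 0 (Real.log x) with h | h
    · rw [abs_of_nonneg h]; linarith
    · rw [abs_of_nonpos h]; linarith

theorem measurable_log_norm_sub : Measurable fun p : ℂ × ℂ => Real.log ‖p.1 - p.2‖ := by fun_prop

/-- The circle average of log|z-w| is log max(r, |w|) ≥ log r. As |log x| ≤ 2x - log x, this bounds
the inner integrals of the absolute value uniformly in w. -/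
theorem integrable_log_circleLaw_prod {σ : Measure ℂ} (hσ : IsCompactProbability σ) {r : ℝ}
    (hr : 0 < r) :
    Integrable (fun p : ℂ × ℂ => Real.log ‖p.1 - p.2‖) ((circleLaw r).prod σ) := by
  have := hσ.1
  obtain ⟨R, hR1, hR⟩ := hσ.exists_bound
  refine (integrable_prod_iff' measurable_log_norm_sub.aestronglyMeasurable).2
    ⟨Eventually.of_forall fun w => integrable_circleLaw (by fun_prop)
      (circleIntegrable_log_norm_sub w 0 r), ?_⟩
  have hmeas : AEStronglyMeasurable
      (fun w => ∫ z, ‖Real.log ‖z - w‖‖ ∂(circleLaw r)) σ :=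
    (measurable_log_norm_sub.norm.aestronglyMeasurable
      (μ := (circleLaw r).prod σ)).prod_swap.integral_prod_right'
  refine Integrable.of_bound hmeas (2 * (r + R) - Real.log r) (hR.mono fun w hw => ?_)
  rw [Real.norm_of_nonneg (integral_nonneg fun _ => norm_nonneg _)]
  have hi := integrable_circleLaw (r := r) (f := fun z => Real.log ‖z - w‖) (by fun_prop)
    (circleIntegrable_log_norm_sub w 0 r)
  have hle : ∫ z, ‖Real.log ‖z - w‖‖ ∂(circleLaw r) ≤
      ∫ z, (2 * (r + R) - Real.log ‖z - w‖) ∂(circleLaw r) := by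
    refine integral_mono_ae hi.norm ((integrable_const _).sub hi) ?_
    filter_upwards [circleLaw_ae_norm hr.le] with z hz
    have h1 := abs_log_le (norm_nonneg (z - w))
    have h2 := norm_sub_le z w
    rw [hz] at h2
    simp only [Real.norm_eq_abs]
    linarith
  refine hle.trans ?_
  rw [integral_sub (integrable_const _) hi,
    integral_circleLaw (f := fun z => Real.log ‖z - w‖) (by fun_prop),
    circleAverage_log_norm_sub_eq_log_max w hr]
  have hlog : Real.log r ≤ Real.log (max r ‖(0 : ℂ) - w‖) := Real.log_le_log hr (le_max_left _ _)
  simp only [integral_const, probReal_univ, smul_eq_mul, one_mul]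
  linarith

theorem integral_log_circleLaw_prod {σ : Measure ℂ} (hσ : IsCompactProbability σ) {r : ℝ}
    (hr : 0 < r) :
    ∫ p, Real.log ‖p.1 - p.2‖ ∂((circleLaw r).prod σ) = ∫ w, Real.log (max r ‖w‖) ∂σ := by
  have := hσ.1
  rw [integral_prod_symm _ (integrable_log_circleLaw_prod hσ hr)]
  refine integral_congr_ae (Eventually.of_forall fun w => ?_)
  simp only
  rw [integral_circleLaw (by fun_prop), circleAverage_log_norm_sub_eq_log_max w hr, zero_sub,
    norm_neg]

theorem circleLaw_prod_off_diag {σ : Measure ℂ} [IsProbabilityMeasure σ] {r : ℝ} (hr : 0 < r) :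
    ∀ᵐ p ∂((circleLaw r).prod σ), p.1 ≠ p.2 := by
  have hm : MeasurableSet {p : ℂ × ℂ | p.1 ≠ p.2} :=
    (measurableSet_eq_fun measurable_fst measurable_snd).compl
  rw [← Measure.prod_swap]
  refine (ae_map_iff measurable_swap.aemeasurable hm).2 ?_
  exact (Measure.ae_prod_iff_ae_ae (measurable_swap hm)).2
    (Eventually.of_forall fun w => circleLaw_ae_ne hr.ne' w)

theorem finiteEnergy_circleLaw {Q : ℂ → EReal} (hQ : IsPotential Q) {r : ℝ} (hr : 0 < r)
    (hfin : Q r ≠ ⊤) : FiniteEnergy Q (circleLaw r) := by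
  have hae : ∀ᵐ z ∂(circleLaw r), Q z = Q r :=
    (circleLaw_ae_norm hr.le).mono fun z hz => by rw [hQ.eq_norm z, hz]
  exact ⟨circleLaw_prod_off_diag hr,
    integrable_log_circleLaw_prod (isCompactProbability_circleLaw hr.le) hr,
    hae.mono fun z hz => hz ▸ hfin,
    (integrable_const (Q r).toReal).congr (hae.mono fun z hz => by simp only [hz])⟩

/-! ### The equilibrium measure -/

theorem mix_prod {σ ν : Measure ℂ} [IsProbabilityMeasure σ] [IsProbabilityMeasure ν] (a b : ℝ≥0∞)
    [SFinite (a • σ)] [SFinite (b • ν)] :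
    (a • σ + b • ν).prod (a • σ + b • ν) =
      (a * a) • σ.prod σ + (a * b) • σ.prod ν + ((b * a) • ν.prod σ + (b * b) • ν.prod ν) := by
  rw [Measure.add_prod, Measure.prod_add, Measure.prod_add]
  simp only [Measure.prod_smul_left, Measure.prod_smul_right, smul_smul, mul_comm b a]

/-- The first variation of the energy of an equilibrium measure in the direction of the uniform
law on a circle. -/
theorem IsEquilibriumMeasure.first_variation {Q : ℂ → EReal} (hQ : IsPotential Q) {σ : Measure ℂ}
    (hσ : IsEquilibriumMeasure Q σ) (hfe : FiniteEnergy Q σ) {r : ℝ} (hr : 0 < r)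
    (hfin : Q r ≠ ⊤) :
    2 * ∫ w, Real.log (max r ‖w‖) ∂σ + (-2 * ∫ p, Real.log ‖p.1 - p.2‖ ∂(σ.prod σ) +
      ∫ z, (Q z).toReal ∂σ) ≤ (Q r).toReal := by
  obtain ⟨hσc, hmin⟩ := hσ
  have := hσc.1
  set ν := circleLaw r with hν
  have hνe : FiniteEnergy Q ν := finiteEnergy_circleLaw hQ hr hfin
  have hνc : IsCompactProbability ν := isCompactProbability_circleLaw hr.le
  set D := ∫ p, Real.log ‖p.1 - p.2‖ ∂(σ.prod σ) with hD
  set E := ∫ z, (Q z).toReal ∂σ with hE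
  set X := ∫ w, Real.log (max r ‖w‖) ∂σ with hX
  set Y := ∫ p, Real.log ‖p.1 - p.2‖ ∂(ν.prod ν) with hY
  have hνσ : Integrable (fun p : ℂ × ℂ => Real.log ‖p.1 - p.2‖) (ν.prod σ) :=
    integrable_log_circleLaw_prod hσc hr
  have hνσd : ∀ᵐ p ∂(ν.prod σ), p.1 ≠ p.2 := circleLaw_prod_off_diag hr
  have hsym : (fun p : ℂ × ℂ => Real.log ‖p.1 - p.2‖) ∘ Prod.swap =
      fun p : ℂ × ℂ => Real.log ‖p.1 - p.2‖ := by
    ext p; simp [norm_sub_rev]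
  have hσν : Integrable (fun p : ℂ × ℂ => Real.log ‖p.1 - p.2‖) (σ.prod ν) := by
    rw [← hsym]; exact hνσ.swap
  have hσνd : ∀ᵐ p ∂(σ.prod ν), p.1 ≠ p.2 := by
    have hm : MeasurableSet {p : ℂ × ℂ | p.1 ≠ p.2} :=
      (measurableSet_eq_fun measurable_fst measurable_snd).compl
    rw [← Measure.prod_swap]
    refine (ae_map_iff measurable_swap.aemeasurable hm).2 (hνσd.mono fun p hp => ?_)
    exact fun h => hp h.symm
  have hXνσ : ∫ p, Real.log ‖p.1 - p.2‖ ∂(ν.prod σ) = X := integral_log_circleLaw_prod hσc hr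
  have hXσν : ∫ p, Real.log ‖p.1 - p.2‖ ∂(σ.prod ν) = X := by
    rw [← hXνσ, ← integral_prod_swap]
    refine integral_congr_ae (Eventually.of_forall fun p => ?_)
    simp [norm_sub_rev]
  have hQν : ∫ z, (Q z).toReal ∂ν = (Q r).toReal := by
    have hae : ∀ᵐ z ∂ν, (Q z).toReal = (Q r).toReal :=
      (circleLaw_ae_norm hr.le).mono fun z hz => by rw [hQ.eq_norm z, hz]
    rw [integral_congr_ae hae]
    simp
  -- The energy of (1-e)σ + eν is a quadratic polynomial in e. Minimality at e = 0, after division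
  -- by e > 0, gives this inequality; then e tends to 0.
  have key : ∀ e ∈ Set.Ioo (0 : ℝ) 1,
      0 ≤ 2 * D - E - 2 * X + (Q r).toReal + e * (-D + 2 * X - Y) := by
    intro e he
    obtain ⟨he0, he1⟩ := he
    set a := ENNReal.ofReal (1 - e) with ha
    set b := ENNReal.ofReal e with hb
    have hat : a ≠ ⊤ := ENNReal.ofReal_ne_top
    have hbt : b ≠ ⊤ := ENNReal.ofReal_ne_top
    have har : a.toReal = 1 - e := ENNReal.toReal_ofReal (by linarith)
    have hbr : b.toReal = e := ENNReal.toReal_ofReal he0.le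
    have hab : a + b = 1 := by
      rw [ha, hb, ← ENNReal.ofReal_add (by linarith) he0.le]; simp
    have : IsFiniteMeasure (a • σ) := Measure.smul_finite σ hat
    have : IsFiniteMeasure (b • ν) := Measure.smul_finite ν hbt
    set μ := a • σ + b • ν with hμ
    have hμc : IsCompactProbability μ := by
      refine ⟨⟨by simp [hμ, hab]⟩, ?_⟩
      obtain ⟨K₁, hK₁, h1⟩ := hσc.2
      obtain ⟨K₂, hK₂, h2⟩ := hνc.2
      refine ⟨K₁ ∪ K₂, hK₁.union hK₂, ?_⟩
      rw [hμ, Measure.add_apply, Measure.smul_apply, Measure.smul_apply,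
        measure_mono_null (Set.compl_subset_compl.2 Set.subset_union_left) h1,
        measure_mono_null (Set.compl_subset_compl.2 Set.subset_union_right) h2]
      simp
    have hprod : μ.prod μ = _ := mix_prod a b
    have hi1 := hfe.log_int.smul_measure (ENNReal.mul_ne_top hat hat)
    have hi2 := hσν.smul_measure (ENNReal.mul_ne_top hat hbt)
    have hi3 := hνσ.smul_measure (ENNReal.mul_ne_top hbt hat)
    have hi4 := hνe.log_int.smul_measure (ENNReal.mul_ne_top hbt hbt)
    have hj1 := hfe.int.smul_measure hat
    have hj2 := hνe.int.smul_measure hbt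
    have hμe : FiniteEnergy Q μ := by
      refine ⟨?_, ?_, ?_, hj1.add_measure hj2⟩
      · rw [hprod, ae_add_measure_iff, ae_add_measure_iff, ae_add_measure_iff]
        exact ⟨⟨Measure.ae_smul_measure hfe.off_diag _, Measure.ae_smul_measure hσνd _⟩,
          Measure.ae_smul_measure hνσd _, Measure.ae_smul_measure hνe.off_diag _⟩
      · rw [hprod]
        exact (hi1.add_measure hi2).add_measure (hi3.add_measure hi4)
      · rw [hμ, ae_add_measure_iff]
        exact ⟨Measure.ae_smul_measure hfe.fin _, Measure.ae_smul_measure hνe.fin _⟩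
    have hle := hmin μ hμc
    rw [hfe.energy_eq hQ, hμe.energy_eq hQ, EReal.coe_le_coe_iff, hprod,
      integral_add_measure (hi1.add_measure hi2) (hi3.add_measure hi4),
      integral_add_measure hi1 hi2, integral_add_measure hi3 hi4, hμ,
      integral_add_measure hj1 hj2] at hle
    simp only [integral_smul_measure, ENNReal.toReal_mul, har, hbr, smul_eq_mul, hQν, hXνσ,
      hXσν] at hle
    rw [← hD, ← hE, ← hY] at hle
    have h3 : 0 ≤ e * (2 * D - E - 2 * X + (Q r).toReal + e * (-D + 2 * X - Y)) := by
      nlinarith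
    exact (mul_nonneg_iff_of_pos_left he0).1 h3
  have hlim : Tendsto (fun e : ℝ => 2 * D - E - 2 * X + (Q r).toReal + e * (-D + 2 * X - Y))
      (𝓝[>] 0) (𝓝 (2 * D - E - 2 * X + (Q r).toReal + 0 * (-D + 2 * X - Y))) :=
    (Continuous.tendsto (by fun_prop) 0).mono_left nhdsWithin_le_nhds
  have h0 := ge_of_tendsto hlim (by
    filter_upwards [Ioo_mem_nhdsGT (zero_lt_one (α := ℝ))] with e he
    exact key e he)
  linarith

/-- The radial average of `2 ∫ log |z - w| dσ(w)` plus the Robin constant. -/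
noncomputable def radialPotential (Q : ℂ → EReal) (σ : Measure ℂ) (r : ℝ) : ℝ :=
  2 * ∫ w, Real.log (max r ‖w‖) ∂σ + (-2 * ∫ p, Real.log ‖p.1 - p.2‖ ∂(σ.prod σ) +
      ∫ z, (Q z).toReal ∂σ)

theorem measure_singleton_eq_zero_of_off_diag {σ : Measure ℂ} [IsProbabilityMeasure σ]
    (h : ∀ᵐ p ∂(σ.prod σ), p.1 ≠ p.2) (z : ℂ) : ∀ᵐ w ∂σ, w ≠ z := by
  have h1 : (σ.prod σ) ({z} ×ˢ {z}) = 0 := by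
    refine measure_mono_null ?_ (ae_iff.1 h)
    rintro ⟨x, y⟩ ⟨hx, hy⟩
    simp only [Set.mem_singleton_iff] at hx hy
    simp [hx, hy]
  rw [Measure.prod_prod, mul_self_eq_zero] at h1
  rw [ae_iff]
  simpa using h1

/-- The first variation gives U ≤ Q almost everywhere for the radial potential U. Conversely ∫ U dσ
≥ ∫ Q dσ, because ∬ log|z-w| ≤ ∬ log max(|z|, |w|). Hence Q - U is nonnegative with nonpositive
integral and vanishes almost everywhere. -/
theorem IsEquilibriumMeasure.radialPotential_eq {Q : ℂ → EReal} (hQ : IsPotential Q)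
    {σ : Measure ℂ} (hσ : IsEquilibriumMeasure Q σ) (hfe : FiniteEnergy Q σ) :
    ∀ᵐ z ∂σ, 0 < ‖z‖ ∧ Q z ≠ ⊤ ∧ (Q z).toReal = radialPotential Q σ ‖z‖ := by
  have hσc := hσ.1
  have := hσc.1
  obtain ⟨R, hR1, hR⟩ := hσc.exists_bound
  have h0 : ∀ᵐ z ∂σ, z ≠ 0 := measure_singleton_eq_zero_of_off_diag hfe.off_diag 0
  have hpair : ∀ᵐ p ∂(σ.prod σ), (p.1 ≠ 0 ∧ p.2 ≠ 0) ∧ (‖p.1‖ ≤ R ∧ ‖p.2‖ ≤ R) ∧ p.1 ≠ p.2 :=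
    (ae_prod_of_ae h0 h0).and ((ae_prod_of_ae hR hR).and hfe.off_diag)
  set M : ℂ × ℂ → ℝ := fun p => Real.log (max ‖p.1‖ ‖p.2‖) with hM
  have hMint : Integrable M (σ.prod σ) := by
    refine Integrable.mono' (hfe.log_int.abs.add (integrable_const (Real.log R + Real.log 2)))
      (Measurable.aestronglyMeasurable (by fun_prop)) ?_
    filter_upwards [hpair] with p hp
    obtain ⟨⟨h1, h2⟩, ⟨h3, h4⟩, h5⟩ := hp
    have hmax : 0 < max ‖p.1‖ ‖p.2‖ := lt_max_of_lt_left (norm_pos_iff.2 h1)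
    have h6 : Real.log (max ‖p.1‖ ‖p.2‖) ≤ Real.log R := Real.log_le_log hmax (max_le h3 h4)
    have h7 : Real.log ‖p.1 - p.2‖ ≤ Real.log 2 + Real.log (max ‖p.1‖ ‖p.2‖) := by
      rw [← Real.log_mul (by norm_num) hmax.ne']
      refine Real.log_le_log (norm_pos_iff.2 (sub_ne_zero.2 h5)) ((norm_sub_le _ _).trans ?_)
      linarith [le_max_left ‖p.1‖ ‖p.2‖, le_max_right ‖p.1‖ ‖p.2‖]
    have h8 : 0 ≤ Real.log R := Real.log_nonneg hR1
    have h9 : 0 ≤ Real.log 2 := Real.log_nonneg (by norm_num)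
    have h10 := neg_abs_le (Real.log ‖p.1 - p.2‖)
    have h11 := abs_nonneg (Real.log ‖p.1 - p.2‖)
    simp only [hM, Pi.add_apply, Real.norm_eq_abs, abs_le]
    constructor <;> linarith
  have hratio : (fun p => Real.log ‖1 - radialRatio p‖) =ᵐ[σ.prod σ]
      fun p => Real.log ‖p.1 - p.2‖ - M p := by
    filter_upwards [hpair] with p hp
    obtain ⟨⟨h1, h2⟩, -, h5⟩ := hp
    have hmax : 0 < max ‖p.1‖ ‖p.2‖ := lt_max_of_lt_left (norm_pos_iff.2 h1)
    have := norm_one_sub_radialRatio h1 h2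
    rw [show (p.1, p.2) = p from rfl] at this
    rw [this, Real.log_div (norm_ne_zero_iff.2 (sub_ne_zero.2 h5)) hmax.ne']
  have hne : ∀ᵐ p ∂(σ.prod σ), radialRatio p ≠ 1 := by
    filter_upwards [hpair] with p hp h
    obtain ⟨⟨h1, h2⟩, -, h5⟩ := hp
    have hmax : 0 < max ‖p.1‖ ‖p.2‖ := lt_max_of_lt_left (norm_pos_iff.2 h1)
    have := norm_one_sub_radialRatio h1 h2
    rw [show (p.1, p.2) = p from rfl, h, sub_self, norm_zero, eq_comm, div_eq_zero_iff] at this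
    rcases this with h6 | h6
    · exact h5 (sub_eq_zero.1 (norm_eq_zero.1 h6))
    · exact hmax.ne' h6
  have hdiff := hfe.log_int.sub hMint
  -- Positivity of the angular part: the energy integral of log|z-w| is at most that of log max(|z|,
  -- |w|). This replaces radial symmetry of σ.
  have hpd := integral_log_norm_one_sub_nonpos σ (hdiff.congr hratio.symm) hne
  rw [integral_congr_ae hratio, integral_sub hfe.log_int hMint] at hpd
  set D := ∫ p, Real.log ‖p.1 - p.2‖ ∂(σ.prod σ) with hD
  set E := ∫ z, (Q z).toReal ∂σ with hE
  have hinner : Integrable (fun z => ∫ w, Real.log (max ‖z‖ ‖w‖) ∂σ) σ := hMint.integral_prod_left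
  have hMeq : ∫ p, M p ∂(σ.prod σ) = ∫ z, ∫ w, Real.log (max ‖z‖ ‖w‖) ∂σ ∂σ :=
    integral_prod _ hMint
  have hHint : Integrable (fun z => radialPotential Q σ ‖z‖) σ :=
    (hinner.const_mul 2).add (integrable_const _)
  have hle : ∀ᵐ z ∂σ, radialPotential Q σ ‖z‖ ≤ (Q z).toReal := by
    filter_upwards [h0, hfe.fin] with z hz hfin
    rw [hQ.eq_norm z] at hfin ⊢
    exact hσ.first_variation hQ hfe (norm_pos_iff.2 hz) hfin
  have hint : ∫ z, radialPotential Q σ ‖z‖ ∂σ =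
      2 * (∫ p, M p ∂(σ.prod σ)) + (-2 * D + E) := by
    simp only [radialPotential]
    rw [integral_add (hinner.const_mul 2) (integrable_const _), integral_const_mul, hMeq]
    simp [hD, hE]
  have hnn : 0 ≤ᵐ[σ] fun z => (Q z).toReal - radialPotential Q σ ‖z‖ :=
    hle.mono fun z hz => sub_nonneg.2 hz
  have hz0 : ∫ z, ((Q z).toReal - radialPotential Q σ ‖z‖) ∂σ = 0 := by
    refine le_antisymm ?_ (integral_nonneg_of_ae hnn)
    rw [integral_sub hfe.int hHint, hint]
    linarith
  have hae := (integral_eq_zero_iff_of_nonneg_ae hnn (hfe.int.sub hHint)).1 hz0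
  filter_upwards [h0, hfe.fin, hae] with z hz1 hz2 hz3
  exact ⟨norm_pos_iff.2 hz1, hz2, sub_eq_zero.1 hz3⟩

/-- The set is covered by an increasing sequence of half-lines whose endpoints belong to it, so each
has mass at most `c`. No continuity of the distribution function is needed. -/
theorem measure_setOf_Iic_le (ν : Measure ℝ) (c : ℝ≥0∞) : ν {r | ν (Set.Iic r) ≤ c} ≤ c := by
  set S : Set ℝ := {r | ν (Set.Iic r) ≤ c} with hS
  rcases S.eq_empty_or_nonempty with h | hne
  · simp [h]
  obtain ⟨u, hu, hmono, hcov⟩ : ∃ u : ℕ → ℝ, (∀ n, u n ∈ S) ∧ Monotone u ∧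
      S ⊆ ⋃ n, Set.Iic (u n) := by
    by_cases hb : BddAbove S
    · by_cases hmem : sSup S ∈ S
      · exact ⟨fun _ => sSup S, fun _ => hmem, monotone_const, fun x hx =>
          Set.mem_iUnion.2 ⟨0, le_csSup hb hx⟩⟩
      · obtain ⟨u, hu1, hu2, hu3⟩ := (isLUB_csSup hne hb).exists_seq_monotone_tendsto hne
        refine ⟨u, hu3.2, hu1, fun x hx => ?_⟩
        have hlt : x < sSup S := lt_of_le_of_ne (le_csSup hb hx) fun h => hmem (h ▸ hx)
        obtain ⟨n, hn⟩ := (hu3.1.eventually (lt_mem_nhds hlt)).exists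
        exact Set.mem_iUnion.2 ⟨n, hn.le⟩
    · refine ⟨fun n => n, fun n => ?_, Nat.mono_cast, fun x _ => ?_⟩
      · obtain ⟨y, hy, hny⟩ := not_bddAbove_iff.1 hb n
        exact (measure_mono (Set.Iic_subset_Iic.2 hny.le)).trans hy
      · obtain ⟨n, hn⟩ := exists_nat_ge x
        exact Set.mem_iUnion.2 ⟨n, hn⟩
  refine (measure_mono hcov).trans ?_
  have hm : Monotone fun n => Set.Iic (u n) := fun i j hij => Set.Iic_subset_Iic.2 (hmono hij)
  rw [hm.measure_iUnion]
  exact iSup_le fun n => hu n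

theorem measure_setOf_Ici_le (ν : Measure ℝ) (c : ℝ≥0∞) : ν {r | ν (Set.Ici r) ≤ c} ≤ c := by
  have h := measure_setOf_Iic_le (ν.map fun x => -x) c
  have hm : Measurable fun x : ℝ => -x := measurable_neg
  have h1 : ∀ r : ℝ, (ν.map fun x => -x) (Set.Iic r) = ν (Set.Ici (-r)) := by
    intro r
    rw [Measure.map_apply hm measurableSet_Iic]
    congr 1
    ext x
    simp
  simp only [h1] at h
  refine le_trans ?_ h
  refine le_trans (le_of_eq ?_) (Measure.le_map_apply hm.aemeasurable _)
  congr 1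
  ext x
  simp

theorem integrable_log_max {σ : Measure ℂ} (hσ : IsCompactProbability σ) {r : ℝ} (hr : 0 < r) :
    Integrable (fun w : ℂ => Real.log (max r ‖w‖)) σ := by
  have := hσ.1
  obtain ⟨R, -, hR⟩ := hσ.exists_bound
  refine Integrable.of_bound (Measurable.aestronglyMeasurable (by fun_prop))
    (|Real.log r| + |Real.log (max r R)|) (hR.mono fun w hw => ?_)
  have h1 : Real.log r ≤ Real.log (max r ‖w‖) := Real.log_le_log hr (le_max_left _ _)
  have h2 : Real.log (max r ‖w‖) ≤ Real.log (max r R) :=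
    Real.log_le_log (lt_max_of_lt_left hr) (max_le_max_left _ hw)
  rw [Real.norm_eq_abs, abs_le]
  constructor
  · linarith [neg_abs_le (Real.log r), abs_nonneg (Real.log (max r R))]
  · linarith [le_abs_self (Real.log (max r R)), abs_nonneg (Real.log r)]

/-- Supporting lines of the radial potential. -/
theorem radialPotential_add_le {Q : ℂ → EReal} {σ : Measure ℂ} (hσ : IsCompactProbability σ)
    {r x : ℝ} (hr : 0 < r) (hx : 0 < x) {A : Set ℂ} (hA : MeasurableSet A)
    (h1 : ∀ w ∈ A, ‖w‖ ≤ r) (h2 : ∀ w ∉ A, r ≤ ‖w‖) :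
    radialPotential Q σ r + 2 * σ.real A * (Real.log x - Real.log r) ≤ radialPotential Q σ x := by
  have := hσ.1
  have hir := integrable_log_max hσ hr
  have hix := integrable_log_max hσ hx
  have hiA : Integrable (A.indicator fun _ : ℂ => Real.log x - Real.log r) σ :=
    (integrable_const _).indicator hA
  have hle : ∫ w, A.indicator (fun _ : ℂ => Real.log x - Real.log r) w ∂σ ≤
      ∫ w, (Real.log (max x ‖w‖) - Real.log (max r ‖w‖)) ∂σ := by
    refine integral_mono hiA (hix.sub hir) fun w => ?_
    by_cases hw : w ∈ A
    · simp only [Set.indicator_of_mem hw, max_eq_left (h1 w hw)]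
      exact sub_le_sub_right (Real.log_le_log hx (le_max_left _ _)) _
    · simp only [Set.indicator_of_notMem hw, max_eq_right (h2 w hw)]
      exact sub_nonneg.2 (Real.log_le_log (hr.trans_le (h2 w hw)) (le_max_right _ _))
  rw [integral_sub hix hir, integral_indicator hA, setIntegral_const, smul_eq_mul] at hle
  simp only [radialPotential]
  linarith

theorem IsEquilibriumMeasure.finiteEnergy {Q : ℂ → EReal} (hQ : IsPotential Q) {σ : Measure ℂ}
    (hσ : IsEquilibriumMeasure Q σ) {r : ℝ} (hr : 0 < r) (hfin : Q r ≠ ⊤) :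
    FiniteEnergy Q σ := by
  refine finiteEnergy_of_ne_top hQ hσ.1 (ne_top_of_le_ne_top ?_
    (hσ.2 _ (isCompactProbability_circleLaw hr.le)))
  rw [(finiteEnergy_circleLaw hQ hr hfin).energy_eq hQ]
  exact EReal.coe_ne_top _

/-- At a point of the support of the equilibrium measure, the mass of the disk is half of the
logarithmic slope of the potential. -/
theorem IsTwoComponent.slope_of_touch {Q : ℂ → EReal} {m : ℕ} {a₀ b₀ a₁ b₁ : ℝ} {t : ℕ → ℝ}
    (h : IsTwoComponent Q m a₀ b₀ a₁ b₁ t) {σ : Measure ℂ} (hσ : IsEquilibriumMeasure Q σ)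
    {r : ℝ} (hr : 0 < r) (hfin : Q r ≠ ⊤) (htouch : (Q r).toReal = radialPotential Q σ r)
    (hpos : 0 < σ.real {z | ‖z‖ ≤ r}) :
    (r : ℂ) ∈ coincidenceSet Q ∧ logSlope Q r = 2 * σ.real {z | ‖z‖ ≤ r} ∧
      logSlope Q r = 2 * σ.real {z | ‖z‖ < r} := by
  have hfe : FiniteEnergy Q σ := hσ.finiteEnergy h.pot h.b₀_pos
    (h.smooth.eventually_ne_top h.b₀_mem).self_of_nhds
  have := hσ.1.1
  have hQr : Q r = ((radialPotential Q σ r : ℝ) : EReal) := by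
    rw [← htouch, EReal.coe_toReal hfin (h.pot.ne_bot _)]
  have hline : ∀ A : Set ℂ, MeasurableSet A → (∀ w ∈ A, ‖w‖ ≤ r) → (∀ w ∉ A, r ≤ ‖w‖) →
      ∀ x : ℝ, 0 < x →
      ((radialPotential Q σ r + 2 * σ.real A * (Real.log x - Real.log r) : ℝ) : EReal) ≤ Q x := by
    intro A hA h1 h2 x hx
    by_cases hxt : Q x = ⊤
    · rw [hxt]; exact le_top
    rw [← EReal.coe_toReal hxt (h.pot.ne_bot _), EReal.coe_le_coe_iff]
    exact (radialPotential_add_le hσ.1 hr hx hA h1 h2).trans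
      (hσ.first_variation h.pot hfe hx hxt)
  have hm1 : MeasurableSet {z : ℂ | ‖z‖ ≤ r} := measurableSet_le measurable_norm measurable_const
  have hm2 : MeasurableSet {z : ℂ | ‖z‖ < r} := measurableSet_lt measurable_norm measurable_const
  -- Both the closed and the open disk are admissible in the supporting line inequality. As q is
  -- differentiable, the two slopes must agree, so the circle carries no mass.
  have l1 := hline _ hm1 (fun w hw => hw) (fun w hw => (not_le.1 hw).le)
  have l2 := hline _ hm2 (fun w hw => le_of_lt hw) (fun w hw => not_lt.1 hw)
  have hS : (r : ℂ) ∈ coincidenceSet Q := by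
    refine mem_coincidenceSet_of_line h.pot
      (c := radialPotential Q σ r - 2 * σ.real {z | ‖z‖ ≤ r} * Real.log r)
      (l := 2 * σ.real {z | ‖z‖ ≤ r}) (by positivity) ?_ hr
      (fun x hx => le_trans (le_of_eq ?_) (l1 x hx)) (hQr.trans ?_)
    · linarith [measureReal_le_one (μ := σ) (s := {z : ℂ | ‖z‖ ≤ r})]
    · congr 1; ring
    · congr 1; ring
  have hp : profile Q r = radialPotential Q σ r := htouch
  rw [← hp] at l1 l2
  exact ⟨hS, h.slope_eq hr hS l1, h.slope_eq hr hS l2⟩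

/-- The mass that the equilibrium measure gives to the inner component of the droplet. -/
theorem IsTwoComponent.logSlope_eq_mass {Q : ℂ → EReal} {m : ℕ} {a₀ b₀ a₁ b₁ : ℝ} {t : ℕ → ℝ}
    (h : IsTwoComponent Q m a₀ b₀ a₁ b₁ t) {σ : Measure ℂ} (hσ : IsEquilibriumMeasure Q σ) :
    logSlope Q b₀ = 2 * σ.real {z | ‖z‖ ≤ b₀} := by
  have := hσ.1.1
  have hfe : FiniteEnergy Q σ := hσ.finiteEnergy h.pot h.b₀_pos
    (h.smooth.eventually_ne_top h.b₀_mem).self_of_nhds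
  set ν : Measure ℝ := σ.map norm with hν
  have hmn : Measurable (norm : ℂ → ℝ) := measurable_norm
  have : IsProbabilityMeasure ν := Measure.isProbabilityMeasure_map hmn.aemeasurable
  have hIic : ∀ r : ℝ, σ.real {z | ‖z‖ ≤ r} = ν.real (Set.Iic r) := fun r => by
    rw [measureReal_def, measureReal_def, hν, Measure.map_apply hmn measurableSet_Iic]; rfl
  have hIio : ∀ r : ℝ, σ.real {z | ‖z‖ < r} = ν.real (Set.Iio r) := fun r => by
    rw [measureReal_def, measureReal_def, hν, Measure.map_apply hmn measurableSet_Iio]; rfl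
  have hpos : ∀ᵐ z ∂σ, 0 < σ.real {w | ‖w‖ ≤ ‖z‖} := by
    have h1 : ν {r | ν (Set.Iic r) ≤ 0} = 0 := le_antisymm (measure_setOf_Iic_le ν 0) bot_le
    have h2 : ∀ᵐ z ∂σ, ¬ ν (Set.Iic ‖z‖) ≤ 0 :=
      ae_of_ae_map (p := fun r => ¬ ν (Set.Iic r) ≤ 0) hmn.aemeasurable (by
        rw [ae_iff]; simpa using h1)
    filter_upwards [h2] with z hz
    rw [hIic, measureReal_def]
    exact ENNReal.toReal_pos (fun h0 => hz h0.le) (measure_ne_top _ _)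
  have htouch : ∀ᵐ z ∂σ, 0 < ‖z‖ ∧ (‖z‖ : ℂ) ∈ coincidenceSet Q ∧
      logSlope Q ‖z‖ = 2 * ν.real (Set.Iic ‖z‖) ∧ logSlope Q ‖z‖ = 2 * ν.real (Set.Iio ‖z‖) := by
    filter_upwards [hpos, hσ.radialPotential_eq h.pot hfe] with z hz1 hz2
    obtain ⟨h1, h2, h3⟩ := hz2
    rw [h.pot.eq_norm z] at h2 h3
    have := h.slope_of_touch hσ h1 h2 h3 hz1
    rw [hIic, hIio] at this
    exact ⟨h1, this⟩
  have hl := h.logSlope_pos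
  have hl2 := h.logSlope_eq ▸ h.logSlope_lt_two
  -- At almost every point with |z| ≤ b₀ the mass of the disk is half the slope, and the slope is at
  -- most the one at b₀. `hhigh` is the mirror statement for the complement, and the distribution
  -- function bounds then pin the mass of the disk of radius b₀ from both sides.
  have hlow : ∀ᵐ z ∂σ, ‖z‖ ≤ b₀ → ν (Set.Iic ‖z‖) ≤ ENNReal.ofReal (logSlope Q b₀ / 2) := by
    filter_upwards [htouch] with z hz hzb
    obtain ⟨h1, h2, h3, -⟩ := hz
    rw [← ofReal_measureReal]
    refine ENNReal.ofReal_le_ofReal ?_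
    have : logSlope Q ‖z‖ ≤ logSlope Q b₀ := by
      rcases hzb.lt_or_eq with hlt | heq
      · rcases (h.mem_iff h1).1 h2 with h5 | ⟨k, hk, h5⟩ | h5
        · exact (h.logSlope_lt_left h1 h5.1 hlt).le
        · exact absurd (h.outpost k hk).1 (by rw [← h5]; exact not_lt.2 hzb)
        · exact absurd h.gap (not_lt.2 (h5.1.trans hzb))
      · rw [heq]
    linarith
  have hhigh : ∀ᵐ z ∂σ, b₀ < ‖z‖ → ν (Set.Ici ‖z‖) ≤ ENNReal.ofReal (1 - logSlope Q b₀ / 2) := by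
    filter_upwards [htouch] with z hz hzb
    obtain ⟨h1, h2, -, h3⟩ := hz
    have hc : ν.real (Set.Ici ‖z‖) = 1 - ν.real (Set.Iio ‖z‖) := by
      rw [← Set.compl_Iio, probReal_compl_eq_one_sub measurableSet_Iio]
    rw [← ofReal_measureReal, hc]
    refine ENNReal.ofReal_le_ofReal ?_
    have : logSlope Q b₀ ≤ logSlope Q ‖z‖ := by
      rcases (h.mem_iff h1).1 h2 with h5 | ⟨k, hk, h5⟩ | h5
      · exact absurd h5.2 (not_le.2 hzb)
      · rw [h5, h.logSlope_t hk]
      · rw [← h.logSlope_eq]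
        rcases h5.1.lt_or_eq with hlt | heq
        · exact (h.logSlope_lt_right hlt h5.2).le
        · rw [heq]
    linarith
  have hub : ν (Set.Iic b₀) ≤ ENNReal.ofReal (logSlope Q b₀ / 2) := by
    refine le_trans ?_ (measure_setOf_Iic_le ν _)
    have h1 := measure_mono_ae (μ := σ) (s := norm ⁻¹' Set.Iic b₀)
      (t := norm ⁻¹' {r : ℝ | ν (Set.Iic r) ≤ ENNReal.ofReal (logSlope Q b₀ / 2)})
      (hlow.mono fun z hz hzb => hz hzb)
    rw [hν, Measure.map_apply hmn measurableSet_Iic]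
    exact h1.trans (Measure.le_map_apply hmn.aemeasurable _)
  have hlb : ν (Set.Ioi b₀) ≤ ENNReal.ofReal (1 - logSlope Q b₀ / 2) := by
    refine le_trans ?_ (measure_setOf_Ici_le ν _)
    have h1 := measure_mono_ae (μ := σ) (s := norm ⁻¹' Set.Ioi b₀)
      (t := norm ⁻¹' {r : ℝ | ν (Set.Ici r) ≤ ENNReal.ofReal (1 - logSlope Q b₀ / 2)})
      (hhigh.mono fun z hz hzb => hz hzb)
    rw [hν, Measure.map_apply hmn measurableSet_Ioi]
    exact h1.trans (Measure.le_map_apply hmn.aemeasurable _)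
  have hub' : ν.real (Set.Iic b₀) ≤ logSlope Q b₀ / 2 :=
    ENNReal.toReal_le_of_le_ofReal (by positivity) hub
  have hlb' : ν.real (Set.Ioi b₀) ≤ 1 - logSlope Q b₀ / 2 :=
    ENNReal.toReal_le_of_le_ofReal (by linarith) hlb
  rw [← Set.compl_Iic, probReal_compl_eq_one_sub measurableSet_Iic] at hlb'
  rw [hIic]
  linarith

/-! ### Radial statistics of the gas -/

instance : areaMeasure.IsAddHaarMeasure :=
  Measure.IsAddHaarMeasure.smul _
    (by simp [Real.pi_pos]) ENNReal.ofReal_ne_top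

theorem areaMeasure_real_ball : areaMeasure.real (Metric.ball 0 1) = 1 := by
  rw [measureReal_def, areaMeasure, Measure.smul_apply, Complex.volume_ball, smul_eq_mul,
    ENNReal.toReal_mul, ENNReal.toReal_ofReal (by positivity)]
  simp

theorem integral_area_norm (f : ℝ → ℝ) :
    ∫ z, f ‖z‖ ∂areaMeasure = 2 * ∫ r in Set.Ioi (0 : ℝ), r * f r := by
  rw [integral_fun_norm_addHaar areaMeasure f, areaMeasure_real_ball, Complex.finrank_real_complex]
  simp

/-- The Boltzmann factor `exp (-Q)`. -/
noncomputable def boltz (Q : ℂ → EReal) (z : ℂ) : ℝ := (EReal.exp (-Q z)).toReal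

theorem boltz_nonneg (Q : ℂ → EReal) (z : ℂ) : 0 ≤ boltz Q z := ENNReal.toReal_nonneg

theorem boltz_of_eq_coe {Q : ℂ → EReal} {z : ℂ} {x : ℝ} (h : Q z = x) :
    boltz Q z = Real.exp (-x) := by
  rw [boltz, h, ← EReal.coe_neg, EReal.exp_coe, ENNReal.toReal_ofReal (Real.exp_pos _).le]

theorem boltz_of_eq_top {Q : ℂ → EReal} {z : ℂ} (h : Q z = ⊤) : boltz Q z = 0 := by
  simp [boltz, h]

theorem IsPotential.boltz_le {Q : ℂ → EReal} (hQ : IsPotential Q) {z : ℂ} {x : ℝ}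
    (h : (x : EReal) ≤ Q z) : boltz Q z ≤ Real.exp (-x) := by
  by_cases ht : Q z = ⊤
  · rw [boltz_of_eq_top ht]; exact (Real.exp_pos _).le
  · obtain ⟨a, ha⟩ := EReal_eq_coe_of_ne (hQ.ne_bot z) ht
    rw [boltz_of_eq_coe ha]
    rw [ha, EReal.coe_le_coe_iff] at h
    exact Real.exp_le_exp.2 (neg_le_neg h)

theorem IsPotential.measurable_boltz {Q : ℂ → EReal} (hQ : IsPotential Q) :
    Measurable (boltz Q) := by
  have := hQ.lsc.measurable
  unfold boltz
  exact (this.neg.ereal_exp).ennreal_toReal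

theorem IsPotential.boltz_norm {Q : ℂ → EReal} (hQ : IsPotential Q) (z : ℂ) :
    boltz Q z = boltz Q (‖z‖ : ℂ) := by
  rw [boltz, boltz, ← hQ.eq_norm z]

theorem IsPotential.exp_neg_ne_top {Q : ℂ → EReal} (hQ : IsPotential Q) (z : ℂ) :
    EReal.exp (-Q z) ≠ ⊤ := by
  simp [hQ.ne_bot z]

theorem exp_neg_mul (Q : ℂ → EReal) (n : ℕ) (z : ℂ) :
    EReal.exp (-((n : EReal) * Q z)) = EReal.exp (-Q z) ^ n := by
  rw [← mul_neg, EReal.exp_nmul]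

/-- The real-valued gas density. -/
noncomputable def realDensity (Q : ℂ → EReal) (n : ℕ) (z : Fin n → ℂ) : ℝ :=
  (∏ j : Fin n, ∏ k ∈ Finset.Ioi j, ‖z k - z j‖ ^ 2) * ∏ j : Fin n, boltz Q (z j) ^ n

theorem IsPotential.gasDensity_eq {Q : ℂ → EReal} (hQ : IsPotential Q) (n : ℕ) (z : Fin n → ℂ) :
    gasDensity Q n z = ENNReal.ofReal (realDensity Q n z) := by
  have h1 : ∏ j : Fin n, ∏ k ∈ Finset.Ioi j, ‖z k - z j‖ₑ ^ 2 =
      ENNReal.ofReal (∏ j : Fin n, ∏ k ∈ Finset.Ioi j, ‖z k - z j‖ ^ 2) := by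
    rw [ENNReal.ofReal_prod_of_nonneg fun j _ => Finset.prod_nonneg fun k _ => by positivity]
    refine Finset.prod_congr rfl fun j _ => ?_
    rw [ENNReal.ofReal_prod_of_nonneg fun k _ => by positivity]
    refine Finset.prod_congr rfl fun k _ => ?_
    rw [ENNReal.ofReal_pow (norm_nonneg _), ofReal_norm]
  have h2 : ∏ j : Fin n, EReal.exp (-((n : EReal) * Q (z j))) =
      ENNReal.ofReal (∏ j : Fin n, boltz Q (z j) ^ n) := by
    rw [ENNReal.ofReal_prod_of_nonneg fun j _ => pow_nonneg (boltz_nonneg _ _) _]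
    refine Finset.prod_congr rfl fun j _ => ?_
    rw [exp_neg_mul, ENNReal.ofReal_pow (boltz_nonneg _ _), boltz,
      ENNReal.ofReal_toReal (hQ.exp_neg_ne_top _)]
  rw [gasDensity, h1, h2, realDensity, ENNReal.ofReal_mul]
  exact Finset.prod_nonneg fun j _ => Finset.prod_nonneg fun k _ => by positivity

theorem realDensity_nonneg (Q : ℂ → EReal) (n : ℕ) (z : Fin n → ℂ) : 0 ≤ realDensity Q n z :=
  mul_nonneg (Finset.prod_nonneg fun j _ => Finset.prod_nonneg fun k _ => by positivity)
    (Finset.prod_nonneg fun j _ => pow_nonneg (boltz_nonneg _ _) _)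

theorem IsPotential.measurable_realDensity {Q : ℂ → EReal} (hQ : IsPotential Q) (n : ℕ) :
    Measurable (realDensity Q n) := by
  have := hQ.measurable_boltz
  unfold realDensity
  fun_prop

/-- The radial moment `∫ f(|z|) |z|²ᵏ exp (-n Q) dA`. -/
noncomputable def moment (Q : ℂ → EReal) (n : ℕ) (f : ℝ → ℝ) (k : ℕ) : ℝ :=
  ∫ z, f ‖z‖ * ‖z‖ ^ (2 * k) * boltz Q z ^ n ∂areaMeasure

/-- The integrand is O(max(|z|, 1)^(-s)) with s = 2θn - a. From a ≤ 2n - 2, n ≥ 1 and θ > 1 it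
follows that s > 2, the real dimension. -/
theorem IsPotential.integrable_pow_mul_boltz {Q : ℂ → EReal} (hQ : IsPotential Q) {n a : ℕ}
    (han : a + 2 ≤ 2 * n) : Integrable (fun z => ‖z‖ ^ a * boltz Q z ^ n) areaMeasure := by
  obtain ⟨θ, hθ, C, hC⟩ := hQ.growth
  have hn : (1 : ℝ) ≤ n := by
    have : 1 ≤ n := by omega
    exact_mod_cast this
  set s : ℝ := 2 * θ * n - a with hs
  have hs2 : 2 < s := by
    have h1 : (a : ℝ) + 2 ≤ 2 * n := by exact_mod_cast han
    nlinarith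
  have hmeas := hQ.measurable_boltz
  have hint : Integrable (fun z : ℂ => Real.exp (n * C) * 2 ^ s * (1 + ‖z‖) ^ (-s)) areaMeasure :=
    (integrable_one_add_norm (by simpa [Complex.finrank_real_complex] using hs2)).const_mul _
  refine hint.mono' (Measurable.aestronglyMeasurable (by fun_prop))
    (Eventually.of_forall fun z => ?_)
  rw [Real.norm_of_nonneg (by have := boltz_nonneg Q z; positivity)]
  set M := max ‖z‖ 1 with hM
  have hM1 : 1 ≤ M := le_max_right _ _
  have hM0 : 0 < M := by linarith
  have h1 : boltz Q z ^ n ≤ Real.exp (n * C) * M ^ (-(2 * θ * n)) := by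
    calc boltz Q z ^ n ≤ Real.exp (-(2 * θ * Real.log M - C)) ^ n :=
          pow_le_pow_left₀ (boltz_nonneg _ _) (hQ.boltz_le (hC z)) n
      _ = _ := by
          rw [← Real.exp_nat_mul, Real.rpow_def_of_pos hM0, ← Real.exp_add]
          congr 1; ring
  have h2 : ‖z‖ ^ a ≤ M ^ (a : ℝ) := by
    rw [Real.rpow_natCast]
    exact pow_le_pow_left₀ (norm_nonneg _) (le_max_left _ _) a
  calc ‖z‖ ^ a * boltz Q z ^ n ≤ M ^ (a : ℝ) * (Real.exp (n * C) * M ^ (-(2 * θ * n))) :=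
        mul_le_mul h2 h1 (pow_nonneg (boltz_nonneg _ _) _) (by positivity)
    _ = Real.exp (n * C) * M ^ (-s) := by
        rw [mul_left_comm, ← Real.rpow_add hM0]
        congr 2; rw [hs]; ring
    _ ≤ Real.exp (n * C) * (2 ^ s * (1 + ‖z‖) ^ (-s)) := by
        gcongr
        have h3 : (1 + ‖z‖) / 2 ≤ M := by
          have := le_max_left ‖z‖ 1
          linarith
        have h4 : M ^ (-s) ≤ ((1 + ‖z‖) / 2) ^ (-s) :=
          Real.rpow_le_rpow_of_nonpos (by positivity) h3 (by linarith)
        refine h4.trans (le_of_eq ?_)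
        rw [Real.div_rpow (by positivity) (by norm_num), Real.rpow_neg (by norm_num : (0:ℝ) ≤ 2)]
        field_simp
    _ = _ := by ring

theorem IsPotential.integrable_monomial {Q : ℂ → EReal} (hQ : IsPotential Q) {n a b : ℕ}
    (han : a < n) (hbn : b < n) {f : ℝ → ℝ} (hf : Measurable f) {B : ℝ} (hB : ∀ r, |f r| ≤ B) :
    Integrable (fun z : ℂ => ((f ‖z‖ * boltz Q z ^ n : ℝ) : ℂ) *
      (z ^ a * (starRingEnd ℂ) z ^ b)) areaMeasure := by
  have hmeas := hQ.measurable_boltz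
  have hconj : Measurable fun z : ℂ => (starRingEnd ℂ) z := Complex.continuous_conj.measurable
  refine ((hQ.integrable_pow_mul_boltz (n := n) (a := a + b) (by omega)).const_mul B).mono'
    (Measurable.aestronglyMeasurable (by fun_prop)) (Eventually.of_forall fun z => ?_)
  rw [norm_mul, norm_mul, norm_pow, norm_pow, RCLike.norm_conj, Complex.norm_real,
    Real.norm_eq_abs, abs_mul, abs_of_nonneg (pow_nonneg (boltz_nonneg Q z) n), ← pow_add]
  have := hB ‖z‖
  have h2 := pow_nonneg (boltz_nonneg Q z) n
  calc _ ≤ B * boltz Q z ^ n * ‖z‖ ^ (a + b) := by gcongr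
    _ = _ := by ring

theorem IsPotential.integral_monomial {Q : ℂ → EReal} (hQ : IsPotential Q) (n a b : ℕ)
    (f : ℝ → ℝ) :
    ∫ z, ((f ‖z‖ * boltz Q z ^ n : ℝ) : ℂ) * (z ^ a * (starRingEnd ℂ) z ^ b) ∂areaMeasure =
      if a = b then (moment Q n f a : ℂ) else 0 := by
  split_ifs with hab
  · subst hab
    rw [moment, ← integral_complex_ofReal]
    refine integral_congr_ae (Eventually.of_forall fun z => ?_)
    simp only
    rw [← mul_pow, Complex.mul_conj']
    push_cast
    ring
  -- Rotation by the angle π/(a-b) multiplies z^a z̄^b by e^(iπ) = -1, so the integral equals its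
  -- own negative.
  · set c : Circle := Circle.exp (Real.pi / ((a : ℝ) - b)) with hc
    have hab' : (a : ℝ) - b ≠ 0 := by
      intro h; exact hab (by exact_mod_cast sub_eq_zero.1 h)
    have hcc : (c : ℂ) ^ a * (starRingEnd ℂ) (c : ℂ) ^ b = -1 := by
      rw [hc, Circle.coe_exp, ← Complex.exp_conj, map_mul, Complex.conj_I, Complex.conj_ofReal,
        ← Complex.exp_nat_mul, ← Complex.exp_nat_mul, ← Complex.exp_add, ← Complex.exp_pi_mul_I]
      congr 1
      have : (a : ℂ) - b ≠ 0 := by exact_mod_cast hab'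
      push_cast
      field_simp
      ring
    have hmp : MeasurePreserving (rotation c) areaMeasure areaMeasure :=
      ((rotation c).measurePreserving).smul_measure _
    have hinv := MeasurePreserving.integral_comp' (f := (rotation c).toMeasurableEquiv) hmp
      (fun z : ℂ => ((f ‖z‖ * boltz Q z ^ n : ℝ) : ℂ) * (z ^ a * (starRingEnd ℂ) z ^ b))
    have hneg : ∀ z : ℂ, ((f ‖rotation c z‖ * boltz Q (rotation c z) ^ n : ℝ) : ℂ) *
        ((rotation c z) ^ a * (starRingEnd ℂ) (rotation c z) ^ b) =
        -(((f ‖z‖ * boltz Q z ^ n : ℝ) : ℂ) * (z ^ a * (starRingEnd ℂ) z ^ b)) := by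
      intro z
      rw [LinearIsometryEquiv.norm_map, hQ.boltz_norm (rotation c z),
        LinearIsometryEquiv.norm_map, ← hQ.boltz_norm z, rotation_apply, map_mul, mul_pow, mul_pow]
      linear_combination ((f ‖z‖ * boltz Q z ^ n : ℝ) : ℂ) * (z ^ a * (starRingEnd ℂ) z ^ b) * hcc
    have hinv' : ∫ z, -(((f ‖z‖ * boltz Q z ^ n : ℝ) : ℂ) * (z ^ a * (starRingEnd ℂ) z ^ b))
        ∂areaMeasure = ∫ z, ((f ‖z‖ * boltz Q z ^ n : ℝ) : ℂ) * (z ^ a * (starRingEnd ℂ) z ^ b)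
        ∂areaMeasure := by
      rw [← hinv]
      refine integral_congr_ae (Eventually.of_forall fun z => ?_)
      exact (hneg z).symm
    rw [integral_neg] at hinv'
    exact self_eq_neg.1 hinv'.symm

/-! ### Permutation expansion of the gas density -/

open Equiv in
theorem vandermonde_sq_expand {n : ℕ} (z : Fin n → ℂ) :
    ((∏ j : Fin n, ∏ k ∈ Finset.Ioi j, ‖z k - z j‖ ^ 2 : ℝ) : ℂ) =
      ∑ σ : Perm (Fin n), ∑ τ : Perm (Fin n), ((Perm.sign σ : ℤ) : ℂ) * ((Perm.sign τ : ℤ) : ℂ) *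
        ∏ i, (z i ^ (σ i : ℕ) * (starRingEnd ℂ) (z i) ^ (τ i : ℕ)) := by
  have hdet : (Matrix.vandermonde z).det =
      ∑ σ : Perm (Fin n), ((Perm.sign σ : ℤ) : ℂ) * ∏ i, z i ^ (σ i : ℕ) := by
    rw [← Matrix.det_transpose, Matrix.det_apply']
    simp [Matrix.vandermonde_apply]
  have h1 : ((∏ j : Fin n, ∏ k ∈ Finset.Ioi j, ‖z k - z j‖ ^ 2 : ℝ) : ℂ) =
      (Matrix.vandermonde z).det * (starRingEnd ℂ) (Matrix.vandermonde z).det := by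
    rw [Matrix.det_vandermonde]
    simp only [map_prod, ← Finset.prod_mul_distrib, Complex.ofReal_prod, Complex.mul_conj',
      Complex.ofReal_pow]
  rw [h1, hdet, map_sum, Finset.sum_mul_sum]
  refine Finset.sum_congr rfl fun σ _ => Finset.sum_congr rfl fun τ _ => ?_
  simp only [map_mul, map_prod, map_pow, map_intCast, Finset.prod_mul_distrib]
  ring

theorem realDensity_mul_expand {Q : ℂ → EReal} {n : ℕ} (F : Fin n → ℝ → ℝ) (z : Fin n → ℂ) :
    ((realDensity Q n z * ∏ i, F i ‖z i‖ : ℝ) : ℂ) =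
      ∑ σ : Equiv.Perm (Fin n), ∑ τ : Equiv.Perm (Fin n),
        ((Equiv.Perm.sign σ : ℤ) : ℂ) * ((Equiv.Perm.sign τ : ℤ) : ℂ) *
        ∏ i, (((F i ‖z i‖ * boltz Q (z i) ^ n : ℝ) : ℂ) *
          (z i ^ (σ i : ℕ) * (starRingEnd ℂ) (z i) ^ (τ i : ℕ))) := by
  rw [realDensity, mul_assoc, Complex.ofReal_mul, vandermonde_sq_expand, Finset.sum_mul]
  refine Finset.sum_congr rfl fun σ _ => ?_
  rw [Finset.sum_mul]
  refine Finset.sum_congr rfl fun τ _ => ?_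
  rw [mul_assoc, ← Finset.prod_mul_distrib, Complex.ofReal_prod, ← Finset.prod_mul_distrib]
  congr 1
  refine Finset.prod_congr rfl fun i _ => ?_
  push_cast
  ring

/-- In the double sum over permutations, orthogonality of distinct monomials kills every term with σ
≠ τ; on the diagonal the signs square to 1. This is the source of the independence of the moduli. -/
theorem IsPotential.integral_realDensity {Q : ℂ → EReal} (hQ : IsPotential Q) {n : ℕ}
    {F : Fin n → ℝ → ℝ} (hF : ∀ i, Measurable (F i)) {B : ℝ} (hB : ∀ i r, |F i r| ≤ B) :
    Integrable (fun z => realDensity Q n z * ∏ i, F i ‖z i‖)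
      (Measure.pi fun _ : Fin n => areaMeasure) ∧
    ∫ z, realDensity Q n z * ∏ i, F i ‖z i‖ ∂(Measure.pi fun _ : Fin n => areaMeasure) =
      ∑ σ : Equiv.Perm (Fin n), ∏ i, moment Q n (F i) (σ i) := by
  have hterm : ∀ σ τ : Equiv.Perm (Fin n), Integrable (fun z : Fin n → ℂ =>
      ((Equiv.Perm.sign σ : ℤ) : ℂ) * ((Equiv.Perm.sign τ : ℤ) : ℂ) *
        ∏ i, (((F i ‖z i‖ * boltz Q (z i) ^ n : ℝ) : ℂ) *
          (z i ^ (σ i : ℕ) * (starRingEnd ℂ) (z i) ^ (τ i : ℕ))))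
      (Measure.pi fun _ : Fin n => areaMeasure) := fun σ τ =>
    (Integrable.fintype_prod (f := fun i (z : ℂ) => ((F i ‖z‖ * boltz Q z ^ n : ℝ) : ℂ) *
      (z ^ (σ i : ℕ) * (starRingEnd ℂ) z ^ (τ i : ℕ))) fun i =>
      hQ.integrable_monomial (σ i).2 (τ i).2 (hF i) (hB i)).const_mul _
  have hint : Integrable (fun z => ((realDensity Q n z * ∏ i, F i ‖z i‖ : ℝ) : ℂ))
      (Measure.pi fun _ : Fin n => areaMeasure) := by
    simp only [realDensity_mul_expand]
    exact integrable_finsetSum _ fun σ _ => integrable_finsetSum _ fun τ _ => hterm σ τ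
  refine ⟨by simpa only [RCLike.re_eq_complex_re, Complex.ofReal_re] using hint.re, ?_⟩
  have hc : ((∫ z, realDensity Q n z * ∏ i, F i ‖z i‖
      ∂(Measure.pi fun _ : Fin n => areaMeasure) : ℝ) : ℂ) =
      ((∑ σ : Equiv.Perm (Fin n), ∏ i, moment Q n (F i) (σ i) : ℝ) : ℂ) := by
    rw [← integral_complex_ofReal]
    simp only [realDensity_mul_expand]
    rw [integral_finsetSum _ fun σ _ => integrable_finsetSum _ fun τ _ => hterm σ τ]
    rw [Complex.ofReal_sum]
    refine Finset.sum_congr rfl fun σ _ => ?_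
    rw [integral_finsetSum _ fun τ _ => hterm σ τ, Finset.sum_eq_single σ]
    · rw [integral_const_mul, integral_fintype_prod_eq_prod (fun i (z : ℂ) =>
        ((F i ‖z‖ * boltz Q z ^ n : ℝ) : ℂ) *
          (z ^ (σ i : ℕ) * (starRingEnd ℂ) z ^ (σ i : ℕ)))]
      simp only [hQ.integral_monomial, if_true]
      rw [← Int.cast_mul, ← Units.val_mul, Int.units_mul_self]
      simp
    · intro τ _ hτ
      rw [integral_const_mul, integral_fintype_prod_eq_prod (fun i (z : ℂ) =>
        ((F i ‖z‖ * boltz Q z ^ n : ℝ) : ℂ) *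
          (z ^ (σ i : ℕ) * (starRingEnd ℂ) z ^ (τ i : ℕ)))]
      obtain ⟨i, hi⟩ : ∃ i, τ i ≠ σ i := by
        by_contra! h
        exact hτ (Equiv.ext h)
      rw [Finset.prod_eq_zero (Finset.mem_univ i), mul_zero]
      rw [hQ.integral_monomial, if_neg]
      exact fun h => hi (Fin.ext h.symm)
    · simp
  exact_mod_cast hc

/-- The expectation of `f(|z|)` under the law with density proportional to
`|z|²ᵏ exp (-n Q)`. -/
noncomputable def level (Q : ℂ → EReal) (n : ℕ) (f : ℝ → ℝ) (k : ℕ) : ℝ :=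
  moment Q n f k / moment Q n (fun _ => 1) k

theorem level_one {Q : ℂ → EReal} {n k : ℕ} (hJ : 0 < moment Q n (fun _ => 1) k) :
    level Q n (fun _ => 1) k = 1 := div_self hJ.ne'

theorem IsPotential.integral_gas {Q : ℂ → EReal} (hQ : IsPotential Q) {n : ℕ}
    (hJ : ∀ k < n, 0 < moment Q n (fun _ => 1) k) :
    IsProbabilityMeasure (gas Q n) ∧ ∀ Φ : (Fin n → ℂ) → ℝ, ∫ z, Φ z ∂(gas Q n) =
      (n.factorial * ∏ k : Fin n, moment Q n (fun _ => 1) k)⁻¹ *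
        ∫ z, realDensity Q n z * Φ z ∂(Measure.pi fun _ : Fin n => areaMeasure) := by
  obtain ⟨hint, hval⟩ := hQ.integral_realDensity (n := n) (F := fun _ _ => 1)
    (fun _ => measurable_const) (B := 1) (by simp)
  simp only [Finset.prod_const_one, mul_one] at hint hval
  set Z : ℝ := n.factorial * ∏ k : Fin n, moment Q n (fun _ => 1) k with hZ
  have hZ0 : 0 < Z := mul_pos (by positivity) (Finset.prod_pos fun k _ => hJ k k.2)
  have hval' : ∫ z, realDensity Q n z ∂(Measure.pi fun _ : Fin n => areaMeasure) = Z := by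
    rw [hval]
    have : ∀ σ : Equiv.Perm (Fin n), ∏ i, moment Q n (fun _ => 1) (σ i : ℕ) =
        ∏ i : Fin n, moment Q n (fun _ => 1) i := fun σ =>
      Equiv.prod_comp σ fun i : Fin n => moment Q n (fun _ => 1) (i : ℕ)
    simp [this, hZ, Fintype.card_perm]
  have hdens : gasDensity Q n = fun z => ENNReal.ofReal (realDensity Q n z) :=
    funext fun z => hQ.gasDensity_eq n z
  have hpart : partitionFunction Q n = ENNReal.ofReal Z := by
    rw [partitionFunction, hdens, ← hval', ofReal_integral_eq_lintegral_ofReal hint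
      (Eventually.of_forall fun z => realDensity_nonneg Q n z)]
  have hmeas := hQ.measurable_realDensity n
  constructor
  · constructor
    rw [gas, Measure.smul_apply, withDensity_apply _ .univ, Measure.restrict_univ, smul_eq_mul]
    have : ∫⁻ z, gasDensity Q n z ∂(Measure.pi fun _ : Fin n => areaMeasure) =
      partitionFunction Q n := rfl
    rw [this, hpart]
    exact ENNReal.inv_mul_cancel (by simpa using hZ0) ENNReal.ofReal_ne_top
  · intro Φ
    rw [gas, integral_smul_measure, hdens, integral_withDensity_eq_integral_toReal_smul
      hmeas.ennreal_ofReal (Eventually.of_forall fun z => ENNReal.ofReal_lt_top), hpart,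
      ENNReal.toReal_inv, ENNReal.toReal_ofReal hZ0.le, smul_eq_mul]
    simp only [ENNReal.toReal_ofReal (realDensity_nonneg _ _ _), smul_eq_mul]

/-- The moduli are distributed as independent radial variables, one for each level, assigned to the
particles by a uniformly random permutation. -/
theorem IsPotential.integral_gas_prod {Q : ℂ → EReal} (hQ : IsPotential Q) {n : ℕ}
    (hJ : ∀ k < n, 0 < moment Q n (fun _ => 1) k)
    {F : Fin n → ℝ → ℝ} (hF : ∀ i, Measurable (F i)) {B : ℝ} (hB : ∀ i r, |F i r| ≤ B) :
    ∫ z, ∏ i, F i ‖z i‖ ∂(gas Q n) =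
      (n.factorial : ℝ)⁻¹ * ∑ σ : Equiv.Perm (Fin n), ∏ i, level Q n (F i) (σ i) := by
  rw [(hQ.integral_gas hJ).2, (hQ.integral_realDensity hF hB).2, mul_inv, mul_assoc,
    Finset.mul_sum]
  congr 1
  refine Finset.sum_congr rfl fun σ _ => ?_
  simp only [level, Finset.prod_div_distrib]
  rw [Equiv.prod_comp σ fun i : Fin n => moment Q n (fun _ => 1) (i : ℕ)]
  field_simp

theorem IsPotential.integral_gas_pair {Q : ℂ → EReal} (hQ : IsPotential Q) {n : ℕ}
    (hJ : ∀ k < n, 0 < moment Q n (fun _ => 1) k) {f g : ℝ → ℝ} (hf : Measurable f)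
    (hg : Measurable g) (hf1 : ∀ r, |f r| ≤ 1) (hg1 : ∀ r, |g r| ≤ 1) (i l : Fin n) :
    ∫ z, f ‖z i‖ * g ‖z l‖ ∂(gas Q n) =
      (n.factorial : ℝ)⁻¹ * ∑ σ : Equiv.Perm (Fin n),
        if i = l then level Q n (fun r => f r * g r) (σ i)
        else level Q n f (σ i) * level Q n g (σ l) := by
  set F : Fin n → ℝ → ℝ := fun j r => (if j = i then f r else 1) * (if j = l then g r else 1)
    with hF
  have hFm : ∀ j, Measurable (F j) := fun j => by
    refine Measurable.mul ?_ ?_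
    · split_ifs <;> fun_prop
    · split_ifs <;> fun_prop
  have hFB : ∀ j r, |F j r| ≤ 1 := fun j r => by
    have h1 : |if j = i then f r else 1| ≤ 1 := by split_ifs <;> simp [hf1]
    have h2 : |if j = l then g r else 1| ≤ 1 := by split_ifs <;> simp [hg1]
    rw [hF, abs_mul]
    exact mul_le_one₀ h1 (abs_nonneg _) h2
  have hprod : ∀ z : Fin n → ℂ, ∏ j, F j ‖z j‖ = f ‖z i‖ * g ‖z l‖ := fun z => by
    simp only [hF, Finset.prod_mul_distrib, Finset.prod_ite_eq', Finset.mem_univ, if_true]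
  simp only [← hprod]
  rw [hQ.integral_gas_prod hJ hFm hFB]
  congr 1
  refine Finset.sum_congr rfl fun σ _ => ?_
  have h1 : ∀ k : Fin n, level Q n (fun _ => 1) (k : ℕ) = 1 := fun k => level_one (hJ k k.2)
  split_ifs with hil
  · subst hil
    rw [Finset.prod_eq_single i]
    · simp [hF]
    · intro j _ hj
      simp [hF, hj, h1]
    · simp
  · rw [Finset.prod_eq_mul i l hil]
    · simp [hF, hil, Ne.symm hil]
    · intro j _ hj
      simp [hF, hj.1, hj.2, h1]
    · simp
    · simp

/-- A permutation relabels both indices at once, so each inner double sum is unchanged and the n!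
copies cancel the normalization. -/
theorem sum_perm_comp {n : ℕ} (A : Fin n → Fin n → ℝ) :
    ∑ i, ∑ l, (n.factorial : ℝ)⁻¹ * ∑ σ : Equiv.Perm (Fin n), A (σ i) (σ l) =
      ∑ i, ∑ l, A i l := by
  have h : ∀ σ : Equiv.Perm (Fin n), ∑ i, ∑ l, A (σ i) (σ l) = ∑ i, ∑ l, A i l := fun σ => by
    rw [Equiv.sum_comp σ fun i => ∑ l, A i (σ l)]
    exact Finset.sum_congr rfl fun i _ => Equiv.sum_comp σ fun l => A i l
  simp only [← Finset.mul_sum]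
  have : ∑ i, ∑ l, ∑ σ : Equiv.Perm (Fin n), A (σ i) (σ l) =
      ∑ σ : Equiv.Perm (Fin n), ∑ i, ∑ l, A (σ i) (σ l) := by
    rw [Finset.sum_comm (s := (Finset.univ : Finset (Equiv.Perm (Fin n))))]
    exact Finset.sum_congr rfl fun i _ => Finset.sum_comm
  rw [this]
  simp only [h, Finset.sum_const, Finset.card_univ, Fintype.card_perm, Fintype.card_fin,
    nsmul_eq_mul]
  have : (n.factorial : ℝ) ≠ 0 := by positivity
  field_simp

/-- The linear statistic `∑ f(|z_j|)`. -/
noncomputable def radialSum (f : ℝ → ℝ) (n : ℕ) (z : Fin n → ℂ) : ℝ := ∑ j : Fin n, f ‖z j‖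

theorem measurable_radialSum {f : ℝ → ℝ} (hf : Measurable f) (n : ℕ) :
    Measurable (radialSum f n) := by
  unfold radialSum
  fun_prop

theorem abs_radialSum_le {f : ℝ → ℝ} (hf1 : ∀ r, |f r| ≤ 1) (n : ℕ) (z : Fin n → ℂ) :
    |radialSum f n z| ≤ n := by
  refine (Finset.abs_sum_le_sum_abs _ _).trans ?_
  refine (Finset.sum_le_sum fun j _ => hf1 ‖z j‖).trans ?_
  simp

theorem IsPotential.integral_radialSum {Q : ℂ → EReal} (hQ : IsPotential Q) {n : ℕ}
    (hJ : ∀ k < n, 0 < moment Q n (fun _ => 1) k) {f : ℝ → ℝ} (hf : Measurable f)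
    (hf1 : ∀ r, |f r| ≤ 1) :
    ∫ z, radialSum f n z ∂(gas Q n) = ∑ k : Fin n, level Q n f k := by
  have := (hQ.integral_gas hJ).1
  have hterm : ∀ i : Fin n, ∫ z, f ‖z i‖ ∂(gas Q n) =
      (n.factorial : ℝ)⁻¹ * ∑ σ : Equiv.Perm (Fin n), level Q n f (σ i) := fun i => by
    have := hQ.integral_gas_pair hJ hf (measurable_const (a := (1 : ℝ))) hf1 (by simp) i i
    simpa using this
  have hint : ∀ i : Fin n, Integrable (fun z : Fin n → ℂ => f ‖z i‖) (gas Q n) := fun i =>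
    Integrable.of_bound (Measurable.aestronglyMeasurable (by fun_prop)) 1
      (Eventually.of_forall fun z => hf1 _)
  simp only [radialSum]
  rw [integral_finsetSum _ fun i _ => hint i]
  simp only [hterm, ← Finset.mul_sum]
  rw [Finset.sum_comm]
  have : ∀ σ : Equiv.Perm (Fin n), ∑ i, level Q n f (σ i : ℕ) = ∑ i : Fin n, level Q n f i :=
    fun σ => Equiv.sum_comp σ fun i : Fin n => level Q n f i
  simp only [this, Finset.sum_const, Finset.card_univ, Fintype.card_perm, Fintype.card_fin,
    nsmul_eq_mul]
  have : (n.factorial : ℝ) ≠ 0 := by positivity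
  field_simp

/-- Pairs of distinct particles contribute products of distinct levels, which cancel against the
product of the means; only the diagonal terms remain. -/
theorem IsPotential.covariance_radialSum {Q : ℂ → EReal} (hQ : IsPotential Q) {n : ℕ}
    (hJ : ∀ k < n, 0 < moment Q n (fun _ => 1) k) {f g : ℝ → ℝ} (hf : Measurable f)
    (hg : Measurable g) (hf1 : ∀ r, |f r| ≤ 1) (hg1 : ∀ r, |g r| ≤ 1) :
    covariance (radialSum f n) (radialSum g n) (gas Q n) =
      ∑ k : Fin n, (level Q n (fun r => f r * g r) k - level Q n f k * level Q n g k) := by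
  have := (hQ.integral_gas hJ).1
  have hmem : ∀ {u : ℝ → ℝ}, Measurable u → (∀ r, |u r| ≤ 1) →
      MemLp (radialSum u n) 2 (gas Q n) := fun hu hu1 =>
    MemLp.of_bound (measurable_radialSum hu n).aestronglyMeasurable n
      (Eventually.of_forall fun z => abs_radialSum_le hu1 n z)
  rw [covariance_eq_sub (hmem hf hf1) (hmem hg hg1), hQ.integral_radialSum hJ hf hf1,
    hQ.integral_radialSum hJ hg hg1]
  have hint : ∀ i l : Fin n, Integrable (fun z : Fin n → ℂ => f ‖z i‖ * g ‖z l‖) (gas Q n) :=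
    fun i l => Integrable.of_bound (Measurable.aestronglyMeasurable (by fun_prop)) 1
      (Eventually.of_forall fun z => by
        rw [Real.norm_eq_abs, abs_mul]
        exact mul_le_one₀ (hf1 _) (abs_nonneg _) (hg1 _))
  have hprod : ∫ z, (radialSum f n * radialSum g n) z ∂(gas Q n) =
      ∑ i : Fin n, ∑ l : Fin n, if i = l then level Q n (fun r => f r * g r) i
        else level Q n f i * level Q n g l := by
    have h1 : ∀ z : Fin n → ℂ, (radialSum f n * radialSum g n) z =
        ∑ i, ∑ l, f ‖z i‖ * g ‖z l‖ := fun z => by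
      simp only [Pi.mul_apply, radialSum, Finset.sum_mul_sum]
    simp only [h1]
    rw [integral_finsetSum _ fun i _ => integrable_finsetSum _ fun l _ => hint i l]
    have h2 : ∀ i : Fin n, ∫ z, ∑ l : Fin n, f ‖z i‖ * g ‖z l‖ ∂(gas Q n) =
        ∑ l : Fin n, ∫ z, f ‖z i‖ * g ‖z l‖ ∂(gas Q n) := fun i =>
      integral_finsetSum _ fun l _ => hint i l
    simp only [h2]
    simp only [hQ.integral_gas_pair hJ hf hg hf1 hg1]
    rw [← sum_perm_comp fun i l : Fin n => if i = l then level Q n (fun r => f r * g r) i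
      else level Q n f i * level Q n g l]
    refine Finset.sum_congr rfl fun i _ => Finset.sum_congr rfl fun l _ => ?_
    congr 1
    refine Finset.sum_congr rfl fun σ _ => ?_
    simp only [σ.injective.eq_iff]
  rw [hprod, Finset.sum_mul_sum, ← Finset.sum_sub_distrib]
  refine Finset.sum_congr rfl fun i _ => ?_
  rw [← Finset.sum_sub_distrib, Finset.sum_eq_single i]
  · simp
  · intro l _ hl
    simp [Ne.symm hl]
  · simp

/-! ### Laplace's method with finitely many peaks -/

/-- Near `ζ`, `E` is the exponential of a function with a nondegenerate minimum. -/
def HasGaussianPeak (E : ℝ → ℝ) (ζ κ : ℝ) : Prop :=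
  ∃ V : ℝ → ℝ, (∀ᶠ r in 𝓝 ζ, E r = Real.exp (-V r)) ∧
    (fun r => V r - κ / 2 * (r - ζ) ^ 2) =o[𝓝 ζ] fun r => (r - ζ) ^ 2

/-- Half of the quadratic term absorbs the error, which leaves a Gaussian majorant for the rescaled
integrals. -/
theorem HasGaussianPeak.exists_le {E : ℝ → ℝ} {ζ κ : ℝ} (h : HasGaussianPeak E ζ κ)
    (hκ : 0 < κ) :
    ∃ δ > 0, ∀ r ∈ Metric.ball ζ δ, E r ≤ Real.exp (-(κ / 4) * (r - ζ) ^ 2) := by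
  obtain ⟨V, hV, ho⟩ := h
  have := hV.and (ho.def (c := κ / 4) (by positivity))
  obtain ⟨δ, hδ, hball⟩ := Metric.eventually_nhds_iff_ball.1 this
  refine ⟨δ, hδ, fun r hr => ?_⟩
  obtain ⟨h1, h2⟩ := hball r hr
  rw [h1]
  rw [Real.norm_eq_abs, Real.norm_of_nonneg (sq_nonneg _)] at h2
  have := (abs_le.1 h2).1
  exact Real.exp_le_exp.2 (by linarith)

theorem tendsto_add_inv_sqrt_mul (ζ y : ℝ) :
    Tendsto (fun n : ℕ => ζ + (√(n : ℝ))⁻¹ * y) atTop (𝓝 ζ) := by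
  have h : Tendsto (fun n : ℕ => (√(n : ℝ))⁻¹) atTop (𝓝 0) :=
    tendsto_inv_atTop_zero.comp (Real.tendsto_sqrt_atTop.comp tendsto_natCast_atTop_atTop)
  simpa using (h.mul_const y).const_add ζ

theorem HasGaussianPeak.tendsto_pow {E : ℝ → ℝ} {ζ κ : ℝ} (h : HasGaussianPeak E ζ κ) (y : ℝ) :
    Tendsto (fun n : ℕ => E (ζ + (√(n : ℝ))⁻¹ * y) ^ n) atTop
      (𝓝 (Real.exp (-(κ / 2) * y ^ 2))) := by
  obtain ⟨V, hV, ho⟩ := h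
  have hlim := tendsto_add_inv_sqrt_mul ζ y
  have hsq : ∀ᶠ n : ℕ in atTop, (n : ℝ) * ((√(n : ℝ))⁻¹ * y) ^ 2 = y ^ 2 := by
    filter_upwards [eventually_gt_atTop 0] with n hn
    have : (0 : ℝ) < n := by exact_mod_cast hn
    rw [mul_pow, inv_pow, Real.sq_sqrt this.le]
    field_simp
  have hnV : Tendsto (fun n : ℕ => (n : ℝ) * V (ζ + (√(n : ℝ))⁻¹ * y)) atTop
      (𝓝 (κ / 2 * y ^ 2)) := by
    have h1 : (fun n : ℕ => (n : ℝ) * (V (ζ + (√(n : ℝ))⁻¹ * y) -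
        κ / 2 * ((√(n : ℝ))⁻¹ * y) ^ 2)) =o[atTop] fun n : ℕ => (n : ℝ) * ((√(n : ℝ))⁻¹ * y) ^ 2 := by
      have := ho.comp_tendsto hlim
      simp only [Function.comp_def, add_sub_cancel_left] at this
      exact (Asymptotics.isBigO_refl _ _).mul_isLittleO this
    have h2 : (fun n : ℕ => (n : ℝ) * (V (ζ + (√(n : ℝ))⁻¹ * y) -
        κ / 2 * ((√(n : ℝ))⁻¹ * y) ^ 2)) =o[atTop] fun _ : ℕ => (1 : ℝ) :=
      h1.trans_isBigO ((Asymptotics.isBigO_const_const (y ^ 2) one_ne_zero atTop).congr'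
        (hsq.mono fun _ hn => hn.symm) EventuallyEq.rfl)
    have h3 := ((Asymptotics.isLittleO_one_iff ℝ).1 h2).add_const (κ / 2 * y ^ 2)
    rw [zero_add] at h3
    refine h3.congr' (hsq.mono fun n hn => ?_)
    linear_combination (-(κ / 2)) * hn
  have := (Real.continuous_exp.tendsto _).comp hnV.neg
  rw [← neg_mul] at this
  refine this.congr' ?_
  filter_upwards [hlim.eventually hV] with n hn
  rw [hn, ← Real.exp_nat_mul]
  simp

theorem sqrt_mul_integral_ball (G : ℝ → ℝ) (ζ δ : ℝ) {n : ℕ} (hn : 0 < n) :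
    √(n : ℝ) * ∫ r in Metric.ball ζ δ, G r =
      ∫ y, (Metric.ball ζ δ).indicator G (ζ + (√(n : ℝ))⁻¹ * y) := by
  have hpos : 0 < √(n : ℝ) := Real.sqrt_pos.2 (by exact_mod_cast hn)
  rw [Measure.integral_comp_mul_left (fun y => (Metric.ball ζ δ).indicator G (ζ + y)),
    integral_add_left_eq_self (fun y => (Metric.ball ζ δ).indicator G y) ζ,
    integral_indicator Metric.isOpen_ball.measurableSet, inv_inv, abs_of_pos hpos, smul_eq_mul]

/-- Substitute r = ζ + y/√n. The rescaled integrand converges pointwise to k e^(-κy²/2) and is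
dominated by B e^(-κy²/4). -/
theorem HasGaussianPeak.tendsto_integral {E : ℝ → ℝ} {ζ κ δ B k : ℝ} {K : ℕ → ℝ → ℝ}
    (h : HasGaussianPeak E ζ κ) (hκ : 0 < κ) (hE : Measurable E) (hE0 : ∀ r, 0 ≤ E r)
    (hδ : 0 < δ) (hδE : ∀ r ∈ Metric.ball ζ δ, E r ≤ Real.exp (-(κ / 4) * (r - ζ) ^ 2))
    (hK : ∀ n, Measurable (K n)) (hB : ∀ n, ∀ r ∈ Metric.ball ζ δ, |K n r| ≤ B)
    (hk : ∀ y, Tendsto (fun n : ℕ => K n (ζ + (√(n : ℝ))⁻¹ * y)) atTop (𝓝 k)) :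
    Tendsto (fun n : ℕ => √(n : ℝ) * ∫ r in Metric.ball ζ δ, K n r * E r ^ n) atTop
      (𝓝 (k * √(2 * Real.pi / κ))) := by
  have hgauss : ∫ y : ℝ, k * Real.exp (-(κ / 2) * y ^ 2) = k * √(2 * Real.pi / κ) := by
    rw [integral_const_mul, integral_gaussian]
    congr 2
    field_simp
  rw [← hgauss]
  have hB0 : 0 ≤ B := (abs_nonneg _).trans (hB 0 ζ (Metric.mem_ball_self hδ))
  refine Tendsto.congr' (f₁ := fun n : ℕ => ∫ y, (Metric.ball ζ δ).indicator
    (fun r => K n r * E r ^ n) (ζ + (√(n : ℝ))⁻¹ * y)) ?_ ?_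
  · filter_upwards [eventually_gt_atTop 0] with n hn
    rw [sqrt_mul_integral_ball _ _ _ hn]
  refine tendsto_integral_filter_of_dominated_convergence
    (fun y => B * Real.exp (-(κ / 4) * y ^ 2)) ?_ ?_ ?_ ?_
  · refine Eventually.of_forall fun n => Measurable.aestronglyMeasurable ?_
    have h1 : Measurable fun r => K n r * E r ^ n := (hK n).mul (hE.pow_const n)
    exact (h1.indicator Metric.isOpen_ball.measurableSet).comp (by fun_prop)
  · filter_upwards [eventually_gt_atTop 0] with n hn
    refine Eventually.of_forall fun y => ?_
    by_cases hy : ζ + (√(n : ℝ))⁻¹ * y ∈ Metric.ball ζ δ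
    · rw [Set.indicator_of_mem hy, norm_mul, Real.norm_eq_abs, Real.norm_eq_abs,
        abs_of_nonneg (pow_nonneg (hE0 _) _)]
      refine mul_le_mul (hB n _ hy) ?_ (pow_nonneg (hE0 _) _) hB0
      refine (pow_le_pow_left₀ (hE0 _) (hδE _ hy) n).trans (le_of_eq ?_)
      have : (0 : ℝ) < n := by exact_mod_cast hn
      rw [← Real.exp_nat_mul, add_sub_cancel_left, mul_pow, inv_pow, Real.sq_sqrt this.le]
      congr 1
      field_simp
    · rw [Set.indicator_of_notMem hy, norm_zero]
      positivity
  · exact (integrable_exp_neg_mul_sq (by positivity)).const_mul B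
  · refine Eventually.of_forall fun y => ?_
    refine ((hk y).mul (h.tendsto_pow y)).congr' ?_
    filter_upwards [(tendsto_add_inv_sqrt_mul ζ y).eventually (Metric.ball_mem_nhds ζ hδ)]
      with n hn
    rw [Set.indicator_of_mem (Metric.mem_ball.2 hn)]

/-- Laplace's method for a bounded family of integrands, up to `o(1)`. -/
theorem tendsto_laplace {E : ℝ → ℝ} {Z : Finset ℝ} {κ : ℝ → ℝ} {H : ℕ → ℝ → ℝ} {c : ℕ → ℝ → ℝ}
    {G : ℝ → ℝ} {n₀ : ℕ} {B : ℝ} (hZ : ∀ ζ ∈ Z, 0 < ζ) (hκ : ∀ ζ ∈ Z, 0 < κ ζ)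
    (hE : Measurable E) (hE0 : ∀ r, 0 ≤ E r) (hpeak : ∀ ζ ∈ Z, HasGaussianPeak E ζ (κ ζ))
    (hoff : ∀ δ > 0, ∃ η < 1, ∀ r > 0, (∀ ζ ∈ Z, r ∉ Metric.ball ζ δ) → E r ≤ η)
    (hH : ∀ n, Measurable (H n)) (hG : IntegrableOn G (Set.Ioi 0))
    (hHG : ∀ n, ∀ r > 0, |H n r| * E r ^ n₀ ≤ G r)
    (hE1 : ∀ r > 0, E r ≤ 1)
    (hc : ∀ n, ∀ ζ ∈ Z, |c n ζ| ≤ B)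
    (hHc : ∀ ζ ∈ Z, ∀ y, Tendsto (fun n : ℕ => H n (ζ + (√(n : ℝ))⁻¹ * y) - c n ζ) atTop (𝓝 0))
    (hHB : ∀ ζ ∈ Z, ∀ᶠ r in 𝓝 ζ, ∀ n, |H n r| ≤ B) :
    Tendsto (fun n : ℕ => √(n : ℝ) * (∫ r in Set.Ioi 0, H n r * E r ^ n) -
      ∑ ζ ∈ Z, c n ζ * √(2 * Real.pi / κ ζ)) atTop (𝓝 0) := by
  obtain ⟨δ, hδ, hδE, hδB, hδ0, hdisj⟩ : ∃ δ > 0,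
      (∀ ζ ∈ Z, ∀ r ∈ Metric.ball ζ δ, E r ≤ Real.exp (-(κ ζ / 4) * (r - ζ) ^ 2)) ∧
      (∀ ζ ∈ Z, ∀ r ∈ Metric.ball ζ δ, ∀ n, |H n r| ≤ B) ∧
      (∀ ζ ∈ Z, Metric.ball ζ δ ⊆ Set.Ioi 0) ∧
      (∀ ζ ∈ Z, ∀ ξ ∈ Z, ζ ≠ ξ → Disjoint (Metric.ball ζ δ) (Metric.ball ξ δ)) := by
    have key : ∀ᶠ δ in 𝓝[>] (0 : ℝ), 
        (∀ ζ ∈ Z, ∀ r ∈ Metric.ball ζ δ, E r ≤ Real.exp (-(κ ζ / 4) * (r - ζ) ^ 2)) ∧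
        (∀ ζ ∈ Z, ∀ r ∈ Metric.ball ζ δ, ∀ n, |H n r| ≤ B) ∧
        (∀ ζ ∈ Z, Metric.ball ζ δ ⊆ Set.Ioi 0) ∧
        (∀ ζ ∈ Z, ∀ ξ ∈ Z, ζ ≠ ξ → Disjoint (Metric.ball ζ δ) (Metric.ball ξ δ)) := by
      refine Filter.Eventually.and ?_ (Filter.Eventually.and ?_ (Filter.Eventually.and ?_ ?_))
      · refine (Filter.eventually_all_finset Z).2 fun ζ hζ => ?_
        obtain ⟨δ, hδ, h⟩ := (hpeak ζ hζ).exists_le (hκ ζ hζ)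
        filter_upwards [Ioo_mem_nhdsGT hδ] with δ' hδ' r hr
        exact h r (Metric.ball_subset_ball hδ'.2.le hr)
      · refine (Filter.eventually_all_finset Z).2 fun ζ hζ => ?_
        obtain ⟨δ, hδ, h⟩ := Metric.eventually_nhds_iff_ball.1 (hHB ζ hζ)
        filter_upwards [Ioo_mem_nhdsGT hδ] with δ' hδ' r hr
        exact h r (Metric.ball_subset_ball hδ'.2.le hr)
      · refine (Filter.eventually_all_finset Z).2 fun ζ hζ => ?_
        obtain ⟨δ, hδ, h⟩ := Metric.eventually_nhds_iff_ball.1 (lt_mem_nhds (hZ ζ hζ))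
        filter_upwards [Ioo_mem_nhdsGT hδ] with δ' hδ' r hr
        exact h r (Metric.ball_subset_ball hδ'.2.le hr)
      · refine (Filter.eventually_all_finset Z).2 fun ζ _ => ?_
        refine (Filter.eventually_all_finset Z).2 fun ξ _ => ?_
        by_cases hne : ζ = ξ
        · exact Eventually.of_forall fun _ h => absurd hne h
        · have hd : 0 < dist ζ ξ / 2 := half_pos (dist_pos.2 hne)
          filter_upwards [Ioo_mem_nhdsGT hd] with δ' hδ' _
          exact Metric.ball_disjoint_ball (by linarith [hδ'.2])
    obtain ⟨δ, h1, h2⟩ := (key.and self_mem_nhdsWithin).exists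
    exact ⟨δ, h2, h1⟩
  obtain ⟨η, hη1, hη⟩ := hoff δ hδ
  set U : Set ℝ := ⋃ ζ ∈ Z, Metric.ball ζ δ with hU
  have hUm : MeasurableSet U := Finset.measurableSet_biUnion _ fun _ _ =>
    Metric.isOpen_ball.measurableSet
  have hU0 : U ⊆ Set.Ioi 0 := Set.iUnion₂_subset hδ0
  have hbound : ∀ n, n₀ ≤ n → ∀ r > 0, |H n r * E r ^ n| ≤ G r := fun n hn r hr => by
    rw [abs_mul, abs_of_nonneg (pow_nonneg (hE0 r) n)]
    refine le_trans ?_ (hHG n r hr)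
    exact mul_le_mul_of_nonneg_left (pow_le_pow_of_le_one (hE0 r) (hE1 r hr) hn) (abs_nonneg _)
  have hmeas : ∀ n, Measurable fun r => H n r * E r ^ n := fun n => (hH n).mul (hE.pow_const n)
  have hint : ∀ n, n₀ ≤ n → IntegrableOn (fun r => H n r * E r ^ n) (Set.Ioi 0) := fun n hn =>
    Integrable.mono' hG (hmeas n).aestronglyMeasurable
      ((ae_restrict_iff' measurableSet_Ioi).2 (Eventually.of_forall fun r hr => hbound n hn r hr))
  have hrest : Tendsto (fun n : ℕ => √(n : ℝ) * ∫ r in Set.Ioi 0 \ U, H n r * E r ^ n) atTop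
      (𝓝 0) := by
    -- The maximum with 1/2 makes the base positive, so that it can be inverted. Of the n factors of
    -- `E`, n₀ secure integrability through `G`, and the other n - n₀ give exponential decay, which
    -- beats √n.
    set η' : ℝ := max η (1 / 2) with hη'
    have hη'0 : 0 < η' := lt_max_of_lt_right (by norm_num)
    have hη'1 : η' < 1 := max_lt hη1 (by norm_num)
    have hlim : Tendsto (fun n : ℕ => η'⁻¹ ^ n₀ * (∫ r in Set.Ioi 0, G r) * ((n : ℝ) * η' ^ n)) atTop
        (𝓝 0) := by
      have := (tendsto_self_mul_const_pow_of_lt_one hη'0.le hη'1).const_mul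
        (η'⁻¹ ^ n₀ * (∫ r in Set.Ioi 0, G r))
      rwa [mul_zero] at this
    have hG0 : ∀ r > 0, 0 ≤ G r := fun r hr =>
      le_trans (mul_nonneg (abs_nonneg _) (pow_nonneg (hE0 r) _)) (hHG 0 r hr)
    refine squeeze_zero_norm' ?_ hlim
    filter_upwards [eventually_ge_atTop (max n₀ 1)] with n hn
    have hn0 : n₀ ≤ n := (le_max_left _ _).trans hn
    have hn1 : (1 : ℝ) ≤ n := by exact_mod_cast (le_max_right _ _).trans hn
    have hsqrt : √(n : ℝ) ≤ n := Real.sqrt_le_iff.2 ⟨by linarith, by nlinarith⟩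
    have h1 : ‖∫ r in Set.Ioi 0 \ U, H n r * E r ^ n‖ ≤ ∫ r in Set.Ioi 0 \ U, η' ^ (n - n₀) * G r := by
      refine norm_integral_le_of_norm_le ((hG.mono_set Set.sdiff_subset).const_mul _) ?_
      refine (ae_restrict_iff' (measurableSet_Ioi.diff hUm)).2 (Eventually.of_forall fun r hr => ?_)
      have hr0 : (0 : ℝ) < r := hr.1
      have hEη : E r ≤ η' := (hη r hr0 fun ζ hζ hmem => hr.2 (Set.mem_biUnion hζ hmem)).trans
        (le_max_left _ _)
      rw [Real.norm_eq_abs, abs_mul, abs_of_nonneg (pow_nonneg (hE0 r) n),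
        ← Nat.sub_add_cancel hn0, pow_add, Nat.sub_add_cancel hn0, mul_left_comm]
      exact mul_le_mul (pow_le_pow_left₀ (hE0 r) hEη _) (hHG n r hr0)
        (mul_nonneg (abs_nonneg _) (pow_nonneg (hE0 r) _)) (by positivity)
    have h2 : ∫ r in Set.Ioi 0 \ U, η' ^ (n - n₀) * G r ≤ η' ^ (n - n₀) * ∫ r in Set.Ioi 0, G r := by
      rw [integral_const_mul]
      refine mul_le_mul_of_nonneg_left ?_ (by positivity)
      exact setIntegral_mono_set hG ((ae_restrict_iff' measurableSet_Ioi).2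
        (Eventually.of_forall hG0)) Set.sdiff_subset.eventuallyLE
    have hI0 : 0 ≤ ∫ r in Set.Ioi 0, G r := setIntegral_nonneg measurableSet_Ioi hG0
    rw [norm_mul, Real.norm_of_nonneg (Real.sqrt_nonneg _)]
    calc √(n : ℝ) * ‖∫ r in Set.Ioi 0 \ U, H n r * E r ^ n‖
        ≤ n * (η' ^ (n - n₀) * ∫ r in Set.Ioi 0, G r) := by
          gcongr
          exact h1.trans h2
      _ = _ := by
          rw [pow_sub₀ _ hη'0.ne' hn0, inv_pow]
          ring
  -- The coefficients `c n ζ` are bounded but need not converge. The local limit is therefore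
  -- applied to `H n - c n ζ`, with limit 0, and to the constant 1, then multiplied by the bounded
  -- factor.
  have hloc : ∀ ζ ∈ Z, Tendsto (fun n : ℕ => √(n : ℝ) * (∫ r in Metric.ball ζ δ, H n r * E r ^ n) -
      c n ζ * √(2 * Real.pi / κ ζ)) atTop (𝓝 0) := fun ζ hζ => by
    have h1 := (hpeak ζ hζ).tendsto_integral (hκ ζ hζ) hE hE0 hδ (hδE ζ hζ)
      (K := fun n r => H n r - c n ζ) (B := B + B) (fun n => (hH n).sub_const _)
      (fun n r hr => (abs_sub _ _).trans (add_le_add (hδB ζ hζ r hr n) (hc n ζ hζ))) (hHc ζ hζ)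
    have h2 := (hpeak ζ hζ).tendsto_integral (hκ ζ hζ) hE hE0 hδ (hδE ζ hζ)
      (K := fun _ _ => 1) (B := 1) (k := 1) (fun n => measurable_const)
      (fun n r hr => by simp) (fun y => tendsto_const_nhds)
    have h3 : Tendsto (fun n : ℕ => c n ζ * (√(n : ℝ) * (∫ r in Metric.ball ζ δ, 1 * E r ^ n) -
        1 * √(2 * Real.pi / κ ζ))) atTop (𝓝 0) := by
      have h4 := h2.sub_const (1 * √(2 * Real.pi / κ ζ))
      rw [sub_self] at h4
      refine bdd_le_mul_tendsto_zero' B (Eventually.of_forall fun n => ?_) h4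
      exact hc n ζ hζ
    have h5 := h1.add h3
    rw [zero_mul, add_zero] at h5
    refine h5.congr' ?_
    filter_upwards [eventually_ge_atTop n₀] with n hn
    have hi1 : IntegrableOn (fun r => H n r * E r ^ n) (Metric.ball ζ δ) :=
      (hint n hn).mono_set (hδ0 ζ hζ)
    have hi2 : IntegrableOn (fun r => E r ^ n) (Metric.ball ζ δ) := by
      refine Measure.integrableOn_of_bounded (M := 1) measure_ball_lt_top.ne
        (hE.pow_const n).aestronglyMeasurable ?_
      refine (ae_restrict_iff' Metric.isOpen_ball.measurableSet).2
        (Eventually.of_forall fun r hr => ?_)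
      rw [Real.norm_of_nonneg (pow_nonneg (hE0 r) n)]
      exact pow_le_one₀ (hE0 r) (hE1 r (hδ0 ζ hζ hr))
    simp only [sub_mul, one_mul]
    rw [integral_sub hi1 (hi2.const_mul _), integral_const_mul]
    ring
  have hsum := (tendsto_finsetSum Z hloc).add hrest
  simp only [Finset.sum_const_zero, add_zero] at hsum
  refine hsum.congr' ?_
  filter_upwards [eventually_ge_atTop n₀] with n hn
  have h1 : ∫ r in U, H n r * E r ^ n = ∑ ζ ∈ Z, ∫ r in Metric.ball ζ δ, H n r * E r ^ n :=
    integral_biUnion_finset Z (fun _ _ => Metric.isOpen_ball.measurableSet)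
      (fun ζ hζ ξ hξ hne => hdisj ζ hζ ξ hξ hne) fun ζ hζ => (hint n hn).mono_set (hδ0 ζ hζ)
  have h2 : ∫ r in Set.Ioi 0, H n r * E r ^ n =
      (∫ r in U, H n r * E r ^ n) + ∫ r in Set.Ioi 0 \ U, H n r * E r ^ n := by
    rw [← setIntegral_union Set.disjoint_sdiff_right (measurableSet_Ioi.diff hUm)
      ((hint n hn).mono_set hU0) ((hint n hn).mono_set Set.sdiff_subset),
      Set.union_sdiff_cancel hU0]
  rw [h2, h1, Finset.sum_sub_distrib, mul_add, Finset.mul_sum]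
  ring

/-! ### The radial Boltzmann factor relative to the common tangent -/

/-- The common tangent of the potential, as a function of `log r`. -/
noncomputable def tangent (Q : ℂ → EReal) (b₀ r : ℝ) : ℝ :=
  profile Q b₀ + logSlope Q b₀ * (Real.log r - Real.log b₀)

/-- The Boltzmann factor relative to the common tangent. -/
noncomputable def relBoltz (Q : ℂ → EReal) (b₀ r : ℝ) : ℝ :=
  boltz Q r * Real.exp (tangent Q b₀ r)

/-- The radii at which the potential touches its common tangent. -/
noncomputable def peaks (m : ℕ) (b₀ a₁ : ℝ) (t : ℕ → ℝ) : Finset ℝ :=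
  insert b₀ (insert a₁ ((Finset.Icc 1 m).image t))

theorem relBoltz_nonneg (Q : ℂ → EReal) (b₀ r : ℝ) : 0 ≤ relBoltz Q b₀ r :=
  mul_nonneg (boltz_nonneg _ _) (Real.exp_pos _).le

theorem IsPotential.measurable_relBoltz {Q : ℂ → EReal} (hQ : IsPotential Q) (b₀ : ℝ) :
    Measurable (relBoltz Q b₀) := by
  have := hQ.measurable_boltz
  unfold relBoltz tangent
  fun_prop

theorem IsPotential.relBoltz_le {Q : ℂ → EReal} (hQ : IsPotential Q) {b₀ r x : ℝ}
    (h : (x : EReal) ≤ Q r) : relBoltz Q b₀ r ≤ Real.exp (tangent Q b₀ r - x) := by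
  refine (mul_le_mul_of_nonneg_right (hQ.boltz_le h) (Real.exp_pos _).le).trans (le_of_eq ?_)
  rw [← Real.exp_add]
  congr 1; ring

theorem mem_peaks {m : ℕ} {b₀ a₁ r : ℝ} {t : ℕ → ℝ} :
    r ∈ peaks m b₀ a₁ t ↔ r = b₀ ∨ r = a₁ ∨ ∃ k ∈ Finset.Icc 1 m, r = t k := by
  simp only [peaks, Finset.mem_insert, Finset.mem_image, eq_comm]

namespace IsTwoComponent

variable {Q : ℂ → EReal} {m : ℕ} {a₀ b₀ a₁ b₁ : ℝ} {t : ℕ → ℝ}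

theorem peak_pos (h : IsTwoComponent Q m a₀ b₀ a₁ b₁ t) {ζ : ℝ} (hζ : ζ ∈ peaks m b₀ a₁ t) :
    0 < ζ := by
  rcases mem_peaks.1 hζ with rfl | rfl | ⟨k, hk, rfl⟩
  · exact h.b₀_pos
  · exact h.a₁_pos
  · exact h.t_pos hk

theorem peak_mem (h : IsTwoComponent Q m a₀ b₀ a₁ b₁ t) {ζ : ℝ} (hζ : ζ ∈ peaks m b₀ a₁ t) :
    (ζ : ℂ) ∈ coincidenceSet Q := by
  rcases mem_peaks.1 hζ with rfl | rfl | ⟨k, hk, rfl⟩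
  · exact h.b₀_mem
  · exact h.a₁_mem
  · exact h.t_mem hk

theorem logSlope_peak (h : IsTwoComponent Q m a₀ b₀ a₁ b₁ t) {ζ : ℝ}
    (hζ : ζ ∈ peaks m b₀ a₁ t) : logSlope Q ζ = logSlope Q b₀ := by
  rcases mem_peaks.1 hζ with rfl | rfl | ⟨k, hk, rfl⟩
  · rfl
  · exact h.logSlope_eq
  · exact h.logSlope_t hk

theorem profile_peak (h : IsTwoComponent Q m a₀ b₀ a₁ b₁ t) {ζ : ℝ}
    (hζ : ζ ∈ peaks m b₀ a₁ t) : profile Q ζ = tangent Q b₀ ζ := by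
  rcases mem_peaks.1 hζ with rfl | rfl | ⟨k, hk, rfl⟩
  · simp [tangent]
  · exact h.profile_a₁
  · exact h.profile_t hk

theorem hasGaussianPeak (h : IsTwoComponent Q m a₀ b₀ a₁ b₁ t) {ζ : ℝ}
    (hζ : ζ ∈ peaks m b₀ a₁ t) :
    HasGaussianPeak (relBoltz Q b₀) ζ (4 * quarterLaplacian Q ζ) := by
  refine ⟨fun r => profile Q r - tangent Q b₀ r, ?_, ?_⟩
  · filter_upwards [h.eventually_eq_profile (h.peak_mem hζ)] with r hr
    rw [relBoltz, boltz_of_eq_coe hr, ← Real.exp_add]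
    congr 1; ring
  · exact h.isLittleO_tangent (h.peak_pos hζ) (h.peak_mem hζ) (h.logSlope_peak hζ)
      (h.profile_peak hζ)

theorem relBoltz_le_one (h : IsTwoComponent Q m a₀ b₀ a₁ b₁ t) {r : ℝ} (hr : 0 < r) :
    relBoltz Q b₀ r ≤ 1 := by
  have := h.pot.relBoltz_le (b₀ := b₀) (h.tangent_le hr)
  rwa [tangent, sub_self, Real.exp_zero] at this

/-- Near the origin `Q` is bounded below while the tangent falls with slope l > 0; at infinity `Q`
grows with slope 2θ > 2 > l. This gives a power decay at both ends. -/
theorem exists_relBoltz_le (h : IsTwoComponent Q m a₀ b₀ a₁ b₁ t) :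
    ∃ A : ℝ, ∃ β > 0, ∀ r > 0, relBoltz Q b₀ r ≤ Real.exp (A - β * |Real.log r|) := by
  obtain ⟨θ, hθ, C, hC⟩ := h.pot.growth
  have hl0 := h.logSlope_pos
  have hl2 := h.logSlope_lt_two
  rw [h.logSlope_eq] at hl2
  set l := logSlope Q b₀ with hl
  refine ⟨C + profile Q b₀ - l * Real.log b₀, min l (2 * θ - l), lt_min hl0 (by linarith),
    fun r hr => ?_⟩
  have h1 := h.pot.relBoltz_le (b₀ := b₀) (hC r)
  refine h1.trans (Real.exp_le_exp.2 ?_)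
  rw [Complex.norm_real, Real.norm_of_nonneg hr.le, tangent, ← hl]
  rcases le_total r 1 with h1 | h1
  · rw [max_eq_right h1, Real.log_one, abs_of_nonpos (Real.log_nonpos hr.le h1)]
    have := mul_le_mul_of_nonneg_right (min_le_left l (2 * θ - l))
      (neg_nonneg.2 (Real.log_nonpos hr.le h1))
    linarith
  · rw [max_eq_left h1, abs_of_nonneg (Real.log_nonneg h1)]
    have := mul_le_mul_of_nonneg_right (min_le_right l (2 * θ - l)) (Real.log_nonneg h1)
    linarith

/-- Far out in |log r| the decay at both ends gives e^(-1). On the remaining compact set the lower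
semicontinuous function Q - tangent attains a minimum, which is positive because all touching radii
have been removed. -/
theorem exists_relBoltz_le_off (h : IsTwoComponent Q m a₀ b₀ a₁ b₁ t) {δ : ℝ} (hδ : 0 < δ) :
    ∃ η < 1, ∀ r > 0, (∀ ζ ∈ peaks m b₀ a₁ t, r ∉ Metric.ball ζ δ) → relBoltz Q b₀ r ≤ η := by
  obtain ⟨A, β, hβ, hA⟩ := h.exists_relBoltz_le
  set R := (A + 1) / β with hR
  set K : Set ℝ := Set.Icc (Real.exp (-R)) (Real.exp R) \ ⋃ ζ ∈ peaks m b₀ a₁ t, Metric.ball ζ δ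
    with hK
  have hKc : IsCompact K := isCompact_Icc.diff
    (isOpen_biUnion fun _ _ => Metric.isOpen_ball)
  have hK0 : ∀ r ∈ K, 0 < r := fun r hr => (Real.exp_pos _).trans_le hr.1.1
  obtain ⟨d, hd, hdK⟩ : ∃ d > 0, ∀ r ∈ K, ((tangent Q b₀ r + d : ℝ) : EReal) ≤ Q r := by
    rcases K.eq_empty_or_nonempty with hKe | hKne
    · exact ⟨1, one_pos, by simp [hKe]⟩
    set F : ℝ → EReal := fun r => Q r + ((-tangent Q b₀ r : ℝ) : EReal) with hF
    have hlsc : LowerSemicontinuousOn F K := by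
      refine LowerSemicontinuousOn.add' ?_ ?_ ?_
      · exact (h.pot.lsc.comp Complex.continuous_ofReal).lowerSemicontinuousOn _
      · have : ContinuousOn (fun r : ℝ => ((-tangent Q b₀ r : ℝ) : EReal)) K := by
          refine continuous_coe_real_ereal.comp_continuousOn
            (continuousOn_const.add (continuousOn_const.mul
              ((ContinuousOn.log continuousOn_id fun x hx => ?_).sub continuousOn_const))).neg
          exact (hK0 x hx).ne'
        exact this.lowerSemicontinuousOn
      · intro x _
        exact EReal.continuousAt_add (Or.inr (EReal.coe_ne_bot _)) (Or.inl (h.pot.ne_bot _))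
    obtain ⟨x, hx, hmin⟩ := LowerSemicontinuousOn.exists_isMinOn hKne hKc hlsc
    have key : ∀ d : ℝ, (d : EReal) ≤ F x → ∀ r ∈ K, ((tangent Q b₀ r + d : ℝ) : EReal) ≤ Q r := by
      intro d hd r hr
      have h1 : (d : EReal) ≤ F r := hd.trans (hmin hr)
      by_cases htop : Q r = ⊤
      · rw [htop]; exact le_top
      obtain ⟨q, hq⟩ := EReal_eq_coe_of_ne (h.pot.ne_bot r) htop
      simp only [hF, hq] at h1
      rw [← EReal.coe_add, EReal.coe_le_coe_iff] at h1
      rw [hq, EReal.coe_le_coe_iff]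
      linarith
    by_cases htop : Q x = ⊤
    · exact ⟨1, one_pos, key 1 (by simp [hF, htop])⟩
    · obtain ⟨q, hq⟩ := EReal_eq_coe_of_ne (h.pot.ne_bot x) htop
      have hle : tangent Q b₀ x ≤ q := by
        have := h.tangent_le (hK0 x hx)
        rw [hq] at this
        exact_mod_cast this
      have hne : tangent Q b₀ x ≠ q := by
        intro heq
        have hmem := mem_peaks.2 (h.tangent_eq_imp (hK0 x hx) (hq.trans (by rw [← heq]; rfl)))
        exact hx.2 (Set.mem_biUnion hmem (Metric.mem_ball_self hδ))
      refine ⟨q - tangent Q b₀ x, sub_pos.2 (lt_of_le_of_ne hle hne), key _ ?_⟩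
      simp only [hF, hq]
      rw [← EReal.coe_add, sub_eq_add_neg]
  refine ⟨max (Real.exp (-1)) (Real.exp (-d)), max_lt (by simp) (by simpa using hd),
    fun r hr hoff => ?_⟩
  by_cases hrK : r ∈ K
  · refine le_max_of_le_right ((h.pot.relBoltz_le (hdK r hrK)).trans (le_of_eq ?_))
    congr 1; ring
  · refine le_max_of_le_left ((hA r hr).trans (Real.exp_le_exp.2 ?_))
    have hlog : R ≤ |Real.log r| := by
      by_contra! hlt
      refine hrK ⟨⟨?_, ?_⟩, fun hmem => ?_⟩
      · exact (Real.le_log_iff_exp_le hr).1 (abs_lt.1 hlt).1.le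
      · exact (Real.log_le_iff_le_exp hr).1 (abs_lt.1 hlt).2.le
      · obtain ⟨ζ, hζ, hmem⟩ := Set.mem_iUnion₂.1 hmem
        exact hoff ζ hζ hmem
    have := mul_le_mul_of_nonneg_left hlog hβ.le
    rw [hR, mul_div_cancel₀ _ hβ.ne'] at this
    linarith

theorem rpow_le_exp_abs_log {r s S : ℝ} (hr : 0 < r) (hs : |s| ≤ S) :
    r ^ s ≤ Real.exp (S * |Real.log r|) := by
  rw [Real.rpow_def_of_pos hr]
  refine Real.exp_le_exp.2 ((le_abs_self _).trans ?_)
  rw [abs_mul, mul_comm]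
  exact mul_le_mul_of_nonneg_right hs (abs_nonneg _)

theorem exp_neg_two_abs_log_le {r : ℝ} (hr : 0 < r) :
    Real.exp (-2 * |Real.log r|) ≤ 2 * (1 + r ^ 2)⁻¹ := by
  have h2 : Real.exp (2 * Real.log r) = r ^ 2 := by
    rw [two_mul, Real.exp_add, Real.exp_log hr, sq]
  rw [← div_eq_mul_inv, le_div_iff₀ (by positivity)]
  rcases le_total r 1 with h1 | h1
  · rw [abs_of_nonpos (Real.log_nonpos hr.le h1), neg_mul_neg, h2]
    have : r ^ 2 ≤ 1 := pow_le_one₀ hr.le h1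
    nlinarith
  · rw [abs_of_nonneg (Real.log_nonneg h1), neg_mul, Real.exp_neg, h2]
    have : 1 ≤ r ^ 2 := one_le_pow₀ h1
    rw [inv_mul_le_iff₀ (by positivity)]
    linarith

/-- Weight of the peak `ζ` for the exponent `s`. -/
noncomputable def _root_.CoulombGas.peakWeight (Q : ℂ → EReal) (s ζ : ℝ) : ℝ :=
  ζ ^ s * √(2 * Real.pi / (4 * quarterLaplacian Q ζ))

theorem laplacian_pos (h : IsTwoComponent Q m a₀ b₀ a₁ b₁ t) {ζ : ℝ}
    (hζ : ζ ∈ peaks m b₀ a₁ t) : 0 < quarterLaplacian Q ζ := h.pos _ (h.peak_mem hζ)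

theorem peakWeight_pos (h : IsTwoComponent Q m a₀ b₀ a₁ b₁ t) {s ζ : ℝ}
    (hζ : ζ ∈ peaks m b₀ a₁ t) : 0 < peakWeight Q s ζ := by
  have := h.laplacian_pos hζ
  have := h.peak_pos hζ
  unfold peakWeight
  positivity

/-- The exponents `s n` stay bounded but oscillate with the fractional part of M₀n, so the assertion
is about a difference, not a limit. -/
theorem tendsto_radial_integral (h : IsTwoComponent Q m a₀ b₀ a₁ b₁ t) {f : ℝ → ℝ}
    (hf : Measurable f) (hf1 : ∀ r, |f r| ≤ 1)
    (hfc : ∀ ζ ∈ peaks m b₀ a₁ t, ContinuousAt f ζ) {s : ℕ → ℝ} {S : ℝ} (hs : ∀ n, |s n| ≤ S) :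
    Tendsto (fun n : ℕ => √(n : ℝ) * (∫ r in Set.Ioi 0, f r * r ^ s n * relBoltz Q b₀ r ^ n) -
      ∑ ζ ∈ peaks m b₀ a₁ t, f ζ * peakWeight Q (s n) ζ) atTop (𝓝 0) := by
  obtain ⟨A, β, hβ, hA⟩ := h.exists_relBoltz_le
  have hS0 : 0 ≤ S := (abs_nonneg _).trans (hs 0)
  -- Since n₀β ≥ S + 2, the n₀ spare Boltzmann factors absorb r^(s n) and leave e^(-2|log r|), which
  -- is integrable on the half-line.
  obtain ⟨n₀, hn₀⟩ := exists_nat_ge ((S + 2) / β)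
  rw [div_le_iff₀ hβ] at hn₀
  set B : ℝ := ∑ ζ ∈ peaks m b₀ a₁ t, Real.exp (S * (|Real.log ζ| + 1)) with hB
  have hBle : ∀ ζ ∈ peaks m b₀ a₁ t, Real.exp (S * (|Real.log ζ| + 1)) ≤ B := fun ζ hζ =>
    Finset.single_le_sum (f := fun ζ => Real.exp (S * (|Real.log ζ| + 1)))
      (fun _ _ => (Real.exp_pos _).le) hζ
  have hbd : ∀ r > 0, ∀ n, |f r * r ^ s n| ≤ Real.exp (S * |Real.log r|) := fun r hr n => by
    rw [abs_mul, abs_of_pos (Real.rpow_pos_of_pos hr _)]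
    exact (mul_le_of_le_one_left (Real.rpow_pos_of_pos hr _).le (hf1 r)).trans
      (rpow_le_exp_abs_log hr (hs n))
  have main := tendsto_laplace (E := relBoltz Q b₀) (Z := peaks m b₀ a₁ t)
    (κ := fun ζ => 4 * quarterLaplacian Q ζ) (H := fun n r => f r * r ^ s n)
    (c := fun n ζ => f ζ * ζ ^ s n) (G := fun r => Real.exp (n₀ * A) * (2 * (1 + r ^ 2)⁻¹))
    (n₀ := n₀) (B := B) (fun ζ hζ => h.peak_pos hζ)
    (fun ζ hζ => by have := h.laplacian_pos hζ; positivity)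
    (h.pot.measurable_relBoltz b₀) (relBoltz_nonneg Q b₀) (fun ζ hζ => h.hasGaussianPeak hζ)
    (fun δ hδ => h.exists_relBoltz_le_off hδ) (fun n => by fun_prop)
    ((integrable_inv_one_add_sq.const_mul 2).const_mul _).integrableOn ?_
    (fun r hr => h.relBoltz_le_one hr) ?_ ?_ ?_
  · simpa only [peakWeight, mul_assoc] using main
  · intro n r hr
    calc |f r * r ^ s n| * relBoltz Q b₀ r ^ n₀
        ≤ Real.exp (S * |Real.log r|) * Real.exp (A - β * |Real.log r|) ^ n₀ :=
          mul_le_mul (hbd r hr n) (pow_le_pow_left₀ (relBoltz_nonneg _ _ _) (hA r hr) _)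
            (pow_nonneg (relBoltz_nonneg _ _ _) _) (Real.exp_pos _).le
      _ = Real.exp (S * |Real.log r| + n₀ * (A - β * |Real.log r|)) := by
          rw [← Real.exp_nat_mul, ← Real.exp_add]
      _ ≤ Real.exp (n₀ * A + -2 * |Real.log r|) := by
          refine Real.exp_le_exp.2 ?_
          have := mul_le_mul_of_nonneg_right hn₀ (abs_nonneg (Real.log r))
          linarith
      _ ≤ _ := by
          rw [Real.exp_add]
          exact mul_le_mul_of_nonneg_left (exp_neg_two_abs_log_le hr) (Real.exp_pos _).le
  · intro n ζ hζ
    refine (hbd ζ (h.peak_pos hζ) n).trans (le_trans ?_ (hBle ζ hζ))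
    exact Real.exp_le_exp.2 (mul_le_mul_of_nonneg_left (by linarith) hS0)
  · intro ζ hζ y
    have hζ0 := h.peak_pos hζ
    have hlim := tendsto_add_inv_sqrt_mul ζ y
    have hlog : Tendsto (fun n : ℕ => Real.log (ζ + (√(n : ℝ))⁻¹ * y) - Real.log ζ) atTop
        (𝓝 0) := by
      have := ((Real.continuousAt_log hζ0.ne').tendsto.comp hlim).sub_const (Real.log ζ)
      rwa [sub_self] at this
    -- (r/ζ)^(s n) tends to 1 along r = ζ + y/√n because the exponents are bounded.
    have hslog : Tendsto (fun n : ℕ => s n * (Real.log (ζ + (√(n : ℝ))⁻¹ * y) - Real.log ζ)) atTop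
        (𝓝 0) := bdd_le_mul_tendsto_zero' S (Eventually.of_forall hs) hlog
    have hexp := (Real.continuous_exp.tendsto 0).comp hslog
    rw [Real.exp_zero] at hexp
    have hfl := ((hfc ζ hζ).tendsto.comp hlim).mul hexp
    have h2 := hfl.sub_const (f ζ * 1)
    rw [sub_self] at h2
    have h3 := bdd_le_mul_tendsto_zero' (f := fun n => ζ ^ s n) (Real.exp (S * |Real.log ζ|))
      (Eventually.of_forall fun n => by
        rw [abs_of_pos (Real.rpow_pos_of_pos hζ0 _)]
        exact rpow_le_exp_abs_log hζ0 (hs n)) h2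
    refine h3.congr' ?_
    filter_upwards [hlim.eventually (lt_mem_nhds hζ0)] with n hn
    simp only [Function.comp_apply]
    rw [Real.rpow_def_of_pos hn, Real.rpow_def_of_pos hζ0]
    have : Real.exp (Real.log (ζ + (√(n : ℝ))⁻¹ * y) * s n) = Real.exp (Real.log ζ * s n) *
        Real.exp (s n * (Real.log (ζ + (√(n : ℝ))⁻¹ * y) - Real.log ζ)) := by
      rw [← Real.exp_add]; congr 1; ring
    rw [this]
    ring
  · intro ζ hζ
    have hζ0 := h.peak_pos hζ
    have hev : ∀ᶠ r in 𝓝 ζ, |Real.log r| < |Real.log ζ| + 1 :=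
      ((Real.continuousAt_log hζ0.ne').abs.tendsto).eventually (gt_mem_nhds (by linarith))
    filter_upwards [hev, lt_mem_nhds hζ0] with r hr hr0 n
    refine (hbd r hr0 n).trans (le_trans ?_ (hBle ζ hζ))
    exact Real.exp_le_exp.2 (mul_le_mul_of_nonneg_left hr.le hS0)

end IsTwoComponent

/-! ### Asymptotics of the levels -/

theorem IsPotential.integrable_moment {Q : ℂ → EReal} (hQ : IsPotential Q) {n k : ℕ} (hk : k < n)
    {f : ℝ → ℝ} (hf : Measurable f) (hf1 : ∀ r, |f r| ≤ 1) :
    Integrable (fun z : ℂ => f ‖z‖ * ‖z‖ ^ (2 * k) * boltz Q z ^ n) areaMeasure := by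
  have hmeas := hQ.measurable_boltz
  refine (hQ.integrable_pow_mul_boltz (n := n) (a := 2 * k) (by omega)).mono'
    (Measurable.aestronglyMeasurable (by fun_prop)) (Eventually.of_forall fun z => ?_)
  have h2 := pow_nonneg (boltz_nonneg Q z) n
  rw [mul_assoc, Real.norm_eq_abs, abs_mul,
    abs_of_nonneg (mul_nonneg (pow_nonneg (norm_nonneg z) (2 * k)) h2)]
  exact mul_le_of_le_one_left (by positivity) (hf1 _)

theorem moment_nonneg {Q : ℂ → EReal} {n k : ℕ} {f : ℝ → ℝ} (hf0 : ∀ r, 0 ≤ f r) :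
    0 ≤ moment Q n f k :=
  integral_nonneg fun z => mul_nonneg (mul_nonneg (hf0 _) (by positivity))
    (pow_nonneg (boltz_nonneg Q z) n)

theorem IsPotential.moment_mono {Q : ℂ → EReal} (hQ : IsPotential Q) {n k : ℕ} (hk : k < n)
    {f g : ℝ → ℝ} (hf : Measurable f) (hf1 : ∀ r, |f r| ≤ 1) (hg : Measurable g)
    (hg1 : ∀ r, |g r| ≤ 1) (hfg : ∀ r, f r ≤ g r) : moment Q n f k ≤ moment Q n g k := by
  refine integral_mono (hQ.integrable_moment hk hf hf1) (hQ.integrable_moment hk hg hg1)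
    fun z => ?_
  have h2 := pow_nonneg (boltz_nonneg Q z) n
  have := hfg ‖z‖
  simp only
  gcongr

theorem IsPotential.level_mem_Icc {Q : ℂ → EReal} (hQ : IsPotential Q) {n k : ℕ} (hk : k < n)
    {f : ℝ → ℝ} (hf : Measurable f) (hf0 : ∀ r, 0 ≤ f r) (hf1 : ∀ r, f r ≤ 1) :
    level Q n f k ∈ Set.Icc (0 : ℝ) 1 := by
  refine ⟨div_nonneg (moment_nonneg hf0)
    (moment_nonneg fun _ => zero_le_one), div_le_one_of_le₀ ?_
    (moment_nonneg fun _ => zero_le_one)⟩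
  exact hQ.moment_mono hk hf (fun r => abs_le.2 ⟨by linarith [hf0 r], hf1 r⟩) measurable_const
    (by simp) hf1

/-- Raising the exponent of the moment of a function supported in `r ≤ R`. -/
theorem IsPotential.moment_add_le {Q : ℂ → EReal} (hQ : IsPotential Q) {n k j : ℕ}
    (hk : k + j < n) {f : ℝ → ℝ} (hf : Measurable f) (hf0 : ∀ r, 0 ≤ f r) (hf1 : ∀ r, f r ≤ 1)
    {R : ℝ} (hR : ∀ r, R < r → f r = 0) :
    moment Q n f (k + j) ≤ R ^ (2 * j) * moment Q n f k := by
  have hf1' : ∀ r, |f r| ≤ 1 := fun r => abs_le.2 ⟨by linarith [hf0 r], hf1 r⟩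
  rw [moment, moment, ← integral_const_mul]
  refine integral_mono (hQ.integrable_moment hk hf hf1')
    ((hQ.integrable_moment (by omega) hf hf1').const_mul _) fun z => ?_
  have h2 := pow_nonneg (boltz_nonneg Q z) n
  have h3 := hf0 ‖z‖
  simp only
  by_cases hz : R < ‖z‖
  · simp [hR _ hz]
  · calc f ‖z‖ * ‖z‖ ^ (2 * (k + j)) * boltz Q z ^ n
        = ‖z‖ ^ (2 * j) * (f ‖z‖ * ‖z‖ ^ (2 * k) * boltz Q z ^ n) := by ring
      _ ≤ _ := by
        have : ‖z‖ ^ (2 * j) ≤ R ^ (2 * j) := pow_le_pow_left₀ (norm_nonneg _) (not_lt.1 hz) _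
        gcongr

/-- Raising the exponent of the moment of a function supported in `R ≤ r`. -/
theorem IsPotential.le_moment_add {Q : ℂ → EReal} (hQ : IsPotential Q) {n k j : ℕ}
    (hk : k + j < n) {f : ℝ → ℝ} (hf : Measurable f) (hf0 : ∀ r, 0 ≤ f r) (hf1 : ∀ r, f r ≤ 1)
    {R : ℝ} (hR0 : 0 ≤ R) (hR : ∀ r, r < R → f r = 0) :
    R ^ (2 * j) * moment Q n f k ≤ moment Q n f (k + j) := by
  have hf1' : ∀ r, |f r| ≤ 1 := fun r => abs_le.2 ⟨by linarith [hf0 r], hf1 r⟩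
  rw [moment, moment, ← integral_const_mul]
  refine integral_mono ((hQ.integrable_moment (by omega) hf hf1').const_mul _)
    (hQ.integrable_moment hk hf hf1') fun z => ?_
  have h2 := pow_nonneg (boltz_nonneg Q z) n
  have h3 := hf0 ‖z‖
  simp only
  by_cases hz : ‖z‖ < R
  · simp [hR _ hz]
  · calc _ ≤ ‖z‖ ^ (2 * j) * (f ‖z‖ * ‖z‖ ^ (2 * k) * boltz Q z ^ n) := by
          have : R ^ (2 * j) ≤ ‖z‖ ^ (2 * j) := pow_le_pow_left₀ hR0 (not_lt.1 hz) _
          gcongr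
      _ = _ := by ring

namespace IsTwoComponent

variable {Q : ℂ → EReal} {m : ℕ} {a₀ b₀ a₁ b₁ : ℝ} {t : ℕ → ℝ}

theorem moment_one_pos (h : IsTwoComponent Q m a₀ b₀ a₁ b₁ t) {n k : ℕ} (hk : k < n) :
    0 < moment Q n (fun _ => 1) k := by
  refine (integral_pos_iff_support_of_nonneg (fun z => ?_)
    (h.pot.integrable_moment hk measurable_const (by simp))).2 ?_
  · exact mul_nonneg (by positivity) (pow_nonneg (boltz_nonneg Q z) n)
  obtain ⟨U, hU, hAU, ht, -⟩ := h.smooth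
  have hV : IsOpen (U ∩ {0}ᶜ) := hU.inter isOpen_compl_singleton
  refine (hV.measure_pos areaMeasure ⟨(b₀ : ℂ), hAU h.b₀_mem, ?_⟩).trans_le
    (measure_mono fun z hz => ?_)
  · simpa using h.b₀_pos.ne'
  · obtain ⟨a, ha⟩ := EReal_eq_coe_of_ne (h.pot.ne_bot z) (ht z hz.1)
    have h0 : z ≠ 0 := hz.2
    rw [Function.mem_support, boltz_of_eq_coe ha]
    have : ‖z‖ ≠ 0 := norm_ne_zero_iff.2 h0
    positivity

/-- Polar coordinates give r^(2k+1), and the tangent contributes the power r^(-ln), with l its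
slope. The prefactor depends on neither `f` nor `k`, so it cancels in `level`. -/
theorem moment_eq (h : IsTwoComponent Q m a₀ b₀ a₁ b₁ t) (n k : ℕ) (f : ℝ → ℝ) :
    moment Q n f k = 2 * Real.exp (-(n * (profile Q b₀ - logSlope Q b₀ * Real.log b₀))) *
      ∫ r in Set.Ioi 0, f r * r ^ (2 * (k : ℝ) + 1 - logSlope Q b₀ * n) * relBoltz Q b₀ r ^ n := by
  have h1 : moment Q n f k =
      ∫ z, (fun r : ℝ => f r * r ^ (2 * k) * boltz Q r ^ n) ‖z‖ ∂areaMeasure := by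
    rw [moment]
    refine integral_congr_ae (Eventually.of_forall fun z => ?_)
    simp only
    rw [h.pot.boltz_norm z]
  rw [h1.trans (integral_area_norm fun r : ℝ => f r * r ^ (2 * k) * boltz Q r ^ n), mul_assoc 2]
  refine congrArg (2 * ·) ?_
  rw [← integral_const_mul]
  refine setIntegral_congr_fun measurableSet_Ioi fun r hr => ?_
  have hr0 : (0 : ℝ) < r := hr
  rw [relBoltz, mul_pow, ← Real.exp_nat_mul, tangent, Real.rpow_def_of_pos hr0]
  have h2 : r * r ^ (2 * k) = Real.exp (Real.log r * (2 * k + 1)) := by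
    rw [← pow_succ', ← Real.rpow_natCast, Real.rpow_def_of_pos hr0]
    push_cast
    rfl
  have h3 : Real.exp (Real.log r * (2 * k + 1)) =
      Real.exp (-(n * (profile Q b₀ - logSlope Q b₀ * Real.log b₀))) *
      (Real.exp (Real.log r * (2 * k + 1 - logSlope Q b₀ * n)) *
      Real.exp (n * (profile Q b₀ + logSlope Q b₀ * (Real.log r - Real.log b₀)))) := by
    rw [← Real.exp_add, ← Real.exp_add]
    congr 1; ring
  linear_combination f r * boltz Q r ^ n * (h2.trans h3)

/-- Limiting mean of `f` over the peaks, for the exponent `s`. -/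
noncomputable def _root_.CoulombGas.peakMean (Q : ℂ → EReal) (m : ℕ) (b₀ a₁ : ℝ) (t : ℕ → ℝ)
    (f : ℝ → ℝ) (s : ℝ) : ℝ :=
  (∑ ζ ∈ peaks m b₀ a₁ t, f ζ * peakWeight Q s ζ) / ∑ ζ ∈ peaks m b₀ a₁ t, peakWeight Q s ζ

theorem _root_.CoulombGas.tendsto_div_sub_div {u v a b : ℕ → ℝ} {B β : ℝ} (hβ : 0 < β)
    (hu : Tendsto (fun n => u n - a n) atTop (𝓝 0)) (hv : Tendsto (fun n => v n - b n) atTop (𝓝 0))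
    (ha : ∀ n, |a n| ≤ B * b n) (hb : ∀ n, β ≤ b n) :
    Tendsto (fun n => u n / v n - a n / b n) atTop (𝓝 0) := by
  have h1 : ∀ᶠ n in atTop, β / 2 ≤ v n := by
    filter_upwards [hv.eventually (lt_mem_nhds (show -(β / 2) < 0 by linarith))] with n hn
    have := hb n
    linarith
  have h2 : Tendsto (fun n => (v n - b n) * (a n / b n)) atTop (𝓝 0) := by
    have := bdd_le_mul_tendsto_zero' (f := fun n => a n / b n) B (Eventually.of_forall fun n => by
      have hbn := hβ.trans_le (hb n)
      rw [abs_div, abs_of_pos hbn, div_le_iff₀ hbn]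
      exact ha n) hv
    exact this.congr fun n => mul_comm _ _
  have h3 := hu.sub h2
  rw [sub_zero] at h3
  have h4 := bdd_le_mul_tendsto_zero' (f := fun n => (v n)⁻¹) (2 / β) (h1.mono fun n hn => by
      have hvn : 0 < v n := (half_pos hβ).trans_le hn
      rw [abs_of_pos (inv_pos.2 hvn), ← inv_div]
      exact inv_anti₀ (half_pos hβ) hn) h3
  refine h4.congr' (h1.mono fun n hn => ?_)
  have hvn : v n ≠ 0 := ((half_pos hβ).trans_le hn).ne'
  have hbn : b n ≠ 0 := (hβ.trans_le (hb n)).ne'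
  field_simp
  ring

theorem exists_le_peakWeight (h : IsTwoComponent Q m a₀ b₀ a₁ b₁ t) {ζ : ℝ}
    (hζ : ζ ∈ peaks m b₀ a₁ t) (S : ℝ) : ∃ β > 0, ∀ s, |s| ≤ S → β ≤ peakWeight Q s ζ := by
  have hζ0 := h.peak_pos hζ
  have hL := h.laplacian_pos hζ
  refine ⟨(Real.exp (S * |Real.log ζ|))⁻¹ * √(2 * Real.pi / (4 * quarterLaplacian Q ζ)),
    by positivity, fun s hs => mul_le_mul_of_nonneg_right ?_ (Real.sqrt_nonneg _)⟩
  have := rpow_le_exp_abs_log hζ0 (s := -s) (S := S) (by rwa [abs_neg])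
  rw [Real.rpow_neg hζ0.le] at this
  exact inv_le_of_inv_le₀ (Real.rpow_pos_of_pos hζ0 _) this

/-- Numerator and denominator share the factor √n and the prefactor of the moments; the weight of b₀
keeps the limiting denominator away from 0. -/
theorem tendsto_level (h : IsTwoComponent Q m a₀ b₀ a₁ b₁ t) {f : ℝ → ℝ}
    (hf : Measurable f) (hf1 : ∀ r, |f r| ≤ 1)
    (hfc : ∀ ζ ∈ peaks m b₀ a₁ t, ContinuousAt f ζ) {k : ℕ → ℕ} {S : ℝ}
    (hs : ∀ n : ℕ, |2 * (k n : ℝ) + 1 - logSlope Q b₀ * n| ≤ S) :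
    Tendsto (fun n : ℕ => level Q n f (k n) -
      peakMean Q m b₀ a₁ t f (2 * (k n : ℝ) + 1 - logSlope Q b₀ * n)) atTop (𝓝 0) := by
  have h1 := h.tendsto_radial_integral hf hf1 hfc hs
  have h2 := h.tendsto_radial_integral (f := fun _ => 1) measurable_const (by simp)
    (fun _ _ => continuousAt_const) hs
  simp only [one_mul] at h2
  have hb : b₀ ∈ peaks m b₀ a₁ t := mem_peaks.2 (Or.inl rfl)
  obtain ⟨β, hβ, hβw⟩ := h.exists_le_peakWeight hb S
  have h3 := tendsto_div_sub_div (B := 1) hβ h1 h2 (fun n => ?_) (fun n => ?_)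
  · refine h3.congr' ?_
    filter_upwards [eventually_gt_atTop 0] with n hn
    have : (0 : ℝ) < √(n : ℝ) := Real.sqrt_pos.2 (by exact_mod_cast hn)
    rw [level, h.moment_eq, h.moment_eq, mul_div_mul_left _ _ this.ne',
      mul_div_mul_left _ _ (by positivity), peakMean]
    simp only [one_mul]
  · rw [one_mul]
    refine (Finset.abs_sum_le_sum_abs _ _).trans (Finset.sum_le_sum fun ζ hζ => ?_)
    rw [abs_mul, abs_of_pos (h.peakWeight_pos hζ)]
    exact mul_le_of_le_one_left (h.peakWeight_pos hζ).le (hf1 ζ)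
  · exact (hβw _ (hs n)).trans (Finset.single_le_sum
      (f := fun ζ => peakWeight Q (2 * (k n : ℝ) + 1 - logSlope Q b₀ * n) ζ)
      (fun ζ hζ => (h.peakWeight_pos hζ).le) hb)

/-- The levels of a function equal to one at a peak are bounded below. -/
theorem exists_le_level (h : IsTwoComponent Q m a₀ b₀ a₁ b₁ t) {f : ℝ → ℝ}
    (hf : Measurable f) (hf0 : ∀ r, 0 ≤ f r) (hf1 : ∀ r, f r ≤ 1)
    (hfc : ∀ ζ ∈ peaks m b₀ a₁ t, ContinuousAt f ζ) {ζ : ℝ} (hζ : ζ ∈ peaks m b₀ a₁ t)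
    (hfζ : f ζ = 1) {k : ℕ → ℕ} {S : ℝ}
    (hs : ∀ n : ℕ, |2 * (k n : ℝ) + 1 - logSlope Q b₀ * n| ≤ S) :
    ∃ c > 0, ∀ᶠ n in atTop, c ≤ level Q n f (k n) := by
  have hlev := h.tendsto_level hf (fun r => abs_le.2 ⟨by linarith [hf0 r], hf1 r⟩) hfc hs
  obtain ⟨β, hβ, hβw⟩ := h.exists_le_peakWeight hζ S
  set T : ℝ := ∑ ξ ∈ peaks m b₀ a₁ t, Real.exp (S * |Real.log ξ|) *
    √(2 * Real.pi / (4 * quarterLaplacian Q ξ)) with hT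
  have hle : ∀ s, |s| ≤ S → ∑ ξ ∈ peaks m b₀ a₁ t, peakWeight Q s ξ ≤ T := fun s hs =>
    Finset.sum_le_sum fun ξ hξ => mul_le_mul_of_nonneg_right
      (rpow_le_exp_abs_log (h.peak_pos hξ) hs) (Real.sqrt_nonneg _)
  have hge : ∀ s, |s| ≤ S → β ≤ ∑ ξ ∈ peaks m b₀ a₁ t, f ξ * peakWeight Q s ξ := fun s hs => by
    refine (hβw s hs).trans ?_
    have := Finset.single_le_sum (f := fun ξ => f ξ * peakWeight Q s ξ)
      (fun ξ hξ => mul_nonneg (hf0 ξ) (h.peakWeight_pos hξ).le) hζ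
    simpa [hfζ] using this
  have hpos : ∀ s, 0 < ∑ ξ ∈ peaks m b₀ a₁ t, peakWeight Q s ξ := fun s =>
    Finset.sum_pos (fun ξ hξ => h.peakWeight_pos hξ) ⟨ζ, hζ⟩
  have hT0 : 0 < T := (hpos _).trans_le (hle _ (hs 0))
  refine ⟨β / T / 2, by positivity, ?_⟩
  have hc : 0 < β / T / 2 := by positivity
  filter_upwards [hlev.eventually (lt_mem_nhds (show -(β / T / 2) < 0 by linarith))] with n hn
  have : β / T ≤ peakMean Q m b₀ a₁ t f (2 * (k n : ℝ) + 1 - logSlope Q b₀ * n) :=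
    div_le_div₀ (hβ.le.trans (hge _ (hs n))) (hge _ (hs n)) (hpos _) (hle _ (hs n))
  linarith

end IsTwoComponent

/-! ### Cutoffs -/

theorem continuous_cutoff (ε t : ℝ) : Continuous (cutoff ε t) := by
  have := Real.smoothTransition.continuous
  unfold cutoff
  fun_prop

theorem cutoff_nonneg (ε t r : ℝ) : 0 ≤ cutoff ε t r :=
  mul_nonneg (Real.smoothTransition.nonneg _) (Real.smoothTransition.nonneg _)

theorem cutoff_le_one (ε t r : ℝ) : cutoff ε t r ≤ 1 :=
  mul_le_one₀ (Real.smoothTransition.le_one _) (Real.smoothTransition.nonneg _)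
    (Real.smoothTransition.le_one _)

theorem cutoff_self {ε : ℝ} (hε : 0 < ε) (t : ℝ) : cutoff ε t t = 1 := by
  have h1 : (1 : ℝ) ≤ ε / (ε / 2) := by
    rw [le_div_iff₀ (by positivity)]; linarith
  rw [cutoff, Real.smoothTransition.one_of_one_le (by rwa [sub_sub_cancel]),
    Real.smoothTransition.one_of_one_le (by rwa [add_sub_cancel_left]), one_mul]

theorem cutoff_of_le {ε t r : ℝ} (hε : 0 < ε) (hr : r ≤ t - ε) : cutoff ε t r = 0 := by
  rw [cutoff, Real.smoothTransition.zero_of_nonpos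
    (div_nonpos_of_nonpos_of_nonneg (by linarith) (by positivity)), zero_mul]

theorem cutoff_of_ge {ε t r : ℝ} (hε : 0 < ε) (hr : t + ε ≤ r) : cutoff ε t r = 0 := by
  rw [cutoff, mul_comm, Real.smoothTransition.zero_of_nonpos
    (div_nonpos_of_nonpos_of_nonneg (by linarith) (by positivity)), zero_mul]

/-! ### The weights of the peaks -/

theorem peakWeight_div {Q : ℂ → EReal} {a ζ : ℝ} (ha : 0 < a) (hζ : 0 < ζ)
    (hLa : 0 < quarterLaplacian Q a) (hLζ : 0 < quarterLaplacian Q ζ) (s : ℝ) :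
    peakWeight Q s ζ / peakWeight Q s a =
      √(quarterLaplacian Q a / quarterLaplacian Q ζ) * (ζ / a) ^ s := by
  rw [peakWeight, peakWeight, mul_div_mul_comm, ← Real.div_rpow hζ.le ha.le,
    ← Real.sqrt_div (by positivity), mul_comm]
  congr 2
  have := Real.pi_pos
  field_simp

theorem fracPart_nonneg (M : ℝ) (n : ℕ) : 0 ≤ fracPart M n := Int.fract_nonneg _

theorem fracPart_lt_one (M : ℝ) (n : ℕ) : fracPart M n < 1 := Int.fract_lt_one _

namespace IsTwoComponent

variable {Q : ℂ → EReal} {m : ℕ} {a₀ b₀ a₁ b₁ : ℝ} {t : ℕ → ℝ}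

theorem b₀_mem_peaks : b₀ ∈ peaks m b₀ a₁ t := mem_peaks.2 (Or.inl rfl)

theorem a₁_mem_peaks : a₁ ∈ peaks m b₀ a₁ t := mem_peaks.2 (Or.inr (Or.inl rfl))

theorem t_mem_peaks {k : ℕ} (hk : k ∈ Finset.Icc 1 m) : t k ∈ peaks m b₀ a₁ t :=
  mem_peaks.2 (Or.inr (Or.inr ⟨k, hk, rfl⟩))

theorem peakWeight_div_eq (h : IsTwoComponent Q m a₀ b₀ a₁ b₁ t) {ζ a : ℝ}
    (hζ : ζ ∈ peaks m b₀ a₁ t) (ha : a ∈ peaks m b₀ a₁ t) (s : ℝ) :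
    peakWeight Q s ζ / peakWeight Q s a =
      √(quarterLaplacian Q a / quarterLaplacian Q ζ) * (ζ / a) ^ s :=
  peakWeight_div (h.peak_pos ha) (h.peak_pos hζ) (h.laplacian_pos ha) (h.laplacian_pos hζ) s

/-- The weight is the Laplace weight of the peak relative to that of a₁, for the exponent belonging
to level ⌊M n⌋ + j. -/
theorem weightTilde_eq (h : IsTwoComponent Q m a₀ b₀ a₁ b₁ t) {k : ℕ} (hk : k ∈ Finset.Icc 0 m)
    (M : ℝ) (n j : ℕ) : weightTilde Q b₀ a₁ t M n j k =
      peakWeight Q (2 * j + 1 - 2 * fracPart M n) (if k = 0 then b₀ else t k) /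
        peakWeight Q (2 * j + 1 - 2 * fracPart M n) a₁ := by
  have hζ : (if k = 0 then b₀ else t k) ∈ peaks m b₀ a₁ t := by
    split_ifs with h0
    · exact b₀_mem_peaks
    · exact t_mem_peaks (Finset.mem_Icc.2 ⟨Nat.one_le_iff_ne_zero.2 h0, (Finset.mem_Icc.1 hk).2⟩)
  have hρ : rhoTilde b₀ a₁ t k = (if k = 0 then b₀ else t k) / a₁ := by
    rw [rhoTilde]; split_ifs <;> rfl
  have hρ0 : 0 < (if k = 0 then b₀ else t k) / a₁ := div_pos (h.peak_pos hζ) h.a₁_pos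
  rw [h.peakWeight_div_eq hζ a₁_mem_peaks, weightTilde, thetaTilde, hρ, mul_assoc,
    ← Real.rpow_natCast, ← Real.rpow_add hρ0]
  congr 2
  push_cast
  ring

/-- Below the critical index the exponent is negative and b₀ is the reference peak: inverting the
ratio turns (ζ/b₀)^(-(2j+1)-2x) into (b₀/ζ)^(2j+1+2x), with x the fractional part. -/
theorem weightHat_eq (h : IsTwoComponent Q m a₀ b₀ a₁ b₁ t) {k : ℕ}
    (hk : k ∈ Finset.Icc 1 (m + 1)) (M : ℝ) (n j : ℕ) : weightHat Q m b₀ a₁ t M n j k =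
      peakWeight Q (-(2 * j + 1) - 2 * fracPart M n) (if k = m + 1 then a₁ else t k) /
        peakWeight Q (-(2 * j + 1) - 2 * fracPart M n) b₀ := by
  have hb := h.b₀_pos
  have key : ∀ ζ ∈ peaks m b₀ a₁ t, √(quarterLaplacian Q b₀ / quarterLaplacian Q ζ) *
      (b₀ / ζ) ^ (2 * fracPart M n) * (b₀ / ζ) ^ (2 * j + 1) =
      peakWeight Q (-(2 * j + 1) - 2 * fracPart M n) ζ /
        peakWeight Q (-(2 * j + 1) - 2 * fracPart M n) b₀ := fun ζ hζ => by
    have hρ0 : 0 < b₀ / ζ := div_pos hb (h.peak_pos hζ)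
    rw [h.peakWeight_div_eq hζ b₀_mem_peaks, mul_assoc, ← Real.rpow_natCast, ← Real.rpow_add hρ0,
      ← inv_div b₀ ζ, Real.inv_rpow hρ0.le, ← Real.rpow_neg hρ0.le]
    congr 2
    push_cast
    ring
  by_cases hkm : k = m + 1
  · rw [if_pos hkm, ← key a₁ a₁_mem_peaks, weightHat, thetaHat, rhoHat, if_pos hkm, if_pos hkm,
      thetaTilde, if_pos rfl, rhoTilde, if_pos rfl, mul_inv, ← Real.sqrt_inv, inv_div, neg_mul,
      Real.rpow_neg (div_pos hb h.a₁_pos).le, inv_inv]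
  · rw [if_neg hkm, ← key (t k) (t_mem_peaks (Finset.mem_Icc.2 ⟨(Finset.mem_Icc.1 hk).1, by
      have := (Finset.mem_Icc.1 hk).2; omega⟩)), weightHat, thetaHat, rhoHat, if_neg hkm,
      if_neg hkm]

theorem sum_peaks (h : IsTwoComponent Q m a₀ b₀ a₁ b₁ t)
    (hinj : Set.InjOn t (Set.Icc 1 m)) (g : ℝ → ℝ) :
    ∑ ζ ∈ peaks m b₀ a₁ t, g ζ = g b₀ + (g a₁ + ∑ k ∈ Finset.Icc 1 m, g (t k)) := by
  rw [peaks, Finset.sum_insert, Finset.sum_insert, Finset.sum_image]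
  · intro x hx y hy hxy
    exact hinj (by simpa using hx) (by simpa using hy) hxy
  · intro hmem
    obtain ⟨k, hk, hk'⟩ := Finset.mem_image.1 hmem
    exact (h.outpost k hk).2.ne hk'
  · intro hmem
    rcases Finset.mem_insert.1 hmem with heq | hmem
    · exact h.gap.ne heq
    · obtain ⟨k, hk, hk'⟩ := Finset.mem_image.1 hmem
      exact (h.outpost k hk).1.ne' hk'

theorem peakMean_eq {p : ℕ} (hp : p ∈ Finset.Icc 1 m) {f : ℝ → ℝ} (hfp : f (t p) = 1)
    (hf : ∀ ζ ∈ peaks m b₀ a₁ t, ζ ≠ t p → f ζ = 0) (s : ℝ) :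
    peakMean Q m b₀ a₁ t f s =
      peakWeight Q s (t p) / ∑ ζ ∈ peaks m b₀ a₁ t, peakWeight Q s ζ := by
  rw [peakMean, Finset.sum_eq_single (t p), hfp, one_mul]
  · intro ζ hζ hne
    rw [hf ζ hζ hne, zero_mul]
  · exact fun hne => absurd (t_mem_peaks hp) hne

/-- Dividing by the weight of a₁ turns that peak into the summand 1 of the denominator; the sum then
runs over b₀ and the outposts. -/
theorem expTerm_weightTilde (h : IsTwoComponent Q m a₀ b₀ a₁ b₁ t)
    (hinj : Set.InjOn t (Set.Icc 1 m)) {p : ℕ} (hp : p ∈ Finset.Icc 1 m) (M : ℝ) (n j : ℕ) :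
    expTerm (Finset.Icc 0 m) (weightTilde Q b₀ a₁ t M n j) p =
      peakWeight Q (2 * j + 1 - 2 * fracPart M n) (t p) /
        ∑ ζ ∈ peaks m b₀ a₁ t, peakWeight Q (2 * j + 1 - 2 * fracPart M n) ζ := by
  have hp' := Finset.mem_Icc.1 hp
  set s : ℝ := 2 * j + 1 - 2 * fracPart M n with hs
  have hsum : ∑ k ∈ Finset.Icc 0 m, weightTilde Q b₀ a₁ t M n j k =
      (peakWeight Q s b₀ + ∑ k ∈ Finset.Icc 1 m, peakWeight Q s (t k)) / peakWeight Q s a₁ := by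
    rw [Finset.sum_congr rfl fun k hk => h.weightTilde_eq hk M n j, ← Finset.sum_div,
      ← Finset.insert_Icc_succ_left_eq_Icc (Nat.zero_le m), Finset.sum_insert (by simp), if_pos rfl]
    congr 2
    refine Finset.sum_congr rfl fun k hk => ?_
    rw [if_neg (Nat.one_le_iff_ne_zero.1 (Finset.mem_Icc.1 hk).1)]
  have ha := h.peakWeight_pos (s := s) (a₁_mem_peaks (m := m) (b₀ := b₀) (a₁ := a₁) (t := t))
  rw [expTerm, hsum, h.weightTilde_eq (Finset.mem_Icc.2 ⟨Nat.zero_le _, hp'.2⟩),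
    if_neg (Nat.one_le_iff_ne_zero.1 hp'.1), h.sum_peaks hinj, ← hs, one_add_div ha.ne',
    div_div_div_cancel_right₀ ha.ne']
  congr 1
  ring

theorem expTerm_weightHat (h : IsTwoComponent Q m a₀ b₀ a₁ b₁ t)
    (hinj : Set.InjOn t (Set.Icc 1 m)) {p : ℕ} (hp : p ∈ Finset.Icc 1 m) (M : ℝ) (n j : ℕ) :
    expTerm (Finset.Icc 1 (m + 1)) (weightHat Q m b₀ a₁ t M n j) p =
      peakWeight Q (-(2 * j + 1) - 2 * fracPart M n) (t p) /
        ∑ ζ ∈ peaks m b₀ a₁ t, peakWeight Q (-(2 * j + 1) - 2 * fracPart M n) ζ := by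
  have hp' := Finset.mem_Icc.1 hp
  set s : ℝ := -(2 * j + 1) - 2 * fracPart M n with hs
  have hsum : ∑ k ∈ Finset.Icc 1 (m + 1), weightHat Q m b₀ a₁ t M n j k =
      (∑ k ∈ Finset.Icc 1 m, peakWeight Q s (t k) + peakWeight Q s a₁) / peakWeight Q s b₀ := by
    rw [Finset.sum_congr rfl fun k hk => h.weightHat_eq hk M n j, ← Finset.sum_div,
      Finset.sum_Icc_succ_top (by omega), if_pos rfl]
    congr 2
    refine Finset.sum_congr rfl fun k hk => ?_
    rw [if_neg (by have := (Finset.mem_Icc.1 hk).2; omega)]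
  have hb := h.peakWeight_pos (s := s) (b₀_mem_peaks (m := m) (b₀ := b₀) (a₁ := a₁) (t := t))
  rw [expTerm, hsum, h.weightHat_eq (Finset.mem_Icc.2 ⟨hp'.1, by omega⟩),
    if_neg (by omega), h.sum_peaks hinj, ← hs, one_add_div hb.ne',
    div_div_div_cancel_right₀ hb.ne']
  congr 1
  ring

/-! ### Geometric decay of the levels -/

/-- Raising the index by j multiplies moments supported in r ≤ R by at most R^(2j), while the mass
near a₁ grows at least like R'^(2j), with R' the midpoint of R and a₁. At the base index the cutoff
at a₁ holds a fixed fraction of the mass, so the ratio decays like (R/R')^(2j), uniformly in n. -/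
theorem exists_level_add_le (h : IsTwoComponent Q m a₀ b₀ a₁ b₁ t) {f : ℝ → ℝ}
    (hf : Measurable f) (hf0 : ∀ r, 0 ≤ f r) (hf1 : ∀ r, f r ≤ 1) {R : ℝ} (hR0 : 0 < R)
    (hRa : R < a₁) (hR : ∀ r, R < r → f r = 0) {k : ℕ → ℕ} {S : ℝ}
    (hs : ∀ n : ℕ, |2 * (k n : ℝ) + 1 - logSlope Q b₀ * n| ≤ S) :
    ∃ C, 0 ≤ C ∧ ∃ q, 0 ≤ q ∧ q < 1 ∧ ∀ᶠ n in atTop, ∀ j, k n + j < n →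
      level Q n f (k n + j) ≤ C * q ^ j := by
  set ε := (a₁ - R) / 2 with hε
  have hε0 : 0 < ε := by rw [hε]; linarith
  set R' := a₁ - ε with hR'
  have hRR : R < R' := by rw [hR', hε]; linarith
  have hR'0 : 0 < R' := hR0.trans hRR
  obtain ⟨c, hc, hev⟩ := h.exists_le_level (continuous_cutoff ε a₁).measurable
    (cutoff_nonneg ε a₁) (cutoff_le_one ε a₁) (fun _ _ => (continuous_cutoff ε a₁).continuousAt)
    a₁_mem_peaks (cutoff_self hε0 a₁) hs
  refine ⟨c⁻¹, by positivity, (R / R') ^ 2, by positivity,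
    pow_lt_one₀ (by positivity) ((div_lt_one hR'0).2 hRR) (by norm_num), ?_⟩
  filter_upwards [hev] with n hn j hj
  have hkn : k n < n := by omega
  have hP := h.moment_one_pos hkn
  have hu : c * moment Q n (fun _ => 1) (k n) ≤ moment Q n (cutoff ε a₁) (k n) := by
    rwa [level, le_div_iff₀ hP] at hn
  have hu0 := (mul_pos hc hP).trans_le hu
  have hf' : moment Q n f (k n) ≤ moment Q n (fun _ => 1) (k n) := by
    have := (h.pot.level_mem_Icc hkn hf hf0 hf1).2
    rwa [level, div_le_one hP] at this
  have h1 := h.pot.moment_add_le hj hf hf0 hf1 hR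
  have h2 := h.pot.le_moment_add hj (continuous_cutoff ε a₁).measurable (cutoff_nonneg ε a₁)
    (cutoff_le_one ε a₁) hR'0.le (fun r hr => cutoff_of_le hε0 hr.le)
  have h3 : moment Q n (cutoff ε a₁) (k n + j) ≤ moment Q n (fun _ => 1) (k n + j) :=
    h.pot.moment_mono hj (continuous_cutoff ε a₁).measurable
      (fun r => abs_le.2 ⟨by linarith [cutoff_nonneg ε a₁ r], cutoff_le_one ε a₁ r⟩)
      measurable_const (by simp) (cutoff_le_one ε a₁)
  calc level Q n f (k n + j)
      ≤ (R ^ (2 * j) * moment Q n (fun _ => 1) (k n)) /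
          (R' ^ (2 * j) * (c * moment Q n (fun _ => 1) (k n))) := by
        refine div_le_div₀ (by positivity) (h1.trans ?_) (by positivity) (le_trans ?_ (h2.trans h3))
        · gcongr
        · gcongr
    _ = c⁻¹ * ((R / R') ^ 2) ^ j := by
        rw [← pow_mul, div_pow]
        field_simp

/-- The mirror image: when the index is lowered by j, mass beyond R falls at least like R^(-2j),
while mass near b₀ falls at most like R'^(-2j), with b₀ < R' < R. -/
theorem exists_level_sub_le (h : IsTwoComponent Q m a₀ b₀ a₁ b₁ t) {f : ℝ → ℝ}
    (hf : Measurable f) (hf0 : ∀ r, 0 ≤ f r) (hf1 : ∀ r, f r ≤ 1) {R : ℝ}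
    (hRb : b₀ < R) (hR : ∀ r, r < R → f r = 0) {k : ℕ → ℕ} {S : ℝ}
    (hs : ∀ n : ℕ, |2 * (k n : ℝ) + 1 - logSlope Q b₀ * n| ≤ S) :
    ∃ C, 0 ≤ C ∧ ∃ q, 0 ≤ q ∧ q < 1 ∧ ∀ᶠ n in atTop, k n < n → ∀ j ≤ k n,
      level Q n f (k n - j) ≤ C * q ^ j := by
  have hb := h.b₀_pos
  set ε := (R - b₀) / 2 with hε
  have hε0 : 0 < ε := by rw [hε]; linarith
  set R' := b₀ + ε with hR'
  have hRR : R' < R := by rw [hR', hε]; linarith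
  have hR'0 : 0 < R' := by positivity
  have hR0 : 0 < R := hR'0.trans hRR
  obtain ⟨c, hc, hev⟩ := h.exists_le_level (continuous_cutoff ε b₀).measurable
    (cutoff_nonneg ε b₀) (cutoff_le_one ε b₀) (fun _ _ => (continuous_cutoff ε b₀).continuousAt)
    b₀_mem_peaks (cutoff_self hε0 b₀) hs
  refine ⟨c⁻¹, by positivity, (R' / R) ^ 2, by positivity,
    pow_lt_one₀ (by positivity) ((div_lt_one hR0).2 hRR) (by norm_num), ?_⟩
  filter_upwards [hev] with n hn hkn j hj
  have hP := h.moment_one_pos hkn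
  have hu : c * moment Q n (fun _ => 1) (k n) ≤ moment Q n (cutoff ε b₀) (k n) := by
    rwa [level, le_div_iff₀ hP] at hn
  have hf' : moment Q n f (k n) ≤ moment Q n (fun _ => 1) (k n) := by
    have := (h.pot.level_mem_Icc hkn hf hf0 hf1).2
    rwa [level, div_le_one hP] at this
  have hkj : k n - j + j = k n := Nat.sub_add_cancel hj
  have hjn : k n - j < n := by omega
  have h1 := h.pot.le_moment_add (k := k n - j) (j := j) (by rwa [hkj]) hf hf0 hf1 hR0.le hR
  have h2 := h.pot.moment_add_le (k := k n - j) (j := j) (R := R') (by rwa [hkj])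
    (continuous_cutoff ε b₀).measurable (cutoff_nonneg ε b₀)
    (cutoff_le_one ε b₀) (fun r hr => cutoff_of_ge hε0 hr.le)
  rw [hkj] at h1 h2
  have h3 : moment Q n (cutoff ε b₀) (k n - j) ≤ moment Q n (fun _ => 1) (k n - j) :=
    h.pot.moment_mono hjn (continuous_cutoff ε b₀).measurable
      (fun r => abs_le.2 ⟨by linarith [cutoff_nonneg ε b₀ r], cutoff_le_one ε b₀ r⟩)
      measurable_const (by simp) (cutoff_le_one ε b₀)
  calc level Q n f (k n - j)
      ≤ (moment Q n (fun _ => 1) (k n) / R ^ (2 * j)) /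
          (c * moment Q n (fun _ => 1) (k n) / R' ^ (2 * j)) := by
        refine div_le_div₀ (by positivity) ?_ (by positivity) (le_trans ?_ h3)
        · rw [le_div_iff₀ (by positivity), mul_comm]
          exact h1.trans hf'
        · rw [div_le_iff₀ (by positivity), mul_comm (moment _ _ _ _)]
          exact hu.trans h2
    _ = c⁻¹ * ((R' / R) ^ 2) ^ j := by
        rw [← pow_mul, div_pow]
        field_simp

end IsTwoComponent

/-! ### Passing to the limit in the sums over the levels -/

/-- Tannery's theorem for differences: the finite sums are extended by zero and both families have
geometric majorants independent of n. -/
theorem tendsto_sum_range_sub_tsum {ψ U : ℕ → ℕ → ℝ} {N : ℕ → ℕ} (hN : Tendsto N atTop atTop)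
    (hlim : ∀ j, Tendsto (fun n => ψ n j - U n j) atTop (𝓝 0)) {C q C' q' : ℝ}
    (hC : 0 ≤ C) (hq : 0 ≤ q) (hq1 : q < 1) (hq' : 0 ≤ q') (hq1' : q' < 1)
    (hψ : ∀ᶠ n in atTop, ∀ j < N n, |ψ n j| ≤ C * q ^ j)
    (hU : ∀ n j, |U n j| ≤ C' * q' ^ j) :
    Tendsto (fun n => ∑ j ∈ Finset.range (N n), ψ n j - ∑' j, U n j) atTop (𝓝 0) := by
  have hs := (summable_geometric_of_lt_one hq hq1).mul_left C
  have hs' := (summable_geometric_of_lt_one hq' hq1').mul_left C'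
  have key := tendsto_tsum_of_dominated_convergence (𝓕 := atTop)
    (f := fun n j => (if j < N n then ψ n j else 0) - U n j) (g := fun _ => (0 : ℝ))
    (bound := fun j => C * q ^ j + C' * q' ^ j) (hs.add hs') (fun j => ?_) ?_
  · rw [tsum_zero] at key
    refine key.congr fun n => ?_
    have h1 : HasSum (fun j => if j < N n then ψ n j else 0) (∑ j ∈ Finset.range (N n), ψ n j) := by
      have : HasSum (fun j => if j < N n then ψ n j else 0)
          (∑ j ∈ Finset.range (N n), if j < N n then ψ n j else 0) :=
        hasSum_sum_of_ne_finset_zero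
          fun j hj => if_neg (by simpa using hj)
      rwa [Finset.sum_congr rfl fun j hj => if_pos (Finset.mem_range.1 hj)] at this
    have h2 : Summable (U n) := Summable.of_norm_bounded hs' (hU n)
    exact (h1.sub h2.hasSum).tsum_eq
  · refine (hlim j).congr' ?_
    filter_upwards [hN.eventually_gt_atTop j] with n hn
    rw [if_pos hn]
  · filter_upwards [hψ] with n hn j
    refine (norm_sub_le _ _).trans (add_le_add ?_ (hU n j))
    split_ifs with hj
    · exact hn j hj
    · rw [norm_zero]; positivity

theorem sum_range_eq_add {K n : ℕ} (hK : K ≤ n) (φ : ℕ → ℝ) :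
    ∑ k ∈ Finset.range n, φ k =
      ∑ j ∈ Finset.range (n - K), φ (K + j) + ∑ j ∈ Finset.range K, φ (K - 1 - j) := by
  rw [Finset.sum_range_reflect, add_comm, ← Finset.sum_range_add, Nat.add_sub_cancel' hK]

/-- The Bernoulli variance e - e², with e the probability of the peak p. -/
theorem varTerm_eq {K : Finset ℕ} {w : ℕ → ℝ} {p : ℕ} (hp : p ∈ K) (hw : ∀ k ∈ K, 0 ≤ w k) :
    varTerm K w p = expTerm K w p - expTerm K w p * expTerm K w p := by
  have hS : 0 < 1 + ∑ k ∈ K, w k := by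
    have := Finset.sum_nonneg hw
    linarith
  rw [varTerm, expTerm, Finset.sum_erase_eq_sub hp]
  field_simp
  ring

theorem covTerm_eq (K : Finset ℕ) (w : ℕ → ℝ) (p q : ℕ) :
    covTerm K w p q = expTerm K w p * expTerm K w q := by
  rw [covTerm, expTerm, expTerm, div_mul_div_comm, sq]

theorem expTerm_pos {K : Finset ℕ} {w : ℕ → ℝ} {p : ℕ} (hp : p ∈ K) (hw : ∀ k ∈ K, 0 < w k) :
    0 < expTerm K w p := by
  have := Finset.sum_nonneg fun k hk => (hw k hk).le
  exact div_pos (hw p hp) (by linarith)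

theorem expTerm_le {K : Finset ℕ} {w : ℕ → ℝ} {p : ℕ} (hp : p ∈ K) (hw : ∀ k ∈ K, 0 < w k) :
    expTerm K w p ≤ w p := by
  have := Finset.sum_nonneg fun k hk => (hw k hk).le
  exact div_le_self (hw p hp).le (by linarith)

theorem expTerm_le_one {K : Finset ℕ} {w : ℕ → ℝ} {p : ℕ} (hp : p ∈ K) (hw : ∀ k ∈ K, 0 < w k) :
    expTerm K w p ≤ 1 := by
  have h1 := Finset.sum_nonneg fun k hk => (hw k hk).le
  have h2 := Finset.single_le_sum (fun k hk => (hw k hk).le) hp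
  rw [expTerm, div_le_one (by linarith)]
  linarith

theorem tendsto_mul_sub_mul {u v a b : ℕ → ℝ} (hu : Tendsto (fun n => u n - a n) atTop (𝓝 0))
    (hv : Tendsto (fun n => v n - b n) atTop (𝓝 0)) (ha : ∀ n, |a n| ≤ 1) (hb : ∀ n, |b n| ≤ 1) :
    Tendsto (fun n => u n * v n - a n * b n) atTop (𝓝 0) := by
  have h1 := bdd_le_mul_tendsto_zero' 1 (Eventually.of_forall ha) hv
  have h2 := bdd_le_mul_tendsto_zero' 1 (Eventually.of_forall hb) hu
  have h3 := (h1.add h2).add (hu.mul hv)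
  simp only [mul_zero, add_zero] at h3
  exact h3.congr fun n => by ring

namespace IsTwoComponent

variable {Q : ℂ → EReal} {m : ℕ} {a₀ b₀ a₁ b₁ : ℝ} {t : ℕ → ℝ}

theorem weightTilde_pos (h : IsTwoComponent Q m a₀ b₀ a₁ b₁ t) (M : ℝ) (n j : ℕ) :
    ∀ k ∈ Finset.Icc 0 m, 0 < weightTilde Q b₀ a₁ t M n j k := fun k hk => by
  rw [h.weightTilde_eq hk]
  refine div_pos (h.peakWeight_pos ?_) (h.peakWeight_pos a₁_mem_peaks)
  split_ifs with h0
  · exact b₀_mem_peaks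
  · exact t_mem_peaks (Finset.mem_Icc.2 ⟨Nat.one_le_iff_ne_zero.2 h0, (Finset.mem_Icc.1 hk).2⟩)

theorem weightHat_pos (h : IsTwoComponent Q m a₀ b₀ a₁ b₁ t) (M : ℝ) (n j : ℕ) :
    ∀ k ∈ Finset.Icc 1 (m + 1), 0 < weightHat Q m b₀ a₁ t M n j k := fun k hk => by
  rw [h.weightHat_eq hk]
  refine div_pos (h.peakWeight_pos ?_) (h.peakWeight_pos b₀_mem_peaks)
  have hk' := Finset.mem_Icc.1 hk
  split_ifs with h0
  · exact a₁_mem_peaks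
  · exact t_mem_peaks (Finset.mem_Icc.2 ⟨hk'.1, by omega⟩)

theorem exists_expTerm_weightTilde_le (h : IsTwoComponent Q m a₀ b₀ a₁ b₁ t) {p : ℕ}
    (hp : p ∈ Finset.Icc 1 m) (M : ℝ) : ∃ C q : ℝ, 0 ≤ q ∧ q < 1 ∧ ∀ n j,
      expTerm (Finset.Icc 0 m) (weightTilde Q b₀ a₁ t M n j) p ≤ C * q ^ j := by
  have hp' := Finset.mem_Icc.1 hp
  have hp0 : p ≠ 0 := by omega
  have hρ0 : 0 < t p / a₁ := div_pos (h.t_pos hp) h.a₁_pos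
  have hρ1 : t p / a₁ < 1 := (div_lt_one h.a₁_pos).2 (h.outpost p hp).2
  refine ⟨√(quarterLaplacian Q a₁ / quarterLaplacian Q (t p : ℝ)) * (t p / a₁) ^ (-2 : ℝ) *
    (t p / a₁), (t p / a₁) ^ 2, by positivity, pow_lt_one₀ hρ0.le hρ1 two_ne_zero, fun n j => ?_⟩
  refine (expTerm_le (Finset.mem_Icc.2 ⟨Nat.zero_le _, hp'.2⟩) (h.weightTilde_pos M n j)).trans ?_
  rw [weightTilde, thetaTilde, rhoTilde, if_neg hp0, if_neg hp0, ← pow_mul, mul_assoc (_ * _),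
    ← pow_succ']
  gcongr ?_ * _
  refine mul_le_mul_of_nonneg_left ?_ (Real.sqrt_nonneg _)
  exact Real.rpow_le_rpow_of_exponent_ge hρ0 hρ1.le (by linarith [fracPart_lt_one M n])

theorem exists_expTerm_weightHat_le (h : IsTwoComponent Q m a₀ b₀ a₁ b₁ t) {p : ℕ}
    (hp : p ∈ Finset.Icc 1 m) (M : ℝ) : ∃ C q : ℝ, 0 ≤ q ∧ q < 1 ∧ ∀ n j,
      expTerm (Finset.Icc 1 (m + 1)) (weightHat Q m b₀ a₁ t M n j) p ≤ C * q ^ j := by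
  have hp' := Finset.mem_Icc.1 hp
  have hp0 : p ≠ m + 1 := by omega
  have hρ0 : 0 < b₀ / t p := div_pos h.b₀_pos (h.t_pos hp)
  have hρ1 : b₀ / t p < 1 := (div_lt_one (h.t_pos hp)).2 (h.outpost p hp).1
  refine ⟨√(quarterLaplacian Q b₀ / quarterLaplacian Q (t p : ℝ)) * 1 *
    (b₀ / t p), (b₀ / t p) ^ 2, by positivity, pow_lt_one₀ hρ0.le hρ1 two_ne_zero, fun n j => ?_⟩
  refine (expTerm_le (Finset.mem_Icc.2 ⟨hp'.1, by omega⟩) (h.weightHat_pos M n j)).trans ?_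
  rw [weightHat, thetaHat, rhoHat, if_neg hp0, if_neg hp0, ← pow_mul, mul_assoc (_ * _),
    ← pow_succ']
  gcongr ?_ * _
  refine mul_le_mul_of_nonneg_left ?_ (Real.sqrt_nonneg _)
  exact Real.rpow_le_one hρ0.le hρ1.le (by linarith [fracPart_nonneg M n])

/-! ### Levels above and below the critical index ⌊M n⌋ -/

section Levels

variable {M : ℝ}

theorem mass_mem_Ioo (h : IsTwoComponent Q m a₀ b₀ a₁ b₁ t) (hM : logSlope Q b₀ = 2 * M) :
    M ∈ Set.Ioo (0 : ℝ) 1 := by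
  have h1 := h.logSlope_pos
  have h2 := h.logSlope_lt_two
  rw [h.logSlope_eq] at h2
  constructor <;> linarith

theorem _root_.CoulombGas.fracPart_eq (hM : 0 ≤ M) (n : ℕ) : fracPart M n = M * n - ⌊M * n⌋₊ := by
  rw [fracPart, natCast_floor_eq_intCast_floor (by positivity)]

theorem _root_.CoulombGas.floor_mul_le (hM : M ≤ 1) (n : ℕ) : ⌊M * n⌋₊ ≤ n := by
  have : M * n ≤ n := mul_le_of_le_one_left (Nat.cast_nonneg n) hM
  simpa using Nat.floor_le_floor this

theorem _root_.CoulombGas.tendsto_floor_mul (hM : 0 < M) :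
    Tendsto (fun n : ℕ => ⌊M * n⌋₊) atTop atTop :=
  tendsto_nat_floor_atTop.comp (tendsto_natCast_atTop_atTop.const_mul_atTop hM)

theorem _root_.CoulombGas.tendsto_sub_floor_mul (hM0 : 0 ≤ M) (hM : M < 1) :
    Tendsto (fun n : ℕ => n - ⌊M * n⌋₊) atTop atTop := by
  rw [← tendsto_natCast_atTop_iff (R := ℝ)]
  refine tendsto_atTop_mono (fun n => ?_)
    ((tendsto_natCast_atTop_atTop (R := ℝ)).const_mul_atTop (sub_pos.2 hM))
  rw [Nat.cast_sub (floor_mul_le hM.le n)]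
  have := Nat.floor_le (show 0 ≤ M * n by positivity)
  linarith

theorem abs_exponent_add_le (h : IsTwoComponent Q m a₀ b₀ a₁ b₁ t) (hM : logSlope Q b₀ = 2 * M)
    (n j : ℕ) : |2 * ((⌊M * n⌋₊ + j : ℕ) : ℝ) + 1 - logSlope Q b₀ * n| ≤ 2 * j + 3 := by
  have hM' := h.mass_mem_Ioo hM
  have h1 := fracPart_eq hM'.1.le n
  have h2 := fracPart_nonneg M n
  have h3 := fracPart_lt_one M n
  rw [hM, abs_le]
  push_cast
  constructor <;> linarith

/-- The constant leaves room for truncated subtraction at small n: the floor never exceeds the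
truncated index by more than 1 + j. -/
theorem abs_exponent_sub_le (h : IsTwoComponent Q m a₀ b₀ a₁ b₁ t) (hM : logSlope Q b₀ = 2 * M)
    (n j : ℕ) : |2 * ((⌊M * n⌋₊ - 1 - j : ℕ) : ℝ) + 1 - logSlope Q b₀ * n| ≤ 2 * j + 5 := by
  have hM' := h.mass_mem_Ioo hM
  have h1 := fracPart_eq hM'.1.le n
  have h2 := fracPart_nonneg M n
  have h3 := fracPart_lt_one M n
  have h4 : ((⌊M * n⌋₊ - 1 - j : ℕ) : ℝ) ≤ ⌊M * n⌋₊ := by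
    exact_mod_cast (Nat.sub_le _ _).trans (Nat.sub_le _ _)
  have h5 : (⌊M * n⌋₊ : ℝ) ≤ ((⌊M * n⌋₊ - 1 - j : ℕ) : ℝ) + 1 + j := by
    exact_mod_cast (show ⌊M * n⌋₊ ≤ ⌊M * n⌋₊ - 1 - j + 1 + j by omega)
  rw [hM, abs_le]
  constructor <;> linarith

theorem tendsto_level_add (h : IsTwoComponent Q m a₀ b₀ a₁ b₁ t)
    (hinj : Set.InjOn t (Set.Icc 1 m)) (hM : logSlope Q b₀ = 2 * M) {p : ℕ}
    (hp : p ∈ Finset.Icc 1 m) {f : ℝ → ℝ} (hf : Continuous f) (hf1 : ∀ r, |f r| ≤ 1)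
    (hfp : f (t p) = 1) (hf0 : ∀ ζ ∈ peaks m b₀ a₁ t, ζ ≠ t p → f ζ = 0) (j : ℕ) :
    Tendsto (fun n : ℕ => level Q n f (⌊M * n⌋₊ + j) -
      expTerm (Finset.Icc 0 m) (weightTilde Q b₀ a₁ t M n j) p) atTop (𝓝 0) := by
  refine (h.tendsto_level hf.measurable hf1 (fun _ _ => hf.continuousAt)
    (h.abs_exponent_add_le hM · j)).congr fun n => ?_
  rw [peakMean_eq hp hfp hf0, h.expTerm_weightTilde hinj hp]
  have : 2 * ((⌊M * n⌋₊ + j : ℕ) : ℝ) + 1 - logSlope Q b₀ * n = 2 * j + 1 - 2 * fracPart M n := by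
    rw [fracPart_eq (h.mass_mem_Ioo hM).1.le, hM]
    push_cast
    ring
  rw [this]

theorem tendsto_level_sub (h : IsTwoComponent Q m a₀ b₀ a₁ b₁ t)
    (hinj : Set.InjOn t (Set.Icc 1 m)) (hM : logSlope Q b₀ = 2 * M) {p : ℕ}
    (hp : p ∈ Finset.Icc 1 m) {f : ℝ → ℝ} (hf : Continuous f) (hf1 : ∀ r, |f r| ≤ 1)
    (hfp : f (t p) = 1) (hf0 : ∀ ζ ∈ peaks m b₀ a₁ t, ζ ≠ t p → f ζ = 0) (j : ℕ) :
    Tendsto (fun n : ℕ => level Q n f (⌊M * n⌋₊ - 1 - j) -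
      expTerm (Finset.Icc 1 (m + 1)) (weightHat Q m b₀ a₁ t M n j) p) atTop (𝓝 0) := by
  have hM' := h.mass_mem_Ioo hM
  refine (h.tendsto_level hf.measurable hf1 (fun _ _ => hf.continuousAt)
    (h.abs_exponent_sub_le hM · j)).congr' ?_
  filter_upwards [(tendsto_floor_mul hM'.1).eventually_gt_atTop j] with n hn
  rw [peakMean_eq hp hfp hf0, h.expTerm_weightHat hinj hp]
  -- Here ⌊M n⌋ > j, so the natural subtraction is exact and the exponent takes its closed form.
  have : 2 * ((⌊M * n⌋₊ - 1 - j : ℕ) : ℝ) + 1 - logSlope Q b₀ * n =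
      -(2 * j + 1) - 2 * fracPart M n := by
    rw [fracPart_eq hM'.1.le, hM, Nat.sub_sub, Nat.cast_sub (by omega)]
    push_cast
    ring
  rw [this]

/-- Sums over the levels of quantities dominated by the levels of a function supported between
the components of the droplet. -/
theorem tendsto_sum_levels (h : IsTwoComponent Q m a₀ b₀ a₁ b₁ t) (hM : logSlope Q b₀ = 2 * M)
    {p : ℕ} (hp : p ∈ Finset.Icc 1 m) {f : ℝ → ℝ} (hf : Measurable f) (hf0 : ∀ r, 0 ≤ f r)
    (hf1 : ∀ r, f r ≤ 1) {R R' : ℝ} (hR : b₀ < R) (hRf : ∀ r, r < R → f r = 0) (hR0' : 0 < R')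
    (hR' : R' < a₁) (hRf' : ∀ r, R' < r → f r = 0) {φ U L : ℕ → ℕ → ℝ}
    (hφ : ∀ n, ∀ k < n, |φ n k| ≤ level Q n f k)
    (hU : ∀ n j, |U n j| ≤ expTerm (Finset.Icc 0 m) (weightTilde Q b₀ a₁ t M n j) p)
    (hL : ∀ n j, |L n j| ≤ expTerm (Finset.Icc 1 (m + 1)) (weightHat Q m b₀ a₁ t M n j) p)
    (hUlim : ∀ j, Tendsto (fun n : ℕ => φ n (⌊M * n⌋₊ + j) - U n j) atTop (𝓝 0))
    (hLlim : ∀ j, Tendsto (fun n : ℕ => φ n (⌊M * n⌋₊ - 1 - j) - L n j) atTop (𝓝 0)) :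
    (∀ n, Summable (U n) ∧ Summable (L n)) ∧
    Tendsto (fun n => ∑ k : Fin n, φ n k - (∑' j, U n j + ∑' j, L n j)) atTop (𝓝 0) := by
  have hM' := h.mass_mem_Ioo hM
  obtain ⟨C₁, q₁, hq₁, hq₁', hb₁⟩ := h.exists_expTerm_weightTilde_le hp M
  obtain ⟨C₂, q₂, hq₂, hq₂', hb₂⟩ := h.exists_expTerm_weightHat_le hp M
  obtain ⟨C₃, hC₃, q₃, hq₃, hq₃', hb₃⟩ := h.exists_level_add_le hf hf0 hf1 hR0' hR' hRf'
    (fun n => by simpa using h.abs_exponent_add_le hM n 0)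
  obtain ⟨C₄, hC₄, q₄, hq₄, hq₄', hb₄⟩ := h.exists_level_sub_le hf hf0 hf1 hR hRf
    (k := fun n => ⌊M * n⌋₊ - 1) (fun n => by simpa using h.abs_exponent_sub_le hM n 0)
  refine ⟨fun n => ⟨?_, ?_⟩, ?_⟩
  · exact Summable.of_norm_bounded ((summable_geometric_of_lt_one hq₁ hq₁').mul_left C₁)
      fun j => (hU n j).trans (hb₁ n j)
  · exact Summable.of_norm_bounded ((summable_geometric_of_lt_one hq₂ hq₂').mul_left C₂)
      fun j => (hL n j).trans (hb₂ n j)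
  -- The levels k < n split at ⌊M n⌋: upward from it for the tilde series, and downward from ⌊M n⌋ -
  -- 1 for the hat series. Both ranges become infinite because 0 < M < 1.
  have h1 := tendsto_sum_range_sub_tsum (tendsto_sub_floor_mul hM'.1.le hM'.2) hUlim hC₃ hq₃ hq₃'
    hq₁ hq₁' (hb₃.mono fun n hn j hj => (hφ n _ (by omega)).trans (hn j (by omega)))
    fun n j => (hU n j).trans (hb₁ n j)
  have h2 := tendsto_sum_range_sub_tsum (tendsto_floor_mul hM'.1) hLlim hC₄ hq₄ hq₄'
    hq₂ hq₂' (hb₄.mono fun n hn j hj => by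
      have := floor_mul_le hM'.2.le n
      exact (hφ n _ (by omega)).trans (hn (by omega) j (by omega)))
    fun n j => (hL n j).trans (hb₂ n j)
  have h3 := h1.add h2
  rw [add_zero] at h3
  refine h3.congr fun n => ?_
  rw [Fin.sum_univ_eq_sum_range (φ n) n, sum_range_eq_add (floor_mul_le hM'.2.le n)]
  ring

end Levels

end IsTwoComponent

/-! ### The cumulants of the counts near the outposts -/

theorem IsPotential.level_mono {Q : ℂ → EReal} (hQ : IsPotential Q) {n k : ℕ} (hk : k < n)
    {f g : ℝ → ℝ} (hf : Measurable f) (hf1 : ∀ r, |f r| ≤ 1) (hg : Measurable g)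
    (hg1 : ∀ r, |g r| ≤ 1) (hfg : ∀ r, f r ≤ g r) : level Q n f k ≤ level Q n g k :=
  div_le_div_of_nonneg_right (hQ.moment_mono hk hf hf1 hg hg1 hfg)
    (moment_nonneg fun _ => zero_le_one)

theorem abs_cutoff_le_one (ε t r : ℝ) : |cutoff ε t r| ≤ 1 :=
  abs_le.2 ⟨by linarith [cutoff_nonneg ε t r], cutoff_le_one ε t r⟩

namespace IsTwoComponent

variable {Q : ℂ → EReal} {m : ℕ} {a₀ b₀ a₁ b₁ : ℝ} {t : ℕ → ℝ} {M ε : ℝ} {p q : ℕ}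

theorem cutoff_peak (hε : 0 < ε)
    (hsep : ∀ k ∈ Finset.Icc 1 m, ∀ l ∈ Finset.Icc 1 m, k < l → t k + 2 * ε ≤ t l - 2 * ε)
    (hdrop : ∀ k ∈ Finset.Icc 1 m, b₀ ≤ t k - 2 * ε ∧ t k + 2 * ε ≤ a₁)
    (hp : p ∈ Finset.Icc 1 m) : ∀ ζ ∈ peaks m b₀ a₁ t, ζ ≠ t p → cutoff ε (t p) ζ = 0 := by
  intro ζ hζ hne
  rcases mem_peaks.1 hζ with rfl | rfl | ⟨k, hk, rfl⟩
  · exact cutoff_of_le hε (by linarith [(hdrop p hp).1])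
  · exact cutoff_of_ge hε (by linarith [(hdrop p hp).2])
  · rcases lt_trichotomy k p with hkp | rfl | hkp
    · exact cutoff_of_le hε (by linarith [hsep k hk p hp hkp])
    · exact absurd rfl hne
    · exact cutoff_of_ge hε (by linarith [hsep p hp k hk hkp])

theorem cutoff_mul_cutoff (hε : 0 < ε)
    (hsep : ∀ k ∈ Finset.Icc 1 m, ∀ l ∈ Finset.Icc 1 m, k < l → t k + 2 * ε ≤ t l - 2 * ε)
    (hp : p ∈ Finset.Icc 1 m) (hq : q ∈ Finset.Icc 1 m) (hpq : p ≠ q) (r : ℝ) :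
    cutoff ε (t p) r * cutoff ε (t q) r = 0 := by
  have key : ∀ k ∈ Finset.Icc 1 m, ∀ l ∈ Finset.Icc 1 m, k < l →
      cutoff ε (t k) r * cutoff ε (t l) r = 0 := by
    intro k hk l hl hkl
    have := hsep k hk l hl hkl
    rcases le_total r (t k + ε) with hr | hr
    · rw [cutoff_of_le (t := t l) hε (by linarith), mul_zero]
    · rw [cutoff_of_ge (t := t k) hε hr, zero_mul]
  rcases hpq.lt_or_gt with hlt | hlt
  · exact key p hp q hq hlt
  · rw [mul_comm]
    exact key q hq p hp hlt

theorem tendsto_sum_cutoff (h : IsTwoComponent Q m a₀ b₀ a₁ b₁ t) (hM : logSlope Q b₀ = 2 * M)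
    (hε : 0 < ε) (hdrop : ∀ k ∈ Finset.Icc 1 m, b₀ ≤ t k - 2 * ε ∧ t k + 2 * ε ≤ a₁)
    (hp : p ∈ Finset.Icc 1 m) {φ U L : ℕ → ℕ → ℝ}
    (hφ : ∀ n, ∀ k < n, |φ n k| ≤ level Q n (cutoff ε (t p)) k)
    (hU : ∀ n j, |U n j| ≤ expTerm (Finset.Icc 0 m) (weightTilde Q b₀ a₁ t M n j) p)
    (hL : ∀ n j, |L n j| ≤ expTerm (Finset.Icc 1 (m + 1)) (weightHat Q m b₀ a₁ t M n j) p)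
    (hUlim : ∀ j, Tendsto (fun n : ℕ => φ n (⌊M * n⌋₊ + j) - U n j) atTop (𝓝 0))
    (hLlim : ∀ j, Tendsto (fun n : ℕ => φ n (⌊M * n⌋₊ - 1 - j) - L n j) atTop (𝓝 0)) :
    (∀ n, Summable (U n) ∧ Summable (L n)) ∧
    Tendsto (fun n => ∑ k : Fin n, φ n k - (∑' j, U n j + ∑' j, L n j)) atTop (𝓝 0) := by
  have hd := hdrop p hp
  have hb := h.t_pos hp
  exact h.tendsto_sum_levels hM hp (continuous_cutoff ε (t p)).measurable (cutoff_nonneg _ _)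
    (cutoff_le_one _ _) (R := t p - ε) (R' := t p + ε) (by linarith)
    (fun r hr => cutoff_of_le hε hr.le) (by linarith) (by linarith)
    (fun r hr => cutoff_of_ge hε hr.le) hφ hU hL hUlim hLlim

section Terms

theorem mem_Icc_zero (hp : p ∈ Finset.Icc 1 m) : p ∈ Finset.Icc 0 m :=
  Finset.mem_Icc.2 ⟨Nat.zero_le _, (Finset.mem_Icc.1 hp).2⟩

theorem mem_Icc_succ (hp : p ∈ Finset.Icc 1 m) : p ∈ Finset.Icc 1 (m + 1) :=
  Finset.mem_Icc.2 ⟨(Finset.mem_Icc.1 hp).1, (Finset.mem_Icc.1 hp).2.trans (Nat.le_succ m)⟩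

theorem _root_.CoulombGas.abs_expTerm_le_one {K : Finset ℕ} {w : ℕ → ℝ} (hp : p ∈ K)
    (hw : ∀ k ∈ K, 0 < w k) : |expTerm K w p| ≤ 1 := by
  rw [abs_of_pos (expTerm_pos hp hw)]
  exact expTerm_le_one hp hw

theorem _root_.CoulombGas.abs_varTerm_le {K : Finset ℕ} {w : ℕ → ℝ} (hp : p ∈ K)
    (hw : ∀ k ∈ K, 0 < w k) : |varTerm K w p| ≤ expTerm K w p := by
  have h0 := expTerm_pos hp hw
  have h1 := expTerm_le_one hp hw
  rw [varTerm_eq hp fun k hk => (hw k hk).le, abs_le]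
  constructor <;> nlinarith

theorem _root_.CoulombGas.abs_neg_covTerm_le {K : Finset ℕ} {w : ℕ → ℝ} (hp : p ∈ K) (hq : q ∈ K)
    (hw : ∀ k ∈ K, 0 < w k) : |-covTerm K w p q| ≤ expTerm K w p := by
  rw [covTerm_eq, abs_neg, abs_mul, abs_of_pos (expTerm_pos hp hw)]
  exact mul_le_of_le_one_right (expTerm_pos hp hw).le (abs_expTerm_le_one hq hw)

end Terms

theorem tendsto_integral_count (h : IsTwoComponent Q m a₀ b₀ a₁ b₁ t)
    (hinj : Set.InjOn t (Set.Icc 1 m)) (hM : logSlope Q b₀ = 2 * M) (hε : 0 < ε)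
    (hsep : ∀ k ∈ Finset.Icc 1 m, ∀ l ∈ Finset.Icc 1 m, k < l → t k + 2 * ε ≤ t l - 2 * ε)
    (hdrop : ∀ k ∈ Finset.Icc 1 m, b₀ ≤ t k - 2 * ε ∧ t k + 2 * ε ≤ a₁)
    (hp : p ∈ Finset.Icc 1 m) :
    (∀ n, Summable (fun j => expTerm (Finset.Icc 0 m) (weightTilde Q b₀ a₁ t M n j) p) ∧
      Summable fun j => expTerm (Finset.Icc 1 (m + 1)) (weightHat Q m b₀ a₁ t M n j) p) ∧
    Tendsto (fun n : ℕ => ∫ z, count ε (t p) n z ∂(gas Q n) -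
      (∑' j, expTerm (Finset.Icc 0 m) (weightTilde Q b₀ a₁ t M n j) p +
        ∑' j, expTerm (Finset.Icc 1 (m + 1)) (weightHat Q m b₀ a₁ t M n j) p)) atTop (𝓝 0) := by
  have hc := continuous_cutoff ε (t p)
  have hpk := cutoff_peak hε hsep hdrop hp
  obtain ⟨hsum, hlim⟩ := h.tendsto_sum_cutoff hM hε hdrop hp
    (φ := fun n k => level Q n (cutoff ε (t p)) k)
    (fun n k hk => (abs_of_nonneg (h.pot.level_mem_Icc hk hc.measurable (cutoff_nonneg _ _)
      (cutoff_le_one _ _)).1).le)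
    (fun n j => (abs_of_pos (expTerm_pos (mem_Icc_zero hp) (h.weightTilde_pos M n j))).le)
    (fun n j => (abs_of_pos (expTerm_pos (mem_Icc_succ hp) (h.weightHat_pos M n j))).le)
    (h.tendsto_level_add hinj hM hp hc (abs_cutoff_le_one _ _) (cutoff_self hε _) hpk)
    (h.tendsto_level_sub hinj hM hp hc (abs_cutoff_le_one _ _) (cutoff_self hε _) hpk)
  refine ⟨hsum, hlim.congr fun n => ?_⟩
  rw [← h.pot.integral_radialSum (fun k hk => h.moment_one_pos hk) hc.measurable
    (abs_cutoff_le_one _ _)]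
  rfl

/-- The square of the cutoff also equals 1 at `t p` and 0 at the other peaks, so its levels have the
same limit e as those of the cutoff, and each level contributes e - e². Smoothing of the count is
therefore invisible in the limit. -/
theorem tendsto_variance_count (h : IsTwoComponent Q m a₀ b₀ a₁ b₁ t)
    (hinj : Set.InjOn t (Set.Icc 1 m)) (hM : logSlope Q b₀ = 2 * M) (hε : 0 < ε)
    (hsep : ∀ k ∈ Finset.Icc 1 m, ∀ l ∈ Finset.Icc 1 m, k < l → t k + 2 * ε ≤ t l - 2 * ε)
    (hdrop : ∀ k ∈ Finset.Icc 1 m, b₀ ≤ t k - 2 * ε ∧ t k + 2 * ε ≤ a₁)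
    (hp : p ∈ Finset.Icc 1 m) :
    (∀ n, Summable (fun j => varTerm (Finset.Icc 0 m) (weightTilde Q b₀ a₁ t M n j) p) ∧
      Summable fun j => varTerm (Finset.Icc 1 (m + 1)) (weightHat Q m b₀ a₁ t M n j) p) ∧
    Tendsto (fun n : ℕ => variance (count ε (t p) n) (gas Q n) -
      (∑' j, varTerm (Finset.Icc 0 m) (weightTilde Q b₀ a₁ t M n j) p +
        ∑' j, varTerm (Finset.Icc 1 (m + 1)) (weightHat Q m b₀ a₁ t M n j) p)) atTop (𝓝 0) := by
  have hc := continuous_cutoff ε (t p)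
  have hpk := cutoff_peak hε hsep hdrop hp
  have h1 := abs_cutoff_le_one ε (t p)
  have hsq : ∀ r, |cutoff ε (t p) r * cutoff ε (t p) r| ≤ 1 := fun r => by
    rw [abs_mul]
    exact mul_le_one₀ (h1 r) (abs_nonneg _) (h1 r)
  have hc2 : Continuous fun r => cutoff ε (t p) r * cutoff ε (t p) r := hc.mul hc
  have hsqp : cutoff ε (t p) (t p) * cutoff ε (t p) (t p) = 1 := by
    rw [cutoff_self hε, one_mul]
  have hsqk : ∀ ζ ∈ peaks m b₀ a₁ t, ζ ≠ t p → cutoff ε (t p) ζ * cutoff ε (t p) ζ = 0 :=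
    fun ζ hζ hne => by rw [hpk ζ hζ hne, mul_zero]
  obtain ⟨hsum, hlim⟩ := h.tendsto_sum_cutoff hM hε hdrop hp
    (φ := fun n k => level Q n (fun r => cutoff ε (t p) r * cutoff ε (t p) r) k -
      level Q n (cutoff ε (t p)) k * level Q n (cutoff ε (t p)) k)
    (U := fun n j => varTerm (Finset.Icc 0 m) (weightTilde Q b₀ a₁ t M n j) p)
    (L := fun n j => varTerm (Finset.Icc 1 (m + 1)) (weightHat Q m b₀ a₁ t M n j) p)
    (fun n k hk => by
      have h2 := h.pot.level_mem_Icc hk hc.measurable (cutoff_nonneg ε (t p)) (cutoff_le_one ε _)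
      have h3 := h.pot.level_mem_Icc hk hc2.measurable
        (fun r => mul_self_nonneg (cutoff ε (t p) r)) (fun r => (abs_le.1 (hsq r)).2)
      have h4 := h.pot.level_mono hk hc2.measurable hsq hc.measurable h1
        (fun r => mul_le_of_le_one_right (cutoff_nonneg _ _ _) (cutoff_le_one _ _ _))
      rw [abs_le]
      constructor <;> nlinarith [h2.1, h2.2, h3.1])
    (fun n j => abs_varTerm_le (mem_Icc_zero hp) (h.weightTilde_pos M n j))
    (fun n j => abs_varTerm_le (mem_Icc_succ hp) (h.weightHat_pos M n j))
    (fun j => by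
      have h2 := h.tendsto_level_add hinj hM hp hc h1 (cutoff_self hε _) hpk j
      have h3 := h.tendsto_level_add hinj hM hp hc2 hsq hsqp hsqk j
      have hb : ∀ n, |expTerm (Finset.Icc 0 m) (weightTilde Q b₀ a₁ t M n j) p| ≤ 1 := fun n =>
        abs_expTerm_le_one (mem_Icc_zero hp) (h.weightTilde_pos M n j)
      have h4 := h3.sub (tendsto_mul_sub_mul h2 h2 hb hb)
      rw [sub_zero] at h4
      refine h4.congr fun n => ?_
      rw [varTerm_eq (mem_Icc_zero hp) fun k hk => (h.weightTilde_pos M n j k hk).le]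
      ring)
    (fun j => by
      have h2 := h.tendsto_level_sub hinj hM hp hc h1 (cutoff_self hε _) hpk j
      have h3 := h.tendsto_level_sub hinj hM hp hc2 hsq hsqp hsqk j
      have hb : ∀ n, |expTerm (Finset.Icc 1 (m + 1)) (weightHat Q m b₀ a₁ t M n j) p| ≤ 1 :=
        fun n => abs_expTerm_le_one (mem_Icc_succ hp) (h.weightHat_pos M n j)
      have h4 := h3.sub (tendsto_mul_sub_mul h2 h2 hb hb)
      rw [sub_zero] at h4
      refine h4.congr fun n => ?_
      rw [varTerm_eq (mem_Icc_succ hp) fun k hk => (h.weightHat_pos M n j k hk).le]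
      ring)
  refine ⟨hsum, hlim.congr fun n => ?_⟩
  have hv : variance (count ε (t p) n) (gas Q n) =
      covariance (radialSum (cutoff ε (t p)) n) (radialSum (cutoff ε (t p)) n) (gas Q n) :=
    (covariance_self (measurable_radialSum hc.measurable n).aemeasurable).symm
  rw [hv]
  exact congrArg (· - _) (h.pot.covariance_radialSum (fun k hk => h.moment_one_pos hk)
    hc.measurable hc.measurable h1 h1).symm

theorem tendsto_covariance_count (h : IsTwoComponent Q m a₀ b₀ a₁ b₁ t)
    (hinj : Set.InjOn t (Set.Icc 1 m)) (hM : logSlope Q b₀ = 2 * M) (hε : 0 < ε)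
    (hsep : ∀ k ∈ Finset.Icc 1 m, ∀ l ∈ Finset.Icc 1 m, k < l → t k + 2 * ε ≤ t l - 2 * ε)
    (hdrop : ∀ k ∈ Finset.Icc 1 m, b₀ ≤ t k - 2 * ε ∧ t k + 2 * ε ≤ a₁)
    (hp : p ∈ Finset.Icc 1 m) (hq : q ∈ Finset.Icc 1 m) (hpq : p ≠ q) :
    (∀ n, Summable (fun j => covTerm (Finset.Icc 0 m) (weightTilde Q b₀ a₁ t M n j) p q) ∧
      Summable fun j => covTerm (Finset.Icc 1 (m + 1)) (weightHat Q m b₀ a₁ t M n j) p q) ∧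
    Tendsto (fun n : ℕ => covariance (count ε (t p) n) (count ε (t q) n) (gas Q n) -
      (-(∑' j, covTerm (Finset.Icc 0 m) (weightTilde Q b₀ a₁ t M n j) p q) -
        ∑' j, covTerm (Finset.Icc 1 (m + 1)) (weightHat Q m b₀ a₁ t M n j) p q))
      atTop (𝓝 0) := by
  have hc := continuous_cutoff ε (t p)
  have hc' := continuous_cutoff ε (t q)
  have hpk := cutoff_peak hε hsep hdrop hp
  have hpk' := cutoff_peak hε hsep hdrop hq
  have h1 := abs_cutoff_le_one ε (t p)
  have h1' := abs_cutoff_le_one ε (t q)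
  -- Cutoffs at different outposts have product zero, so only minus the product of the two levels
  -- survives.
  have h0 : ∀ n k, level Q n (fun r => cutoff ε (t p) r * cutoff ε (t q) r) k = 0 := fun n k => by
    simp [level, moment, cutoff_mul_cutoff hε hsep hp hq hpq]
  obtain ⟨hsum, hlim⟩ := h.tendsto_sum_cutoff hM hε hdrop hp
    (φ := fun n k => level Q n (fun r => cutoff ε (t p) r * cutoff ε (t q) r) k -
      level Q n (cutoff ε (t p)) k * level Q n (cutoff ε (t q)) k)
    (U := fun n j => -covTerm (Finset.Icc 0 m) (weightTilde Q b₀ a₁ t M n j) p q)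
    (L := fun n j => -covTerm (Finset.Icc 1 (m + 1)) (weightHat Q m b₀ a₁ t M n j) p q)
    (fun n k hk => by
      have h2 := h.pot.level_mem_Icc hk hc.measurable (cutoff_nonneg ε (t p)) (cutoff_le_one ε _)
      have h3 := h.pot.level_mem_Icc hk hc'.measurable (cutoff_nonneg ε (t q)) (cutoff_le_one ε _)
      rw [h0, zero_sub, abs_neg, abs_of_nonneg (mul_nonneg h2.1 h3.1)]
      exact mul_le_of_le_one_right h2.1 h3.2)
    (fun n j => abs_neg_covTerm_le (mem_Icc_zero hp) (mem_Icc_zero hq) (h.weightTilde_pos M n j))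
    (fun n j => abs_neg_covTerm_le (mem_Icc_succ hp) (mem_Icc_succ hq) (h.weightHat_pos M n j))
    (fun j => by
      have h2 := h.tendsto_level_add hinj hM hp hc h1 (cutoff_self hε _) hpk j
      have h3 := h.tendsto_level_add hinj hM hq hc' h1' (cutoff_self hε _) hpk' j
      have h4 := (tendsto_mul_sub_mul h2 h3
        (fun n => abs_expTerm_le_one (mem_Icc_zero hp) (h.weightTilde_pos M n j))
        (fun n => abs_expTerm_le_one (mem_Icc_zero hq) (h.weightTilde_pos M n j))).neg
      rw [neg_zero] at h4
      refine h4.congr fun n => ?_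
      rw [covTerm_eq, h0]
      ring)
    (fun j => by
      have h2 := h.tendsto_level_sub hinj hM hp hc h1 (cutoff_self hε _) hpk j
      have h3 := h.tendsto_level_sub hinj hM hq hc' h1' (cutoff_self hε _) hpk' j
      have h4 := (tendsto_mul_sub_mul h2 h3
        (fun n => abs_expTerm_le_one (mem_Icc_succ hp) (h.weightHat_pos M n j))
        (fun n => abs_expTerm_le_one (mem_Icc_succ hq) (h.weightHat_pos M n j))).neg
      rw [neg_zero] at h4
      refine h4.congr fun n => ?_
      rw [covTerm_eq, h0]
      ring)
  refine ⟨fun n => ⟨by simpa using (hsum n).1.neg, by simpa using (hsum n).2.neg⟩,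
    hlim.congr fun n => ?_⟩
  rw [tsum_neg, tsum_neg, ← sub_eq_add_neg]
  exact congrArg (· - _) (h.pot.covariance_radialSum (fun k hk => h.moment_one_pos hk)
    hc.measurable hc'.measurable h1 h1').symm

theorem _root_.CoulombGas.neg_tsum_covTerm_neg {K : Finset ℕ} {w : ℕ → ℕ → ℝ} (hp : p ∈ K)
    (hq : q ∈ K) (hw : ∀ j, ∀ k ∈ K, 0 < w j k) (hs : Summable fun j => covTerm K (w j) p q) :
    -(∑' j, covTerm K (w j) p q) < 0 := by
  have hpos : ∀ j, 0 < covTerm K (w j) p q := fun j => by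
    rw [covTerm_eq]
    exact mul_pos (expTerm_pos hp (hw j)) (expTerm_pos hq (hw j))
  exact neg_lt_zero.2 (hs.tsum_pos (fun j => (hpos j).le) 0 (hpos 0))

end IsTwoComponent

end CoulombGas

/-! ### Assembly of the three asymptotic formulas -/

theorem mainTheorem4
    (Q : ℂ → EReal) (hQ : CoulombGas.IsPotential Q)
    (m : ℕ) (a₀ b₀ a₁ b₁ : ℝ) (t : ℕ → ℝ)
    (ha₀ : 0 ≤ a₀) (hab₀ : a₀ < b₀) (hab₁ : a₁ < b₁) (hba : b₀ < a₁)
    (ht : ∀ k ∈ Finset.Icc 1 m, b₀ < t k ∧ t k < a₁)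
    (ht_mono : StrictMonoOn t (Set.Icc 1 m))
    (hS : CoulombGas.coincidenceSet Q =
      CoulombGas.annulus a₀ b₀ ∪ (⋃ k ∈ Finset.Icc 1 m, CoulombGas.circle (t k)) ∪
        CoulombGas.annulus a₁ b₁)
    (hsmooth : CoulombGas.IsC6Near Q (CoulombGas.coincidenceSet Q))
    (hpos : ∀ z ∈ CoulombGas.coincidenceSet Q, 0 < CoulombGas.quarterLaplacian Q z)
    (σ : Measure ℂ) (hσ : CoulombGas.IsEquilibriumMeasure Q σ)
    (M₀ : ℝ) (hM₀ : M₀ = σ.real {z | ‖z‖ ≤ b₀})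
    -- the `2ε`-neighbourhoods of the outposts meet neither each other nor the droplet
    (ε : ℝ) (hε : 0 < ε)
    (hε_sep : ∀ k ∈ Finset.Icc 1 m, ∀ l ∈ Finset.Icc 1 m, k < l → t k + 2 * ε ≤ t l - 2 * ε)
    (hε_drop : ∀ k ∈ Finset.Icc 1 m, b₀ ≤ t k - 2 * ε ∧ t k + 2 * ε ≤ a₁) :
    -- expectation
    (∀ p ∈ Finset.Icc 1 m,
      (∀ n : ℕ,
        Summable (fun j : ℕ => CoulombGas.expTerm (Finset.Icc 0 m) (CoulombGas.weightTilde Q b₀ a₁ t M₀ n j) p) ∧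
        Summable (fun j : ℕ => CoulombGas.expTerm (Finset.Icc 1 (m + 1))
          (CoulombGas.weightHat Q m b₀ a₁ t M₀ n j) p)) ∧
      Tendsto (fun n : ℕ => (∫ z, CoulombGas.count ε (t p) n z ∂(CoulombGas.gas Q n)) -
        ((∑' j : ℕ, CoulombGas.expTerm (Finset.Icc 0 m) (CoulombGas.weightTilde Q b₀ a₁ t M₀ n j) p) +
         ∑' j : ℕ, CoulombGas.expTerm (Finset.Icc 1 (m + 1))
          (CoulombGas.weightHat Q m b₀ a₁ t M₀ n j) p)) atTop (𝓝 0)) ∧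
    -- variance
    (∀ p ∈ Finset.Icc 1 m,
      (∀ n : ℕ,
        Summable (fun j : ℕ => CoulombGas.varTerm (Finset.Icc 0 m) (CoulombGas.weightTilde Q b₀ a₁ t M₀ n j) p) ∧
        Summable (fun j : ℕ => CoulombGas.varTerm (Finset.Icc 1 (m + 1))
          (CoulombGas.weightHat Q m b₀ a₁ t M₀ n j) p)) ∧
      Tendsto (fun n : ℕ => variance (CoulombGas.count ε (t p) n) (CoulombGas.gas Q n) -
        ((∑' j : ℕ, CoulombGas.varTerm (Finset.Icc 0 m) (CoulombGas.weightTilde Q b₀ a₁ t M₀ n j) p) +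
         ∑' j : ℕ, CoulombGas.varTerm (Finset.Icc 1 (m + 1))
          (CoulombGas.weightHat Q m b₀ a₁ t M₀ n j) p)) atTop (𝓝 0)) ∧
    -- covariance, a sum of two negative terms
    (∀ p ∈ Finset.Icc 1 m, ∀ q ∈ Finset.Icc 1 m, p ≠ q →
      (∀ n : ℕ,
        Summable (fun j : ℕ => CoulombGas.covTerm (Finset.Icc 0 m) (CoulombGas.weightTilde Q b₀ a₁ t M₀ n j) p q) ∧
        Summable (fun j : ℕ => CoulombGas.covTerm (Finset.Icc 1 (m + 1))
          (CoulombGas.weightHat Q m b₀ a₁ t M₀ n j) p q)) ∧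
      (∀ n : ℕ,
        -(∑' j : ℕ, CoulombGas.covTerm (Finset.Icc 0 m) (CoulombGas.weightTilde Q b₀ a₁ t M₀ n j) p q) < 0 ∧
        -(∑' j : ℕ, CoulombGas.covTerm (Finset.Icc 1 (m + 1))
          (CoulombGas.weightHat Q m b₀ a₁ t M₀ n j) p q) < 0) ∧
      Tendsto (fun n : ℕ => covariance (CoulombGas.count ε (t p) n) (CoulombGas.count ε (t q) n) (CoulombGas.gas Q n) -
        (-(∑' j : ℕ, CoulombGas.covTerm (Finset.Icc 0 m) (CoulombGas.weightTilde Q b₀ a₁ t M₀ n j) p q) -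
         ∑' j : ℕ, CoulombGas.covTerm (Finset.Icc 1 (m + 1))
          (CoulombGas.weightHat Q m b₀ a₁ t M₀ n j) p q)) atTop (𝓝 0)) := by
  have h : CoulombGas.IsTwoComponent Q m a₀ b₀ a₁ b₁ t :=
    ⟨hQ, ha₀, hab₀, hab₁, hba, ht, hS, hsmooth, hpos⟩
  -- The equilibrium measure enters the asymptotics only through this identity; everything else is
  -- expressed by the slope of the common tangent.
  have hM : CoulombGas.logSlope Q b₀ = 2 * M₀ := by
    rw [hM₀]
    exact h.logSlope_eq_mass hσ
  have hinj := ht_mono.injOn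
  refine ⟨fun p hp => h.tendsto_integral_count hinj hM hε hε_sep hε_drop hp,
    fun p hp => h.tendsto_variance_count hinj hM hε hε_sep hε_drop hp,
    fun p hp q hq hpq => ?_⟩
  obtain ⟨hsum, hlim⟩ := h.tendsto_covariance_count hinj hM hε hε_sep hε_drop hp hq hpq
  refine ⟨hsum, fun n => ⟨?_, ?_⟩, hlim⟩
  · exact CoulombGas.neg_tsum_covTerm_neg (CoulombGas.IsTwoComponent.mem_Icc_zero hp)
      (CoulombGas.IsTwoComponent.mem_Icc_zero hq) (fun j => h.weightTilde_pos M₀ n j) (hsum n).1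
  · exact CoulombGas.neg_tsum_covTerm_neg (CoulombGas.IsTwoComponent.mem_Icc_succ hp)
      (CoulombGas.IsTwoComponent.mem_Icc_succ hq) (fun j => h.weightHat_pos M₀ n j) (hsum n).2
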